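/- Let $M$ be an $n$-dimensional $C^\infty$ manifold and let $\mathcal F\colon TM\to\mathbb R$ be a Finsler function: $\mathcal F$ is continuous, smooth on $\hat TM=TM\setminus\{0\}$, positively homogeneous of degree $1$ on each tangent space, and $g_{ij}(x,y)=\tfrac12\,\partial^2\mathcal F^2/\partial y^i\partial y^j$ is positive definite for $y\neq 0$. In induced coordinates $(x^i,y^i)$ put $$G^i=\tfrac14 g^{il}\Big(2\frac{\partial g_{jl}}{\partial x^k}-\frac{\partial g_{jk}}{\partial x^l}\Big)y^jy^k,\qquad G^i_j=\frac{\partial G^i}{\partial y^j}.$$ A field $V(t)\neq0$ along a smooth curve $c$ is parallel if $\dot V^i+G^i_j(c,V)\dot c^j=0$. For $p\in M$ let $\mathcal I_pM=\{y\in T_pM:\mathcal F(y)=1\}$ be the indicatrix at $p$, let $\mathcal IM$ be the indicatrix bundle, and let $\mathrm{Hol}(p)$ be the subgroup of $\mathrm{Diff}^\infty(\mathcal I_pM)$ given by the parallel translations of $\mathcal I_pM$ along piecewise smooth closed curves at $p$. For vector fields $X,Y$ on $M$ let $X^h=X^i(\partial_{x^i}-G^k_i\,\partial_{y^k})$ be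 the horizontal lift, let $r(X,Y)$ be the curvature vector field on $\mathcal IM$, which is the vertical part of $[X^h,Y^h]$, and let $\nabla_X\xi=[X^h,\xi]$ be the horizontal Berwald derivative of a vertical field $\xi$. Let $\mathfrak{hol}_f(M)$ be the smallest Lie algebra of (vertical) vector fields on $\mathcal IM$ which contains $r(X,Y)$ for all smooth vector fields $X,Y$ on $M$, and which contains $\nabla_X\xi$ whenever it contains $\xi$ and $X$ is a smooth vector field on $M$. Here Lie algebras are taken over $\mathbb R$. The infinitesimal holonomy algebra at $p$ is $$\mathfrak{hol}^*(p)=\{\xi|_{\mathcal I_pM}:\xi\in\mathfrak{hol}_f(M)\}.$$ Theorem. For every $p\in M$, $\mathfrak{hol}^*(p)$ is a Lie subalgebra of the Lie algebra $\mathfrak X^\infty(\mathcal I_pM)$ of smooth vector fields on $\mathcal I_pM$, and it is tangent to $\mathrm{Hol}(p)$. That is, for every $\xi\in\mathfrak{hol}^*(p)$ there are $\varepsilon>0$ and a family of diffeomorphisms $\phi_t\in\mathrm{Hol}(p)$, $t\in(-\varepsilon,\varepsilon)$, which is $C^1$ (the map $(t,y)\mapsto\phi_t(y)$ is $C^1$),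 with $\phi_0=\mathrm{Id}$ and $\frac{\partial\phi_t}{\partial t}\big|_{t=0}=\xi$. -/

import Mathlib

open Set
open scoped Manifold ContDiff

noncomputable section

/-! ### Coordinate expressions

Below, `f : E → E → ℝ` is a Finsler function written in induced coordinates `(x, y)` of a
tangent bundle; `E` is the coordinate space. -/

section Coordinates

variable {E : Type*} [NormedAddCommGroup E] [NormedSpace ℝ E]

/-- `½ ∂²(f²)(y + s u + t v)/∂s∂t` at `s = t = 0`, as a bilinear form in `(u, v)`,
for a function `f` on one tangent space. -/
def fibreMetric (f : E → ℝ) (y : E) : E →L[ℝ] E →L[ℝ] ℝ :=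
  (1 / 2 : ℝ) • fderiv ℝ (fderiv ℝ (fun y' => f y' ^ 2)) y

/-- The geodesic coefficients
`G^i = ¼ g^{il} (2 ∂g_{jl}/∂x^k - ∂g_{jk}/∂x^l) y^j y^k`, as a vector of `E`.
The inverse matrix `g^{il}` is the inverse of `g_{(x,y)} : E → E*`. -/
def sprayCoeff (f : E → E → ℝ) (x y : E) : E :=
  (1 / 4 : ℝ) • (fibreMetric (f x) y).inverse
    ((2 : ℝ) • fderiv ℝ (fun x' => fibreMetric (f x') y y) x y
      - fderiv ℝ (fun x' => fibreMetric (f x') y y y) x)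

/-- The connection coefficients `G^i_j = ∂G^i/∂y^j`, as the linear map `u ↦ G^i_j u^j`. -/
def connCoeff (f : E → E → ℝ) (x y : E) : E →L[ℝ] E :=
  fderiv ℝ (sprayCoeff f x) y

/-- The curvature `R_{(x,y)}(u, v) = v[u^h, v^h]`, in coordinates
`R^i_{jk} u^j v^k` with
`R^i_{jk} = ∂G^i_j/∂x^k - ∂G^i_k/∂x^j + G^m_j ∂G^i_k/∂y^m - G^m_k ∂G^i_j/∂y^m`. -/
def curvatureCoeff (f : E → E → ℝ) (x y u v : E) : E :=
  fderiv ℝ (fun x' => connCoeff f x' y) x v u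
    - fderiv ℝ (fun x' => connCoeff f x' y) x u v
    + fderiv ℝ (connCoeff f x) y (connCoeff f x y u) v
    - fderiv ℝ (connCoeff f x) y (connCoeff f x y v) u

/-- The horizontal Berwald derivative `∇_u ξ = [u^h, ξ]` of a vertical field
`ξ^i(x, y) ∂/∂y^i`, in coordinates
`(∂ξ^i/∂x^j - G^k_j ∂ξ^i/∂y^k + (∂G^i_j/∂y^k) ξ^k) u^j`. -/
def berwaldCoeff (f : E → E → ℝ) (ξ : E → E → E) (x y u : E) : E :=
  fderiv ℝ (fun x' => ξ x' y) x u
    - fderiv ℝ (ξ x) y (connCoeff f x y u)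
    + fderiv ℝ (connCoeff f x) y (ξ x y) u

end Coordinates

/-! ### Finsler manifolds -/

/-- A Finsler function on `M`: a continuous function on `TM`, smooth off the zero section,
positively homogeneous of degree one on each tangent space, with positive definite Finsler
metric. The tangent space `T_xM` is, as a vector space, the model space `E`, read in the
preferred chart at `x`. -/
structure FinslerFunction (E : Type*) [NormedAddCommGroup E] [NormedSpace ℝ E]
    (M : Type*) [TopologicalSpace M] [ChartedSpace E M] [IsManifold 𝓘(ℝ, E) ∞ M] where
  toFun : TangentBundle 𝓘(ℝ, E) M → ℝ
  continuous_toFun : Continuous toFun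
  smooth_toFun : ContMDiffOn (𝓘(ℝ, E).tangent) 𝓘(ℝ, ℝ) ∞ toFun {v | v.2 ≠ 0}
  homogeneous : ∀ (x : M) (y : E) (r : ℝ), 0 < r → toFun ⟨x, r • y⟩ = r * toFun ⟨x, y⟩
  posDef : ∀ (x : M) (y : E), y ≠ 0 → ∀ u : E, u ≠ 0 →
    0 < fibreMetric (fun y' : E => toFun ⟨x, y'⟩) y u u

section Finsler

variable {E : Type*} [NormedAddCommGroup E] [NormedSpace ℝ E]
  {M : Type*} [TopologicalSpace M] [ChartedSpace E M] [IsManifold 𝓘(ℝ, E) ∞ M]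

namespace FinslerFunction

variable (F : FinslerFunction E M)

/-- The value of the Finsler function at `y ∈ T_xM`. -/
def val (x : M) (y : E) : ℝ := F.toFun ⟨x, y⟩

/-- The indicatrix `I_pM = {y ∈ T_pM : F(y) = 1}`. -/
def Indicatrix (p : M) : Type _ := {y : E // F.val p y = 1}

/-- The open cone `{y ∈ T_pM : F(y) > 0}` over the indicatrix. -/
def cone (p : M) : Set E := {y | 0 < F.val p y}

variable {F}

/-- The point `y / F(y)` of the indicatrix. -/
def normalize {p : M} (y : E) (hy : 0 < F.val p y) : F.Indicatrix p :=
  ⟨(F.val p y)⁻¹ • y, by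
    have h := F.homogeneous p y (F.val p y)⁻¹ (inv_pos.mpr hy)
    have h2 : F.val p ((F.val p y)⁻¹ • y) = (F.val p y)⁻¹ * F.val p y := h
    rw [h2, inv_mul_cancel₀ hy.ne']⟩

open Classical in
/-- The extension `y ↦ F(y) f(y / F(y))`, positively homogeneous of degree one, of a map
`f : I_pM → T_pM` to the open cone over `I_pM` (and `0` elsewhere). -/
def homExt {p : M} (f : F.Indicatrix p → E) (y : E) : E :=
  if hy : 0 < F.val p y then F.val p y • f (normalize y hy) else 0

/-- Smoothness of a map `I_pM → T_pM` on the hypersurface `I_pM` of `T_pM`. As `F` is smooth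
and positive on the cone, `f` is smooth if and only if its homogeneous extension is smooth. -/
def IsSmoothOnIndicatrix {p : M} (f : F.Indicatrix p → E) : Prop :=
  ContDiffOn ℝ ∞ (homExt f) (F.cone p)

/-- Elements of `𝔛^∞(I_pM)`: smooth maps `ξ : I_pM → T_pM` with `ξ(y)` tangent to the level
set `I_pM` of `F` at `y`. -/
def IsVectorField {p : M} (ξ : F.Indicatrix p → E) : Prop :=
  IsSmoothOnIndicatrix ξ ∧ ∀ y : F.Indicatrix p, fderiv ℝ (F.val p) y.1 (ξ y) = 0

/-- The Lie bracket of vector fields on `I_pM`, computed in the vector space `T_pM` with the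
homogeneous extensions (for fields tangent to `I_pM` the value on `I_pM` does not depend on
the extensions). -/
def bracket {p : M} (ξ η : F.Indicatrix p → E) : F.Indicatrix p → E :=
  fun y => VectorField.lieBracket ℝ (homExt ξ) (homExt η) y.1

theorem val_homExt_of_mem {p : M} (φ : F.Indicatrix p → F.Indicatrix p) {y : E}
    (hy : 0 < F.val p y) : F.val p (homExt (fun z => (φ z).1) y) = F.val p y := by
  have h : F.val p (F.val p y • (φ (normalize y hy)).1)
      = F.val p y * F.val p (φ (normalize y hy)).1 := F.homogeneous p _ _ hy
  rw [homExt, dif_pos hy, h, (φ (normalize y hy)).2, mul_one]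

theorem homExt_comp {p : M} (φ ψ : F.Indicatrix p → F.Indicatrix p) {y : E}
    (hy : 0 < F.val p y) :
    homExt (fun z => (φ (ψ z)).1) y
      = homExt (fun z => (φ z).1) (homExt (fun z => (ψ z).1) y) := by
  have h1 := val_homExt_of_mem ψ hy
  have h2 : 0 < F.val p (homExt (fun z => (ψ z).1) y) := by rw [h1]; exact hy
  have h3 : normalize (homExt (fun z => (ψ z).1) y) h2 = ψ (normalize y hy) := by
    apply Subtype.ext
    change (F.val p (homExt (fun z => (ψ z).1) y))⁻¹ • (homExt (fun z => (ψ z).1) y) = _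
    rw [h1, homExt, dif_pos hy, smul_smul, inv_mul_cancel₀ hy.ne', one_smul]
  rw [homExt, dif_pos hy, homExt, dif_pos h2, h3, h1]

theorem homExt_id {p : M} {y : E} (hy : 0 < F.val p y) :
    homExt (fun z : F.Indicatrix p => z.1) y = y := by
  rw [homExt, dif_pos hy]
  change F.val p y • ((F.val p y)⁻¹ • y) = y
  rw [smul_smul, mul_inv_cancel₀ hy.ne', one_smul]

theorem IsSmoothOnIndicatrix.comp {p : M} {φ ψ : F.Indicatrix p → F.Indicatrix p}
    (hφ : IsSmoothOnIndicatrix (fun z => (φ z).1))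
    (hψ : IsSmoothOnIndicatrix (fun z => (ψ z).1)) :
    IsSmoothOnIndicatrix (fun z => (φ (ψ z)).1) := by
  have h : ContDiffOn ℝ ∞
      (homExt (fun z => (φ z).1) ∘ homExt (fun z => (ψ z).1)) (F.cone p) := by
    refine ContDiffOn.comp hφ hψ ?_
    intro y hy
    change 0 < F.val p _
    rw [val_homExt_of_mem ψ hy]
    exact hy
  exact h.congr (fun y hy => homExt_comp φ ψ hy)

theorem isSmoothOnIndicatrix_id {p : M} :
    IsSmoothOnIndicatrix (fun z : F.Indicatrix p => z.1) :=
  contDiffOn_id.congr (fun _ hy => homExt_id hy)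

variable (F)

/-- The group `Diff^∞(I_pM)` of smooth diffeomorphisms of the indicatrix. -/
def diffGroup (p : M) : Subgroup (Equiv.Perm (F.Indicatrix p)) where
  carrier := {φ | IsSmoothOnIndicatrix (fun z => (φ z).1) ∧
    IsSmoothOnIndicatrix (fun z => (φ.symm z).1)}
  mul_mem' := fun {φ ψ} hφ hψ =>
    ⟨IsSmoothOnIndicatrix.comp (φ := φ) (ψ := ψ) hφ.1 hψ.1,
      IsSmoothOnIndicatrix.comp (φ := ψ.symm) (ψ := φ.symm) hψ.2 hφ.2⟩
  one_mem' := ⟨isSmoothOnIndicatrix_id, isSmoothOnIndicatrix_id⟩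
  inv_mem' := fun hφ => ⟨hφ.2, hφ.1⟩

/-- A vector field `ξ` on `I_pM` is tangent to a subgroup `K` of `Diff^∞(I_pM)` if there is
a `C¹` family `φ_t ∈ K`, `-ε < t < ε`, with `φ_0 = Id` and `∂φ_t/∂t = ξ` at `t = 0`. -/
def IsTangentTo {p : M} (K : Subgroup (F.diffGroup p)) (ξ : F.Indicatrix p → E) : Prop :=
  ∃ ε : ℝ, 0 < ε ∧ ∃ φ : ℝ → F.diffGroup p,
    (∀ t ∈ Ioo (-ε) ε, φ t ∈ K) ∧
    ContDiffOn ℝ 1 (fun q : ℝ × E => homExt (fun z => ((φ q.1).1 z).1) q.2)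
      (Ioo (-ε) ε ×ˢ F.cone p) ∧
    φ 0 = 1 ∧
    ∀ y : F.Indicatrix p, HasDerivAt (fun t => ((φ t).1 y).1) (ξ y) 0

/-- `S` is a Lie subalgebra of `𝔛^∞(I_pM)`. -/
structure IsLieSubalgebra {p : M} (S : Set (F.Indicatrix p → E)) : Prop where
  isVectorField : ∀ ξ ∈ S, IsVectorField ξ
  zero_mem : 0 ∈ S
  add_mem : ∀ ξ ∈ S, ∀ η ∈ S, ξ + η ∈ S
  smul_mem : ∀ (r : ℝ), ∀ ξ ∈ S, r • ξ ∈ S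
  bracket_mem : ∀ ξ ∈ S, ∀ η ∈ S, bracket ξ η ∈ S

/-! ### Parallel translation and the holonomy group -/

/-- The vector of coordinates `(y^1, …, y^n)` of a tangent vector in the coordinate system
induced by the preferred chart at `q`. -/
def fibreCoord (q : M) (v : TangentBundle 𝓘(ℝ, E) M) : E :=
  tangentCoordChange 𝓘(ℝ, E) v.proj q v.proj v.2

/-- The Finsler function in the coordinates `(x, y)` induced by the preferred chart at `q`. -/
def coordFun (q : M) (x y : E) : ℝ :=
  F.val ((extChartAt 𝓘(ℝ, E) q).symm x)
    (tangentCoordChange 𝓘(ℝ, E) q ((extChartAt 𝓘(ℝ, E) q).symm x)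
      ((extChartAt 𝓘(ℝ, E) q).symm x) y)

/-- `V` is a parallel field of nonzero tangent vectors along `c : [0, 1] → M`: at each time
`t`, in the coordinates induced by the chart at `c(t)`,
`dV^i/dt + G^i_j(c, V) dc^j/dt = 0`. -/
structure IsParallelAlong (c : ℝ → M) (V : ℝ → TangentBundle 𝓘(ℝ, E) M) : Prop where
  proj_eq : ∀ t ∈ Icc (0 : ℝ) 1, (V t).proj = c t
  ne_zero : ∀ t ∈ Icc (0 : ℝ) 1, (V t).2 ≠ 0
  hasDeriv : ∀ t ∈ Icc (0 : ℝ) 1,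
    HasDerivWithinAt (fun s => fibreCoord (c t) (V s))
      (-(connCoeff (F.coordFun (c t)) (extChartAt 𝓘(ℝ, E) (c t) (c t))
          (fibreCoord (c t) (V t))
          (derivWithin (fun s => extChartAt 𝓘(ℝ, E) (c t) (c s)) (Icc 0 1) t)))
      (Icc 0 1) t

/-- `IsParallelTranslation F p q τ`: the map `τ : I_pM → I_qM` is the parallel translation
along some piecewise smooth curve from `p` to `q`, that is, a composition of parallel
translations along finitely many consecutive smooth curves `[0, 1] → M`. -/
inductive IsParallelTranslation :
    (p q : M) → (F.Indicatrix p → F.Indicatrix q) → Prop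
  | smooth (p q : M) (c : ℝ → M) (hc : ContMDiffOn 𝓘(ℝ, ℝ) 𝓘(ℝ, E) ∞ c (Icc 0 1))
      (h0 : c 0 = p) (h1 : c 1 = q) (τ : F.Indicatrix p → F.Indicatrix q)
      (hτ : ∀ y : F.Indicatrix p, ∃ V : ℝ → TangentBundle 𝓘(ℝ, E) M,
        F.IsParallelAlong c V ∧ V 0 = ⟨p, y.1⟩ ∧ V 1 = ⟨q, (τ y).1⟩) :
      IsParallelTranslation p q τ
  | trans (p q r : M) (σ : F.Indicatrix p → F.Indicatrix q)
      (τ : F.Indicatrix q → F.Indicatrix r)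
      (hσ : IsParallelTranslation p q σ) (hτ : IsParallelTranslation q r τ) :
      IsParallelTranslation p r (τ ∘ σ)

/-- The holonomy group `Hol(p)`: the subgroup of `Diff^∞(I_pM)` given by the parallel
translations along piecewise smooth closed curves at `p`. -/
def holonomyGroup (p : M) : Subgroup (F.diffGroup p) :=
  Subgroup.closure {φ | F.IsParallelTranslation p p φ.1}

/-! ### The fibred and the infinitesimal holonomy algebra -/

/-- A vertical vector field on the indicatrix bundle `IM`: for each `x`, a map `I_xM → T_xM`
(the vertical tangent space at `(x, y)` is identified with `T_xM`). -/
abbrev VerticalField : Type _ := (x : M) → F.Indicatrix x → E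

variable {F} in
/-- A vertical field on `IM`, extended homogeneously along the fibres, in the coordinates
`(x, y)` induced by the preferred chart at `q`. -/
def coordField (ξ : F.VerticalField) (q : M) (x y : E) : E :=
  tangentCoordChange 𝓘(ℝ, E) ((extChartAt 𝓘(ℝ, E) q).symm x) q
    ((extChartAt 𝓘(ℝ, E) q).symm x)
    (homExt (ξ ((extChartAt 𝓘(ℝ, E) q).symm x))
      (tangentCoordChange 𝓘(ℝ, E) q ((extChartAt 𝓘(ℝ, E) q).symm x)
        ((extChartAt 𝓘(ℝ, E) q).symm x) y))

/-- `X` is a smooth vector field on `M`. -/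
def _root_.IsSmoothField (X : (x : M) → TangentSpace 𝓘(ℝ, E) x) : Prop :=
  ContMDiff 𝓘(ℝ, E) (𝓘(ℝ, E).tangent) ∞
    (fun x => (⟨x, X x⟩ : TangentBundle 𝓘(ℝ, E) M))

/-- The curvature vector field `r(X, Y)(x, y) = R_{(x,y)}(X_x, Y_x)`, computed at each `x` in
the chart at `x`. -/
def curvatureField (X Y : (x : M) → TangentSpace 𝓘(ℝ, E) x) : F.VerticalField :=
  fun x y => curvatureCoeff (F.coordFun x) (extChartAt 𝓘(ℝ, E) x x) y.1 (X x) (Y x)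

variable {F} in
/-- The horizontal Berwald covariant derivative `∇_X ξ = [X^h, ξ]` on `IM`, computed at each
`x` in the chart at `x`. As `X^h` is tangent to `IM`, the value on `IM` does not depend on the
extension of `ξ`. -/
def covariantDeriv (X : (x : M) → TangentSpace 𝓘(ℝ, E) x) (ξ : F.VerticalField) :
    F.VerticalField :=
  fun x y => berwaldCoeff (F.coordFun x) (coordField ξ x) (extChartAt 𝓘(ℝ, E) x x) y.1 (X x)

/-- Membership in the fibred holonomy algebra `hol_f(M)`: the smallest Lie algebra of vector
fields on `IM` that contains the curvature vector fields and is closed under `∇_X` for every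
smooth vector field `X` on `M`. All its elements are vertical, and the Lie bracket of vertical
fields is taken fibre by fibre. -/
inductive FibredHolonomyAlgebra : F.VerticalField → Prop
  | curvature (X Y : (x : M) → TangentSpace 𝓘(ℝ, E) x) (hX : IsSmoothField X)
      (hY : IsSmoothField Y) : FibredHolonomyAlgebra (F.curvatureField X Y)
  | covariantDeriv (X : (x : M) → TangentSpace 𝓘(ℝ, E) x) (hX : IsSmoothField X)
      (ξ : F.VerticalField) (hξ : FibredHolonomyAlgebra ξ) :
      FibredHolonomyAlgebra (covariantDeriv X ξ)
  | zero : FibredHolonomyAlgebra 0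
  | add (ξ η : F.VerticalField) (hξ : FibredHolonomyAlgebra ξ)
      (hη : FibredHolonomyAlgebra η) : FibredHolonomyAlgebra (ξ + η)
  | smul (r : ℝ) (ξ : F.VerticalField) (hξ : FibredHolonomyAlgebra ξ) :
      FibredHolonomyAlgebra (r • ξ)
  | bracket (ξ η : F.VerticalField) (hξ : FibredHolonomyAlgebra ξ)
      (hη : FibredHolonomyAlgebra η) : FibredHolonomyAlgebra (fun x => bracket (ξ x) (η x))

/-- The infinitesimal holonomy algebra `hol*(p) = {ξ|_{I_pM} : ξ ∈ hol_f(M)}`. -/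
def infinitesimalHolonomyAlgebra (p : M) : Set (F.Indicatrix p → E) :=
  {ζ | ∃ ξ : F.VerticalField, F.FibredHolonomyAlgebra ξ ∧ ξ p = ζ}

end FinslerFunction

end Finsler

end

/-! Work in a chart. Call ξ the leading field of order k of a smooth family of holonomies Φ(t, x,
·), one for every base point x near x₀, if Φ(t, x, y) = y + t ^ k ξ(x, y) + O(t ^ (k + 1)); this is
`HolonomyFamily`. The leading fields have all the closure properties that define hol_f(M), so every
element of hol_f(M) leads such a family (`FibredHolonomyAlgebra.exists_holonomyFamily`).

The geometric closure properties come from one computation, `exists_commutator`: the commutator of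
id + t ^ k A and id + t ^ l B is id + t ^ (k + l) C, where C at t = 0 is the Lie bracket of B and A.
Applied to two families of holonomies, it gives the fibrewise bracket. Applied to a family and to
parallel transport along tX, it gives [X^h, ξ], the Berwald derivative; this is why the base point
has to vary. Applied to transports along tX and tY, it gives transport around a small parallelogram
and the curvature, with k = 2.

The linear structure comes from composition. Families of equal order compose to the sum of their
fields. For a real r of either sign, Φ_{t + (r/k) t ^ 2} ∘ Φ_t⁻¹ has order k + 1 and leading field r
ξ; with r = 1 this raises the order without changing the field, so that orders can be matched and
made odd.

Once k is odd, the substitution t = s ^ (1/k) is defined for both signs of s and turns the family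
into y + s A(s ^ (1/k), y). This is C¹ in (s, y), although the root is not differentiable at 0 for k
> 1, and its derivative at s = 0 is ξ (`HolonomyFamily.isTangentTo`).

Two supports remain. Parallel transport must be smooth in the base point, the displacement and the
vector; this follows from the inverse function theorem on a space of continuous paths
(`exists_smooth_flow`), and homogeneity makes short transports defined on all nonzero vectors at
once. Moreover connection, curvature and Berwald derivative are defined at each point in that
point's own chart, so their invariance under changes of coordinates is needed (`IsCoordChange`). -/

open Filter Topology

noncomputable section

universe u

set_option linter.unusedSectionVars false

/-! ### Composition operators on spaces of continuous paths -/

section Nemytskii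

/-- The composition operator `γ ↦ f ∘ γ` on continuous maps from the unit interval. -/
def postcompMap {E F : Type*} [TopologicalSpace E] [TopologicalSpace F] (f : C(E, F))
    (γ : C(unitInterval, E)) : C(unitInterval, F) := f.comp γ

theorem continuous_postcompMap {E F : Type*} [TopologicalSpace E] [TopologicalSpace F]
    (f : C(E, F)) : Continuous (postcompMap f) :=
  ContinuousMap.continuous_postcomp f

variable {E F G : Type*} [NormedAddCommGroup E] [NormedSpace ℝ E]
  [NormedAddCommGroup F] [NormedSpace ℝ F] [NormedAddCommGroup G] [NormedSpace ℝ G]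

/-- Pointwise application of a path of continuous linear maps to a path of vectors. -/
def pathApply : C(unitInterval, E →L[ℝ] F) →L[ℝ] C(unitInterval, E) →L[ℝ] C(unitInterval, F) :=
  LinearMap.mkContinuous₂
    (LinearMap.mk₂ ℝ (fun (A : C(unitInterval, E →L[ℝ] F)) (h : C(unitInterval, E)) =>
        (⟨fun s => A s (h s), by fun_prop⟩ : C(unitInterval, F)))
      (fun _ _ _ => by ext; simp) (fun _ _ _ => by ext; simp)
      (fun _ _ _ => by ext; simp) (fun _ _ _ => by ext; simp)) 1
    (fun A h => by
      rw [one_mul, ContinuousMap.norm_le _ (by positivity)]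
      intro s
      exact ((A s).le_opNorm (h s)).trans
        (mul_le_mul (A.norm_coe_le_norm s) (h.norm_coe_le_norm s) (norm_nonneg _)
          (norm_nonneg A)))

/-- At each parameter the remainder is bounded by the mean value inequality on the segment from γ s
to γ s + h s. The oscillation of `f'` there is small uniformly in s because composition with `f'` is
itself continuous in the sup norm. -/
theorem hasFDerivAt_postcompMap (f : C(E, F)) (f' : C(E, E →L[ℝ] F))
    (hf : ∀ x, HasFDerivAt f (f' x) x) (γ : C(unitInterval, E)) :
    HasFDerivAt (postcompMap f) (pathApply (postcompMap f' γ)) γ := by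
  rw [hasFDerivAt_iff_isLittleO_nhds_zero, Asymptotics.isLittleO_iff]
  intro c hc
  have hcont := (continuous_postcompMap f').continuousAt (x := γ)
  obtain ⟨δ, hδ, hball⟩ := (Metric.continuousAt_iff (α := C(unitInterval, E))
    (β := C(unitInterval, E →L[ℝ] F))).1 hcont c hc
  filter_upwards [Metric.ball_mem_nhds (0 : C(unitInterval, E)) hδ] with h hh
  rw [mem_ball_zero_iff] at hh
  rw [ContinuousMap.norm_le _ (by positivity)]
  intro s
  have hseg : ∀ x ∈ segment ℝ (γ s) (γ s + h s), ‖f' x - f' (γ s)‖ ≤ c := by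
    intro x hx
    rw [segment_eq_image'] at hx
    obtain ⟨θ, hθ, rfl⟩ := hx
    have hb := hball (x := γ + θ • h) (by
      rw [dist_eq_norm, add_sub_cancel_left, norm_smul, Real.norm_of_nonneg hθ.1]
      exact (mul_le_of_le_one_left (norm_nonneg _) hθ.2).trans_lt hh)
    have := ContinuousMap.dist_apply_le_dist (f := postcompMap f' (γ + θ • h))
      (g := postcompMap f' γ) s
    rw [dist_eq_norm] at this
    simpa [postcompMap] using this.trans hb.le
  have key := (convex_segment (γ s) (γ s + h s)).norm_image_sub_le_of_norm_hasFDerivWithin_le'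
    (f := f) (φ := f' (γ s)) (fun x _ => (hf x).hasFDerivWithinAt) hseg
    (left_mem_segment ℝ _ _) (right_mem_segment ℝ _ _)
  simp only [add_sub_cancel_left] at key
  exact key.trans (mul_le_mul_of_nonneg_left (h.norm_coe_le_norm s) hc.le)

/-- The derivative is a bounded bilinear operation applied to composition with `fderiv ℝ f`, so one
more derivative of `f` gives one more derivative of the operator. The spaces vary in the induction
because the target becomes `E →L[ℝ] F`; a common universe keeps that target within reach of the
induction hypothesis. -/
theorem contDiff_postcompMap_nat (n : ℕ) : ∀ {E F : Type u} [NormedAddCommGroup E]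
    [NormedSpace ℝ E] [NormedAddCommGroup F] [NormedSpace ℝ F] (f : C(E, F)),
    ContDiff ℝ ∞ f → ContDiff ℝ n (postcompMap f) := by
  induction n with
  | zero =>
    intro E F _ _ _ _ f _
    exact contDiff_zero.2 (continuous_postcompMap f)
  | succ n ih =>
    intro E F _ _ _ _ f hf
    have hf' : ContDiff ℝ ∞ (fderiv ℝ f) := hf.fderiv_right (by simp)
    let f' : C(E, E →L[ℝ] F) := ⟨fderiv ℝ f, hf'.continuous⟩
    have hd := hasFDerivAt_postcompMap f f'
      (fun x => (hf.differentiable (by simp) x).hasFDerivAt)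
    rw [show ((n + 1 : ℕ) : WithTop ℕ∞) = (n : WithTop ℕ∞) + 1 by norm_cast,
      contDiff_succ_iff_fderiv]
    refine ⟨fun γ => (hd γ).differentiableAt, by simp, ?_⟩
    have : fderiv ℝ (postcompMap f) = fun γ => pathApply (postcompMap f' γ) :=
      funext fun γ => (hd γ).fderiv
    rw [this]
    exact (ContinuousLinearMap.contDiff (E := C(unitInterval, E →L[ℝ] F))
      (F := C(unitInterval, E) →L[ℝ] C(unitInterval, F)) pathApply).comp (ih f' hf')

theorem contDiff_postcompMap {E F : Type u} [NormedAddCommGroup E]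
    [NormedSpace ℝ E] [NormedAddCommGroup F] [NormedSpace ℝ F] (f : C(E, F))
    (hf : ContDiff ℝ ∞ f) : ContDiff ℝ ∞ (postcompMap f) :=
  contDiff_infty.2 fun n => contDiff_postcompMap_nat n f hf

/-- The integral over `[0, 1]` of a continuous path. -/
def pathIntegral (F : Type*) [NormedAddCommGroup F] [NormedSpace ℝ F] :
    C(unitInterval, F) →L[ℝ] F :=
  LinearMap.mkContinuous
    { toFun := fun γ => ∫ s in (0 : ℝ)..1, γ (projIcc 0 1 zero_le_one s)
      map_add' := fun γ η => by
        simp only [ContinuousMap.add_apply]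
        exact intervalIntegral.integral_add
          ((by fun_prop : Continuous _).intervalIntegrable _ _)
          ((by fun_prop : Continuous _).intervalIntegrable _ _)
      map_smul' := fun c γ => by simp } 1
    (fun γ => by
      have := intervalIntegral.norm_integral_le_of_norm_le_const (a := (0 : ℝ)) (b := 1)
        (f := fun s => γ (projIcc 0 1 zero_le_one s)) (C := ‖γ‖)
        (fun s _ => γ.norm_coe_le_norm _)
      simpa using this)

/-- The primitive `s ↦ ∫ r in 0..s, γ r` of a continuous path. -/
def pathPrimitive (F : Type*) [NormedAddCommGroup F] [NormedSpace ℝ F] :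
    C(unitInterval, F) →L[ℝ] C(unitInterval, F) :=
  LinearMap.mkContinuous
    { toFun := fun γ => ⟨fun s => ∫ r in (0 : ℝ)..s, γ (projIcc 0 1 zero_le_one r),
        (intervalIntegral.continuous_primitive
          (fun _ _ => (by fun_prop : Continuous fun r => γ (projIcc 0 1 zero_le_one r)
            ).intervalIntegrable _ _) 0).comp continuous_subtype_val⟩
      map_add' := fun γ η => by
        ext s
        simp only [ContinuousMap.add_apply, ContinuousMap.coe_mk]
        exact intervalIntegral.integral_add
          ((by fun_prop : Continuous _).intervalIntegrable _ _)
          ((by fun_prop : Continuous _).intervalIntegrable _ _)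
      map_smul' := fun c γ => by ext s; simp } 1
    (fun γ => by
      rw [one_mul, ContinuousMap.norm_le _ (norm_nonneg _)]
      intro s
      have := intervalIntegral.norm_integral_le_of_norm_le_const (a := (0 : ℝ)) (b := s)
        (f := fun s => γ (projIcc 0 1 zero_le_one s)) (C := ‖γ‖)
        (fun s _ => γ.norm_coe_le_norm _)
      refine this.trans ?_
      rw [sub_zero, abs_of_nonneg s.2.1]
      exact mul_le_of_le_one_right (norm_nonneg _) s.2.2)

end Nemytskii

/-! ### Hadamard's lemma -/

/-- The quotient is g(t, z) = ∫₀¹ ∂ₜf(st, z) ds. Its smoothness needs no differentiation under the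
integral sign: it is a linear path s ↦ (st, z), followed by a smooth composition operator and a
bounded linear integral. -/
theorem exists_hadamard {Z F : Type u} [NormedAddCommGroup Z] [NormedSpace ℝ Z]
    [NormedAddCommGroup F] [NormedSpace ℝ F] [CompleteSpace F] {f : ℝ × Z → F}
    (hf : ContDiff ℝ ∞ f) :
    ∃ g : ℝ × Z → F, ContDiff ℝ ∞ g ∧ (∀ t z, f (t, z) = f (0, z) + t • g (t, z)) ∧
      ∀ z, g (0, z) = fderiv ℝ f (0, z) (1, 0) := by
  -- `ULift` moves the real factor into the universe of `Z` and `F`, as `contDiff_postcompMap`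
  -- requires.
  let d : ULift.{u} ℝ × Z → F := fun q => fderiv ℝ f (q.1.down, q.2) (1, 0)
  have hf' : ContDiff ℝ ∞ (fderiv ℝ f) := hf.fderiv_right (by simp)
  have hdown : ContDiff ℝ ∞ (fun q : ULift.{u} ℝ × Z => ((q.1.down, q.2) : ℝ × Z)) :=
    ((ContinuousLinearEquiv.ulift (R₁ := ℝ) (M₁ := ℝ)).contDiff.comp contDiff_fst).prodMk
      contDiff_snd
  have hd : ContDiff ℝ ∞ d := (hf'.comp hdown).clm_apply contDiff_const
  let line : ℝ × Z →L[ℝ] C(unitInterval, ULift.{u} ℝ × Z) :=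
    LinearMap.mkContinuous
      { toFun := fun q => ⟨fun s => (⟨s * q.1⟩, q.2), by fun_prop⟩
        map_add' := fun q r => by ext s <;> simp [mul_add]
        map_smul' := fun c q => by ext s <;> simp [mul_left_comm] } 1
      (fun q => by
        rw [one_mul, ContinuousMap.norm_le _ (norm_nonneg _)]
        intro s
        refine max_le ?_ (norm_snd_le q)
        change ‖(s : ℝ) * q.1‖ ≤ _
        rw [norm_mul, Real.norm_of_nonneg s.2.1]
        exact (mul_le_of_le_one_left (norm_nonneg _) s.2.2).trans (norm_fst_le q))
  refine ⟨fun q => pathIntegral F (postcompMap ⟨d, hd.continuous⟩ (line q)),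
    (pathIntegral F).contDiff.comp ((contDiff_postcompMap _ hd).comp line.contDiff), ?_, ?_⟩
  · intro t z
    have hI : pathIntegral F (postcompMap ⟨d, hd.continuous⟩ (line (t, z)))
        = ∫ s in (0 : ℝ)..1, fderiv ℝ f (s * t, z) (1, 0) := by
      change ∫ s in (0 : ℝ)..1, fderiv ℝ f ((projIcc 0 1 zero_le_one s : ℝ) * t, z) (1, 0) = _
      refine intervalIntegral.integral_congr fun s hs => ?_
      rw [uIcc_of_le zero_le_one] at hs
      simp only [projIcc_of_mem zero_le_one hs]
    dsimp only
    rw [hI, ← intervalIntegral.integral_smul]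
    have hder : ∀ s ∈ uIcc (0 : ℝ) 1, HasDerivAt (fun s : ℝ => f (s * t, z))
        (t • fderiv ℝ f (s * t, z) (1, 0)) s := by
      intro s _
      have h1 : HasDerivAt (fun s : ℝ => ((s * t, z) : ℝ × Z)) (t, 0) s :=
        (by simpa using (hasDerivAt_id s).mul_const t :
          HasDerivAt (fun s : ℝ => s * t) t s).prodMk (hasDerivAt_const s z)
      have h2 := (hf.differentiable (by simp) (s * t, z)).hasFDerivAt.comp_hasDerivAt s h1
      have h3 : ((t, 0) : ℝ × Z) = t • (1, 0) := by simp
      rw [h3, map_smul] at h2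
      exact h2
    have hcont : Continuous fun s : ℝ => t • fderiv ℝ f (s * t, z) (1, 0) := by
      have := hf'.continuous
      fun_prop
    rw [intervalIntegral.integral_eq_sub_of_hasDerivAt hder (hcont.intervalIntegrable _ _)]
    simp
  · intro z
    change ∫ s in (0 : ℝ)..1, fderiv ℝ f ((projIcc 0 1 zero_le_one s : ℝ) * 0, z) (1, 0) = _
    simp

/-! ### Germs of smooth maps -/

section GermSmooth

variable {E F G : Type*} [NormedAddCommGroup E] [NormedSpace ℝ E]
  [NormedAddCommGroup F] [NormedSpace ℝ F] [NormedAddCommGroup G] [NormedSpace ℝ G]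

/-- `f` agrees near `z` with a smooth map defined on the whole space. -/
def GermSmooth (f : E → F) (z : E) : Prop :=
  ∃ g : E → F, ContDiff ℝ ∞ g ∧ f =ᶠ[𝓝 z] g

theorem ContDiff.germSmooth {f : E → F} (hf : ContDiff ℝ ∞ f) (z : E) : GermSmooth f z :=
  ⟨f, hf, EventuallyEq.rfl⟩

namespace GermSmooth

variable {f : E → F} {z : E}

theorem contDiffAt (h : GermSmooth f z) : ContDiffAt ℝ ∞ f z := by
  obtain ⟨g, hg, hfg⟩ := h
  exact hg.contDiffAt.congr_of_eventuallyEq hfg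

theorem continuousAt (h : GermSmooth f z) : ContinuousAt f z :=
  h.contDiffAt.continuousAt

theorem eventually (h : GermSmooth f z) : ∀ᶠ z' in 𝓝 z, GermSmooth f z' := by
  obtain ⟨g, hg, hfg⟩ := h
  filter_upwards [hfg.eventuallyEq_nhds] with z' hz'
  exact ⟨g, hg, hz'⟩

theorem congr {f' : E → F} (h : GermSmooth f z) (hf : f' =ᶠ[𝓝 z] f) : GermSmooth f' z := by
  obtain ⟨g, hg, hfg⟩ := h
  exact ⟨g, hg, hf.trans hfg⟩

theorem comp {h : G → E} {w : G} (hf : GermSmooth f (h w)) (hh : GermSmooth h w) :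
    GermSmooth (fun x => f (h x)) w := by
  obtain ⟨g, hg, hfg⟩ := hf
  obtain ⟨k, hk, hhk⟩ := id hh
  refine ⟨fun x => g (k x), hg.comp hk, ?_⟩
  filter_upwards [hhk, hh.continuousAt.eventually hfg] with x h1 h2
  rw [h2, h1]

theorem prodMk {f' : E → G} (hf : GermSmooth f z) (hf' : GermSmooth f' z) :
    GermSmooth (fun x => (f x, f' x)) z := by
  obtain ⟨g, hg, hfg⟩ := hf
  obtain ⟨g', hg', hfg'⟩ := hf'
  refine ⟨fun x => (g x, g' x), hg.prodMk hg', ?_⟩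
  filter_upwards [hfg, hfg'] with x h1 h2
  rw [h1, h2]

/-- Multiply by a smooth bump function, equal to 1 near z and supported inside the ball where f is
smooth. Lemmas about globally smooth maps, such as Hadamard's, then apply to maps known only near
one point. -/
theorem of_eventually_contDiffAt [FiniteDimensional ℝ E]
    (h : ∀ᶠ z' in 𝓝 z, ContDiffAt ℝ ∞ f z') : GermSmooth f z := by
  obtain ⟨ε, hε, hball⟩ := Metric.eventually_nhds_iff.1 h
  let χ : ContDiffBump z := ⟨ε / 3, ε / 2, by positivity, by linarith⟩
  refine ⟨fun x => χ x • f x, contDiff_iff_contDiffAt.2 fun x => ?_, ?_⟩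
  · rcases lt_or_ge (dist x z) ε with hx | hx
    · exact χ.contDiffAt.smul (hball hx)
    · have : (fun x => χ x • f x) =ᶠ[𝓝 x] fun _ => 0 := by
        have hx' : ε / 2 < dist x z := by linarith
        filter_upwards [(continuous_id.dist continuous_const).continuousAt.eventually
          (lt_mem_nhds hx')] with x' (hx' : ε / 2 < dist x' z)
        rw [χ.zero_of_le_dist (le_of_lt hx'), zero_smul]
      exact contDiffAt_const.congr_of_eventuallyEq this
  · filter_upwards [χ.eventuallyEq_one] with x hx
    rw [hx, Pi.one_apply, one_smul]

end GermSmooth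

end GermSmooth

/-! ### Commutators of one-parameter families of maps -/

section Commutator

theorem hasDerivAt_prodMk_left {W F : Type*} [NormedAddCommGroup W] [NormedSpace ℝ W]
    [NormedAddCommGroup F] [NormedSpace ℝ F] {f : ℝ × W → F} {s : ℝ} {w : W}
    (hf : DifferentiableAt ℝ f (s, w)) :
    HasDerivAt (fun s => f (s, w)) (fderiv ℝ f (s, w) (1, 0)) s :=
  HasFDerivAt.comp_hasDerivAt (f := fun s : ℝ => (s, w)) s hf.hasFDerivAt
    ((hasDerivAt_id s).prodMk (hasDerivAt_const s w))

variable {Z F : Type u} [NormedAddCommGroup Z] [NormedSpace ℝ Z]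
  [NormedAddCommGroup F] [NormedSpace ℝ F] [CompleteSpace F]

/-- Hadamard's lemma in the size s of the shift, with (t, z) as parameters. Keeping s independent of
t allows it to be replaced later by different powers of t. -/
theorem exists_hadamard_shift {A : ℝ × Z → F} {V : ℝ × Z → Z} (hA : ContDiff ℝ ∞ A)
    (hV : ContDiff ℝ ∞ V) :
    ∃ A₁ : ℝ × (ℝ × Z) → F, ContDiff ℝ ∞ A₁ ∧
      (∀ s t z, A (t, z + s • V (t, z)) = A (t, z) + s • A₁ (s, (t, z))) ∧
      ∀ t z, A₁ (0, (t, z)) = fderiv ℝ (fun z' => A (t, z')) z (V (t, z)) := by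
  let f : ℝ × (ℝ × Z) → F := fun q => A (q.2.1, q.2.2 + q.1 • V q.2)
  have hf : ContDiff ℝ ∞ f := by fun_prop
  obtain ⟨g, hg, h1, h2⟩ := exists_hadamard hf
  refine ⟨g, hg, fun s t z => ?_, fun t z => ?_⟩
  · simpa [f] using h1 s (t, z)
  · rw [h2]
    have hd := hasDerivAt_prodMk_left (hf.differentiable (by simp) (0, (t, z)))
    have hA' : HasFDerivAt (fun z' => A (t, z')) (fderiv ℝ (fun z' => A (t, z')) z)
        (z + (0 : ℝ) • V (t, z)) := by
      rw [zero_smul, add_zero]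
      exact ((by fun_prop : ContDiff ℝ ∞ fun z' => A (t, z')).differentiable
        (by simp) z).hasFDerivAt
    have hl : HasDerivAt (fun s : ℝ => z + s • V (t, z)) (V (t, z)) 0 := by
      simpa using ((hasDerivAt_id (0 : ℝ)).smul_const (V (t, z))).const_add z
    exact hd.unique (HasFDerivAt.comp_hasDerivAt (f := fun s : ℝ => z + s • V (t, z)) (0 : ℝ)
      hA' hl)

variable [CompleteSpace Z]

/-- Expanding A after a shift by t ^ l B, and B after a shift by t ^ k A, makes the terms of order t
^ k and t ^ l cancel. What remains is t ^ (k + l) times a difference of Hadamard quotients, which at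
t = 0 is DA·B - DB·A. -/
theorem exists_commutator_defect {A B : ℝ × Z → Z} (hA : ContDiff ℝ ∞ A) (hB : ContDiff ℝ ∞ B)
    {k l : ℕ} (hk : k ≠ 0) (hl : l ≠ 0) :
    ∃ C : ℝ × Z → Z, ContDiff ℝ ∞ C ∧
      (∀ t z, (z + t ^ l • B (t, z)) + t ^ k • A (t, z + t ^ l • B (t, z))
        = (z + t ^ k • A (t, z)) + t ^ l • B (t, z + t ^ k • A (t, z))
          + t ^ (k + l) • C (t, z)) ∧
      ∀ z, C (0, z) = VectorField.lieBracket ℝ (fun z => B (0, z)) (fun z => A (0, z)) z := by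
  obtain ⟨A₁, hA₁, hA2, hA3⟩ := exists_hadamard_shift hA hB
  obtain ⟨B₁, hB₁, hB2, hB3⟩ := exists_hadamard_shift hB hA
  refine ⟨fun q => A₁ (q.1 ^ l, q) - B₁ (q.1 ^ k, q), by fun_prop, fun t z => ?_, fun z => ?_⟩
  · dsimp only
    rw [hA2, hB2, pow_add]
    module
  · simp only [zero_pow hk, zero_pow hl, hA3, hB3, VectorField.lieBracket]

/-- If `Φ_t = id + t^k A_t` and `Ψ_t = id + t^l B_t`, then
`Ψ_t⁻¹ Φ_t Ψ_t Φ_t⁻¹ = id + t^(k+l) C_t` with `C_0 = [B_0, A_0]`. -/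
theorem exists_commutator {Φ Ψ Φ' Ψ' : ℝ × Z → Z} {z₀ : Z} {k l : ℕ} (hk : k ≠ 0) (hl : l ≠ 0)
    {A B : ℝ × Z → Z} (hA : ContDiff ℝ ∞ A) (hB : ContDiff ℝ ∞ B)
    (hΦ : ∀ᶠ q in 𝓝 ((0, z₀) : ℝ × Z), Φ q = q.2 + q.1 ^ k • A q)
    (hΨ : ∀ᶠ q in 𝓝 ((0, z₀) : ℝ × Z), Ψ q = q.2 + q.1 ^ l • B q)
    (hΦ' : GermSmooth Φ' (0, z₀)) (hΨ' : GermSmooth Ψ' (0, z₀))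
    (hΦi : ∀ᶠ q in 𝓝 ((0, z₀) : ℝ × Z), Φ (q.1, Φ' q) = q.2)
    (hΨi : ∀ᶠ q in 𝓝 ((0, z₀) : ℝ × Z), Ψ' (q.1, Ψ q) = q.2)
    (hΦ0 : ∀ᶠ z in 𝓝 z₀, Φ' (0, z) = z) :
    ∃ C : ℝ × Z → Z, ContDiff ℝ ∞ C ∧
      (∀ᶠ q in 𝓝 ((0, z₀) : ℝ × Z),
        Ψ' (q.1, Φ (q.1, Ψ (q.1, Φ' q))) = q.2 + q.1 ^ (k + l) • C q) ∧
      ∀ᶠ z in 𝓝 z₀,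
        C (0, z) = VectorField.lieBracket ℝ (fun z => B (0, z)) (fun z => A (0, z)) z := by
  obtain ⟨C₀, hC₀, hC1, hC2⟩ := exists_commutator_defect hA hB hk hl
  obtain ⟨P, hP, hPe⟩ := id hΦ'
  obtain ⟨Q, hQ, hQe⟩ := id hΨ'
  have hembed : Tendsto (fun z : Z => ((0, z) : ℝ × Z)) (𝓝 z₀) (𝓝 (0, z₀)) :=
    (by fun_prop : Continuous fun z : Z => ((0, z) : ℝ × Z)).tendsto z₀
  have hΦ'0 : Φ' (0, z₀) = z₀ := hΦ0.self_of_nhds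
  -- `N (t, w) = Ψ_t (w)`, `f (s, (t, z)) = Ψ'_t (Ψ_t (w) + s C₀ (t, w))` with `w = Φ'_t z`
  let N : ℝ × Z → Z := fun q => q.2 + q.1 ^ l • B q
  let M : ℝ × Z → Z := fun q => q.2 + q.1 ^ k • A q
  let X : ℝ × Z → Z := fun q => N (q.1, M (q.1, P q))
  let V : ℝ × Z → Z := fun q => C₀ (q.1, P q)
  let f : ℝ × (ℝ × Z) → Z := fun q => Q (q.2.1, X q.2 + q.1 • V q.2)
  have hf : ContDiff ℝ ∞ f := by
    simp only [f, X, V, N, M]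
    fun_prop
  obtain ⟨g, hg, hg1, hg2⟩ := exists_hadamard hf
  have hΦ'c : Tendsto (fun q : ℝ × Z => (q.1, Φ' q)) (𝓝 (0, z₀)) (𝓝 (0, z₀)) := by
    have := continuousAt_fst.prodMk hΦ'.continuousAt
    rwa [ContinuousAt, hΦ'0] at this
  have hNc : Continuous N := by simp only [N]; fun_prop
  have hMc : Continuous M := by simp only [M]; fun_prop
  have hN0 : ∀ z, N (0, z) = z := fun z => by simp [N, zero_pow hl]
  have hM0 : ∀ z, M (0, z) = z := fun z => by simp [M, zero_pow hk]
  have hNt : Tendsto (fun q : ℝ × Z => (q.1, N q)) (𝓝 (0, z₀)) (𝓝 (0, z₀)) := by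
    have := (continuous_fst.prodMk hNc).tendsto ((0, z₀) : ℝ × Z)
    rwa [hN0] at this
  have hMt : Tendsto (fun q : ℝ × Z => (q.1, M q)) (𝓝 (0, z₀)) (𝓝 (0, z₀)) := by
    have := (continuous_fst.prodMk hMc).tendsto ((0, z₀) : ℝ × Z)
    rwa [hM0] at this
  -- In Ψ_t(Φ_t(w)) with w = Φ_t⁻¹(z), the inner two maps cancel and Ψ_t(z) is left; hence f is the
  -- identity at s = 0.
  have hXe : ∀ᶠ q in 𝓝 ((0, z₀) : ℝ × Z), X q = N q := by
    filter_upwards [hPe, hΦi, hΦ'c.eventually hΦ] with q h1 h2 h3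
    simp only [X]
    rw [← h1]
    have : M (q.1, Φ' q) = q.2 := by rw [← h2, h3]
    rw [this]
  have hfe0 : ∀ᶠ q in 𝓝 ((0, z₀) : ℝ × Z), f (0, q) = q.2 := by
    filter_upwards [hXe, hΨi, hΨ, hNt.eventually hQe] with q h1 h2 h3 h4
    simp only [f, zero_smul, add_zero, h1]
    have e : Ψ q = N q := h3
    rw [← h4, ← e, h2]
  -- The defect formula exchanges Φ and Ψ up to t ^ (k + l) C₀, so the commutator is f evaluated at
  -- s = t ^ (k + l).
  have hV0 : ∀ᶠ q in 𝓝 ((0, z₀) : ℝ × Z),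
      f (q.1 ^ (k + l), q) = Ψ' (q.1, Φ (q.1, Ψ (q.1, Φ' q))) := by
    have hNΦ : Tendsto (fun q : ℝ × Z => (q.1, N (q.1, Φ' q))) (𝓝 (0, z₀)) (𝓝 (0, z₀)) :=
      hNt.comp hΦ'c
    have hMN : Tendsto (fun q : ℝ × Z => (q.1, M (q.1, N (q.1, Φ' q)))) (𝓝 (0, z₀))
        (𝓝 (0, z₀)) := hMt.comp hNΦ
    filter_upwards [hPe, hΦ'c.eventually hΨ, hNΦ.eventually hΦ, hMN.eventually hQe]
      with q h1 h2 h3 h4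
    have e1 : Ψ (q.1, Φ' q) = N (q.1, Φ' q) := h2
    have e2 : Φ (q.1, N (q.1, Φ' q)) = M (q.1, N (q.1, Φ' q)) := h3
    rw [e1, e2, h4]
    simp only [f, X, V, N, M]
    rw [← h1, ← hC1]
  refine ⟨fun q => g (q.1 ^ (k + l), q), by fun_prop, ?_, ?_⟩
  · filter_upwards [hV0, hfe0] with q h1 h2
    rw [← h1]
    have := hg1 (q.1 ^ (k + l)) q
    rw [h2] at this
    exact this
  · have hkl : k + l ≠ 0 := by omega
    filter_upwards [hembed.eventually hfe0.eventually_nhds, hembed.eventually hXe,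
      hembed.eventually hPe, hΦ0, hΦ0.eventually_nhds, hembed.eventually hQe.eventuallyEq_nhds,
      hembed.eventually hΨi.eventually_nhds, hembed.eventually hΨ.eventually_nhds]
      with z _ h2 h3 h4 _ h6 h7 h8
    -- Ψ_0 is the identity, hence so is its left inverse. At t = 0 the function f is therefore z + s
    -- C₀ near s = 0, and its derivative in s is C₀.
    have hQ0 : ∀ᶠ z' in 𝓝 z, Q (0, z') = z' := by
      have hez : Tendsto (fun z : Z => ((0, z) : ℝ × Z)) (𝓝 z) (𝓝 (0, z)) :=
        (by fun_prop : Continuous fun z : Z => ((0, z) : ℝ × Z)).tendsto z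
      filter_upwards [hez.eventually h6, hez.eventually h7, hez.eventually h8] with z' a b c
      have e : Ψ (0, z') = z' := by rw [c]; exact hN0 z'
      simp only [e] at b
      rw [← a, b]
    rw [zero_pow hkl, hg2, ← hC2]
    have hX : X (0, z) = z := by rw [h2, hN0]
    have hV : V (0, z) = C₀ (0, z) := by simp only [V]; rw [← h3, h4]
    have hd := hasDerivAt_prodMk_left (hf.differentiable (by simp) (0, (0, z)))
    refine hd.unique ?_
    have hl : HasDerivAt (fun s : ℝ => z + s • C₀ (0, z)) (C₀ (0, z)) 0 := by
      simpa using ((hasDerivAt_id (0 : ℝ)).smul_const (C₀ (0, z))).const_add z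
    refine hl.congr_of_eventuallyEq ?_
    have hlt : Tendsto (fun s : ℝ => z + s • C₀ (0, z)) (𝓝 0) (𝓝 z) := by
      have := (by fun_prop : Continuous fun s : ℝ => z + s • C₀ (0, z)).tendsto 0
      simpa using this
    filter_upwards [hlt.eventually hQ0] with s hs
    simp only [f, hX, hV, hs]

end Commutator

/-! ### Smooth dependence of solutions of differential equations on initial values -/

section Flow

/-- The constant path. -/
def constPath (Z : Type*) [NormedAddCommGroup Z] [NormedSpace ℝ Z] :
    Z →L[ℝ] C(unitInterval, Z) :=
  LinearMap.mkContinuous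
    { toFun := fun z => ContinuousMap.const _ z
      map_add' := fun _ _ => rfl
      map_smul' := fun _ _ => rfl } 1
    (fun z => by
      rw [one_mul, ContinuousMap.norm_le _ (norm_nonneg _)]
      exact fun _ => le_rfl)

/-- The shear `(a, h) ↦ (a, h - A a)`. -/
def shearEquiv {X Y : Type*} [NormedAddCommGroup X] [NormedSpace ℝ X] [NormedAddCommGroup Y]
    [NormedSpace ℝ Y] (A : X →L[ℝ] Y) : (X × Y) ≃L[ℝ] (X × Y) :=
  ContinuousLinearEquiv.equivOfInverse
    ((ContinuousLinearMap.fst ℝ X Y).prod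
      (ContinuousLinearMap.snd ℝ X Y - A.comp (ContinuousLinearMap.fst ℝ X Y)))
    ((ContinuousLinearMap.fst ℝ X Y).prod
      (ContinuousLinearMap.snd ℝ X Y + A.comp (ContinuousLinearMap.fst ℝ X Y)))
    (fun x => by ext <;> simp) (fun x => by ext <;> simp)

/-- The inverse function theorem, with smoothness of the inverse in a neighbourhood. -/
theorem exists_smooth_localInverse {X : Type*} [NormedAddCommGroup X] [NormedSpace ℝ X]
    [CompleteSpace X] {H : X → X} (hH : ContDiff ℝ ∞ H) {w : X} (e : X ≃L[ℝ] X)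
    (he : HasFDerivAt H (e : X →L[ℝ] X) w) :
    ∃ K : X → X, K (H w) = w ∧ (∀ᶠ v in 𝓝 (H w), H (K v) = v) ∧
      ∀ᶠ v in 𝓝 (H w), ContDiffAt ℝ ∞ K v := by
  let Φ := hH.contDiffAt.toOpenPartialHomeomorph H he (by simp)
  have hΦ : ∀ x, Φ x = H x := fun _ => rfl
  have hw : w ∈ Φ.source := hH.contDiffAt.mem_toOpenPartialHomeomorph_source he (by simp)
  have hw' : H w ∈ Φ.target := Φ.map_source hw
  have hKw : Φ.symm (H w) = w := Φ.left_inv hw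
  refine ⟨Φ.symm, hKw, ?_, ?_⟩
  · filter_upwards [Φ.open_target.mem_nhds hw'] with v hv
    exact Φ.right_inv hv
  -- Invertible operators form an open set, so the derivative stays invertible near w and the
  -- inverse is smooth at all nearby points, not only at H w.
  · have hinv : ∀ᶠ x in 𝓝 w, ∃ e' : X ≃L[ℝ] X, HasFDerivAt H (e' : X →L[ℝ] X) x := by
      have hc : ContinuousAt (fderiv ℝ H) w :=
        (hH.continuous_fderiv (by simp)).continuousAt
      have hn : range ((↑) : (X ≃L[ℝ] X) → X →L[ℝ] X) ∈ 𝓝 (fderiv ℝ H w) := by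
        rw [he.fderiv]
        exact ContinuousLinearEquiv.nhds e
      filter_upwards [hc hn] with x hx
      obtain ⟨e', he'⟩ := hx
      exact ⟨e', he' ▸ (hH.differentiable (by simp) x).hasFDerivAt⟩
    have hcont : Tendsto Φ.symm (𝓝 (H w)) (𝓝 w) := by
      have := Φ.continuousAt_symm hw'
      rwa [ContinuousAt, hKw] at this
    filter_upwards [Φ.open_target.mem_nhds hw', hcont.eventually hinv] with v hv ⟨e', he'⟩
    exact Φ.contDiffAt_symm hv he' hH.contDiffAt

theorem hasDerivWithinAt_pathPrimitive {Z : Type*} [NormedAddCommGroup Z] [NormedSpace ℝ Z]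
    [CompleteSpace Z] (γ : C(unitInterval, Z)) {s : ℝ} (hs : s ∈ Icc (0 : ℝ) 1) :
    HasDerivWithinAt (fun s => pathPrimitive Z γ (projIcc 0 1 zero_le_one s))
      (γ (projIcc 0 1 zero_le_one s)) (Icc 0 1) s := by
  have hc : Continuous fun r => γ (projIcc 0 1 zero_le_one r) := by fun_prop
  have h := (intervalIntegral.integral_hasDerivAt_right (hc.intervalIntegrable 0 s)
    hc.stronglyMeasurable.stronglyMeasurableAtFilter hc.continuousAt).hasDerivWithinAt
    (s := Icc (0 : ℝ) 1)
  refine h.congr_of_mem (fun r hr => ?_) hs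
  change ∫ r' in (0 : ℝ)..(projIcc 0 1 zero_le_one r : ℝ), γ (projIcc 0 1 zero_le_one r') = _
  rw [projIcc_of_mem zero_le_one hr]

/-- A solution of γ' = ε f(γ) starting at z is a zero of γ - z - ε∫f(γ) in the Banach space of
continuous paths. At ε = 0 the constant path solves this and the derivative in γ is the identity, so
the inverse function theorem gives a solution depending smoothly on (ε, z). The usual short
existence time is replaced by a small ε on the fixed interval [0, 1]. -/
theorem exists_smooth_flow {Z : Type u} [NormedAddCommGroup Z] [NormedSpace ℝ Z]
    [CompleteSpace Z] {f : Z → Z} (hf : ContDiff ℝ ∞ f) (z₀ : Z) {W : Set Z} (hW : W ∈ 𝓝 z₀) :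
    ∃ ε : ℝ, 0 < ε ∧ ∃ γ : Z → ℝ → Z,
      (∀ᶠ z in 𝓝 z₀, γ z 0 = z ∧ ∀ s ∈ Icc (0 : ℝ) 1, γ z s ∈ W ∧
        HasDerivWithinAt (γ z) (ε • f (γ z s)) (Icc 0 1) s) ∧
      ∀ᶠ z in 𝓝 z₀, ContDiffAt ℝ ∞ (fun z => γ z 1) z := by
  let C := C(unitInterval, Z)
  let N : C → C := fun γ => pathPrimitive Z (postcompMap ⟨f, hf.continuous⟩ γ)
  have hN : ContDiff ℝ ∞ N := (pathPrimitive Z).contDiff.comp (contDiff_postcompMap _ hf)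
  let H : (ℝ × Z) × C → (ℝ × Z) × C := fun q =>
    (q.1, q.2 - (constPath Z q.1.2 + q.1.1 • N q.2))
  have hH : ContDiff ℝ ∞ H := by
    have h1 : ContDiff ℝ ∞ fun q : (ℝ × Z) × C => constPath Z q.1.2 :=
      (constPath Z).contDiff.comp (contDiff_snd.comp contDiff_fst)
    have h2 : ContDiff ℝ ∞ fun q : (ℝ × Z) × C => N q.2 := hN.comp contDiff_snd
    exact contDiff_fst.prodMk (contDiff_snd.sub
      (h1.add ((contDiff_fst.comp contDiff_fst).smul h2)))
  let w : (ℝ × Z) × C := ((0, z₀), constPath Z z₀)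
  let A : ℝ × Z →L[ℝ] C := (constPath Z).comp (ContinuousLinearMap.snd ℝ ℝ Z)
    + (ContinuousLinearMap.fst ℝ ℝ Z).smulRight (N (constPath Z z₀))
  -- The factor ε vanishes at w, so the derivative of `N` drops out and a shear is left, which is
  -- invertible.
  have hder : HasFDerivAt H (shearEquiv A : (ℝ × Z) × C →L[ℝ] (ℝ × Z) × C) w := by
    have h2 : HasFDerivAt (fun q : (ℝ × Z) × C => N q.2)
        ((fderiv ℝ N (constPath Z z₀)).comp (ContinuousLinearMap.snd ℝ (ℝ × Z) C)) w :=
      HasFDerivAt.comp (f := fun q : (ℝ × Z) × C => q.2) w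
        (hN.differentiable (by simp) _).hasFDerivAt hasFDerivAt_snd
    have h3 : HasFDerivAt (fun q : (ℝ × Z) × C => q.1.1)
        ((ContinuousLinearMap.fst ℝ ℝ Z).comp (ContinuousLinearMap.fst ℝ (ℝ × Z) C)) w :=
      ((ContinuousLinearMap.fst ℝ ℝ Z).comp (ContinuousLinearMap.fst ℝ (ℝ × Z) C)).hasFDerivAt
    have h1 : HasFDerivAt (fun q : (ℝ × Z) × C => constPath Z q.1.2)
        ((constPath Z).comp ((ContinuousLinearMap.snd ℝ ℝ Z).comp
          (ContinuousLinearMap.fst ℝ (ℝ × Z) C))) w :=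
      ((constPath Z).comp ((ContinuousLinearMap.snd ℝ ℝ Z).comp
          (ContinuousLinearMap.fst ℝ (ℝ × Z) C))).hasFDerivAt
    have := hasFDerivAt_fst.prodMk (hasFDerivAt_snd.sub (h1.add (h3.smul h2)))
    refine this.congr_fderiv ?_
    refine ContinuousLinearMap.ext fun q => Prod.ext ?_ ?_ <;> simp [shearEquiv, A, w]
  obtain ⟨K, hKw, hHK, hK⟩ := exists_smooth_localInverse hH (shearEquiv A) hder
  have hHw : H w = ((0, z₀), 0) := by
    simp [H, w]
  rw [hHw] at hKw hHK hK
  -- the solution with parameter `ε` starting at `z`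
  let G : ℝ × Z → C := fun q => (K (q, 0)).2
  have hemb : Tendsto (fun q : ℝ × Z => (q, (0 : C))) (𝓝 (0, z₀)) (𝓝 ((0, z₀), 0)) :=
    (by fun_prop : Continuous fun q : ℝ × Z => (q, (0 : C))).tendsto _
  have hG : ∀ᶠ q in 𝓝 ((0, z₀) : ℝ × Z), ContDiffAt ℝ ∞ G q := by
    filter_upwards [hemb.eventually hK] with q hq
    exact contDiffAt_snd.comp q
      (ContDiffAt.comp (f := fun q : ℝ × Z => (q, (0 : C))) q hq (by fun_prop))
  have hGe : ∀ᶠ q in 𝓝 ((0, z₀) : ℝ × Z), G q = constPath Z q.2 + q.1 • N (G q) := by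
    filter_upwards [hemb.eventually hHK] with q hq
    have h1 : (K (q, 0)).1 = q := congrArg Prod.fst hq
    have h2 : (K (q, 0)).2 - (constPath Z (K (q, 0)).1.2 + (K (q, 0)).1.1 • N (K (q, 0)).2) = 0 :=
      congrArg Prod.snd hq
    rw [h1] at h2
    exact sub_eq_zero.1 h2
  have hG0 : G (0, z₀) = constPath Z z₀ := by simp only [G, hKw]; rfl
  have hGW : ∀ᶠ q in 𝓝 ((0, z₀) : ℝ × Z), ∀ s, G q s ∈ W := by
    have hc : ContinuousAt G (0, z₀) := hG.self_of_nhds.continuousAt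
    obtain ⟨r, hr, hrW⟩ := Metric.mem_nhds_iff.1 hW
    have := (Metric.continuousAt_iff' (β := ℝ × Z) (α := C(unitInterval, Z))).1 hc r hr
    filter_upwards [this] with q hq s
    refine hrW ?_
    have := (ContinuousMap.dist_apply_le_dist (f := G q) (g := G (0, z₀)) s).trans_lt hq
    rwa [hG0] at this
  -- The neighbourhood of (0, z₀) is split into a product so that one positive ε serves all initial
  -- values near z₀.
  have hall := hG.and (hGe.and hGW)
  rw [nhds_prod_eq] at hall
  obtain ⟨pa, hpa, pb, hpb, hab⟩ := eventually_prod_iff.1 hall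
  obtain ⟨δ, hδ, hδa⟩ := Metric.eventually_nhds_iff.1 hpa
  have hε : pa (δ / 2) := hδa (by
    rw [Real.dist_0_eq_abs, abs_of_pos (by positivity)]; linarith)
  refine ⟨δ / 2, by positivity, fun z s => G (δ / 2, z) (projIcc 0 1 zero_le_one s), ?_, ?_⟩
  · filter_upwards [hpb] with z hz
    obtain ⟨-, h1, h2⟩ := hab hε hz
    have h1' : ∀ s : unitInterval, G (δ / 2, z) s = z + (δ / 2) • N (G (δ / 2, z)) s :=
      fun s => congrArg (fun c : C => c s) h1
    refine ⟨?_, fun s hs => ⟨h2 _, ?_⟩⟩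
    · rw [h1']
      have : N (G (δ / 2, z)) (projIcc 0 1 zero_le_one 0) = 0 := by
        change ∫ r' in (0 : ℝ)..(projIcc (0 : ℝ) 1 zero_le_one 0 : ℝ), _ = _
        simp
      rw [this, smul_zero, add_zero]
    · simp_rw [fun s => h1' (projIcc 0 1 zero_le_one s)]
      have := ((hasDerivWithinAt_pathPrimitive
        (postcompMap ⟨f, hf.continuous⟩ (G (δ / 2, z))) hs).const_smul (δ / 2)).const_add z
      refine this.congr_deriv ?_
      rw [← h1']
      rfl
  · filter_upwards [hpb] with z hz
    have h1 := (hab hε hz).1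
    have h2 : ContDiffAt ℝ ∞ (fun z => G (δ / 2, z)) z :=
      ContDiffAt.comp (f := fun z : Z => (δ / 2, z)) z h1 (by fun_prop)
    exact (ContinuousMap.evalCLM ℝ (projIcc (0 : ℝ) 1 zero_le_one 1)).contDiff.contDiffAt.comp z h2

end Flow

/-! ### Finsler functions in local coordinates -/

section Slices

variable {E F G : Type*} [NormedAddCommGroup E] [NormedSpace ℝ E]
  [NormedAddCommGroup F] [NormedSpace ℝ F] [NormedAddCommGroup G] [NormedSpace ℝ G]

theorem hasFDerivAt_slice_right {φ : E × F → G} {x : E} {y : F}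
    (h : DifferentiableAt ℝ φ (x, y)) :
    HasFDerivAt (fun y' => φ (x, y')) ((fderiv ℝ φ (x, y)).comp (.inr ℝ E F)) y :=
  HasFDerivAt.comp (f := fun y' : F => (x, y')) y h.hasFDerivAt (hasFDerivAt_prodMk_right x y)

theorem hasFDerivAt_slice_left {φ : E × F → G} {x : E} {y : F}
    (h : DifferentiableAt ℝ φ (x, y)) :
    HasFDerivAt (fun x' => φ (x', y)) ((fderiv ℝ φ (x, y)).comp (.inl ℝ E F)) x :=
  HasFDerivAt.comp (f := fun x' : E => (x', y)) x h.hasFDerivAt (hasFDerivAt_prodMk_left x y)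

theorem ContDiffAt.fderiv_infty {φ : E → G} {z : E} (h : ContDiffAt ℝ ∞ φ z) :
    ContDiffAt ℝ ∞ (fderiv ℝ φ) z :=
  h.fderiv_right (by simp)

theorem ContDiffAt.differentiableAt_infty {φ : E → G} {z : E} (h : ContDiffAt ℝ ∞ φ z) :
    DifferentiableAt ℝ φ z :=
  h.differentiableAt (by simp)

theorem ContDiffAt.fderiv_fderiv_comm {φ : E → G} {z : E} (h : ContDiffAt ℝ ∞ φ z) (v w : E) :
    fderiv ℝ (fderiv ℝ φ) z v w = fderiv ℝ (fderiv ℝ φ) z w v :=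
  (h.isSymmSndFDerivAt (by
    rw [minSmoothness_of_isRCLikeNormedField]; exact WithTop.coe_le_coe.2 (le_top : (2 : ℕ∞) ≤ ⊤))).eq v w

end Slices

variable {E : Type u} [NormedAddCommGroup E] [NormedSpace ℝ E]

/-- A Finsler function in coordinates `(x, y)`, with `x` in the open set `O`. -/
structure IsLocalFinsler (f : E → E → ℝ) (O : Set E) : Prop where
  isOpen : IsOpen O
  smooth : ∀ x ∈ O, ∀ y, y ≠ 0 → ContDiffAt ℝ ∞ (fun z : E × E => f z.1 z.2) (x, y)
  homog : ∀ x ∈ O, ∀ (y : E) (r : ℝ), 0 < r → f x (r • y) = r * f x y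
  posDef : ∀ x ∈ O, ∀ y, y ≠ 0 → ∀ u, u ≠ 0 → 0 < fibreMetric (f x) y u u

/-- The slit tangent bundle over `O`. -/
def slit (O : Set E) : Set (E × E) := O ×ˢ {0}ᶜ

/-- The square of a Finsler function. -/
def energy (f : E → E → ℝ) (z : E × E) : ℝ := f z.1 z.2 ^ 2

namespace IsLocalFinsler

variable {f : E → E → ℝ} {O : Set E} (hf : IsLocalFinsler f O)
include hf

theorem isOpen_slit : IsOpen (slit O) := hf.isOpen.prod isOpen_compl_singleton

theorem contDiffAt_energy {z : E × E} (hz : z ∈ slit O) : ContDiffAt ℝ ∞ (energy f) z :=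
  (hf.smooth z.1 hz.1 z.2 hz.2).pow 2

theorem fderiv_energy_slice {x y : E} (hz : (x, y) ∈ slit O) :
    fderiv ℝ (fun y' => f x y' ^ 2) y = (fderiv ℝ (energy f) (x, y)).comp (.inr ℝ E E) :=
  (hasFDerivAt_slice_right (φ := energy f)
    (hf.contDiffAt_energy hz).differentiableAt_infty).fderiv

/-- The metric becomes a block of the full second derivative of the energy on `E × E`. In this form
base and fibre derivatives can be interchanged by symmetry. -/
theorem fibreMetric_eq {x y : E} (hz : (x, y) ∈ slit O) (u v : E) :
    fibreMetric (f x) y u v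
      = (1 / 2) * fderiv ℝ (fderiv ℝ (energy f)) (x, y) (0, u) (0, v) := by
  have h1 : (fderiv ℝ fun y' => f x y' ^ 2) =ᶠ[𝓝 y]
      fun y' => (fderiv ℝ (energy f) (x, y')).comp (.inr ℝ E E) := by
    filter_upwards [isOpen_compl_singleton.mem_nhds (show y ∈ ({0}ᶜ : Set E) from hz.2)]
      with y' hy'
    exact hf.fderiv_energy_slice ⟨hz.1, hy'⟩
  have h2 := hasFDerivAt_slice_right (φ := fderiv ℝ (energy f))
    (hf.contDiffAt_energy hz).fderiv_infty.differentiableAt_infty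
  have h3 := (((ContinuousLinearMap.compL ℝ E (E × E) ℝ).flip (.inr ℝ E E)).hasFDerivAt
    (x := fderiv ℝ (energy f) (x, y))).comp y h2
  rw [fibreMetric, h1.fderiv_eq]
  erw [h3.fderiv]
  simp

theorem energy_smul {x : E} (hx : x ∈ O) (y : E) {r : ℝ} (hr : 0 < r) :
    energy f (x, r • y) = r ^ 2 * energy f (x, y) := by
  simp only [energy, hf.homog x hx y r hr]
  ring

theorem euler {z : E × E} (hz : z ∈ slit O) :
    fderiv ℝ (energy f) z (0, z.2) = 2 * energy f z := by
  have h1 : HasDerivAt (fun r : ℝ => energy f (z.1, r • z.2))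
      (fderiv ℝ (energy f) z (0, z.2)) 1 := by
    have hl : HasDerivAt (fun r : ℝ => (z.1, r • z.2)) (0, z.2) 1 :=
      (hasDerivAt_const _ _).prodMk (by simpa using (hasDerivAt_id (1 : ℝ)).smul_const z.2)
    have hd : HasFDerivAt (energy f) (fderiv ℝ (energy f) z) (z.1, (1 : ℝ) • z.2) := by
      rw [one_smul]
      exact (hf.contDiffAt_energy hz).differentiableAt_infty.hasFDerivAt
    exact HasFDerivAt.comp_hasDerivAt (f := fun r : ℝ => (z.1, r • z.2)) 1 hd hl
  have h2 : HasDerivAt (fun r : ℝ => r ^ 2 * energy f z) (2 * energy f z) 1 := by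
    simpa using (hasDerivAt_pow 2 (1 : ℝ)).mul_const (energy f z)
  refine h1.unique (h2.congr_of_eventuallyEq ?_)
  filter_upwards [lt_mem_nhds (zero_lt_one : (0 : ℝ) < 1)] with r hr
  exact hf.energy_smul hz.1 z.2 hr

/-- Euler's identity holds on the open slit bundle, so it may be differentiated in any direction,
horizontal or vertical. -/
theorem euler_fderiv {z : E × E} (hz : z ∈ slit O) (w : E × E) :
    fderiv ℝ (fderiv ℝ (energy f)) z w (0, z.2) + fderiv ℝ (energy f) z (0, w.2)
      = 2 * fderiv ℝ (energy f) z w := by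
  have hL := hf.contDiffAt_energy hz
  have h1 : HasFDerivAt (fun z : E × E => fderiv ℝ (energy f) z (0, z.2)) _ z :=
    hL.fderiv_infty.differentiableAt_infty.hasFDerivAt.clm_apply
      ((ContinuousLinearMap.inr ℝ E E).comp (.snd ℝ E E)).hasFDerivAt
  have h2 := hL.differentiableAt_infty.hasFDerivAt.const_mul 2
  have h3 := h1.unique (h2.congr_of_eventuallyEq (by
    filter_upwards [hf.isOpen_slit.mem_nhds hz] with z' hz'
    exact hf.euler hz'))
  have := congrArg (fun T : E × E →L[ℝ] ℝ => T w) h3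
  simpa [add_comm] using this

theorem fderiv_fderiv_radial {x y : E} (hz : (x, y) ∈ slit O) (v : E) :
    fderiv ℝ (fderiv ℝ (energy f)) (x, y) (0, y) (0, v) = fderiv ℝ (energy f) (x, y) (0, v) := by
  have h := hf.euler_fderiv hz (0, v)
  rw [(hf.contDiffAt_energy hz).fderiv_fderiv_comm] at h
  dsimp only at h
  linarith

/-- Test with v = a - b: otherwise the positive definite form would vanish on a nonzero vector. -/
theorem fderiv_fderiv_nondegenerate {x y : E} (hz : (x, y) ∈ slit O) {a b : E}
    (h : ∀ v, fderiv ℝ (fderiv ℝ (energy f)) (x, y) (0, a) (0, v)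
      = fderiv ℝ (fderiv ℝ (energy f)) (x, y) (0, b) (0, v)) : a = b := by
  by_contra hab
  have h1 := hf.posDef x hz.1 y hz.2 (a - b) (sub_ne_zero.2 hab)
  rw [hf.fibreMetric_eq hz] at h1
  have h2 : ((0, a - b) : E × E) = (0, a) - (0, b) := by simp
  have h3 := h (a - b)
  have h4 : fderiv ℝ (fderiv ℝ (energy f)) (x, y) (0, a - b)
      = fderiv ℝ (fderiv ℝ (energy f)) (x, y) (0, a)
        - fderiv ℝ (fderiv ℝ (energy f)) (x, y) (0, b) := by rw [h2, map_sub]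
  rw [h4, sub_apply, h3] at h1
  simp at h1

variable [FiniteDimensional ℝ E]

/-- Injectivity and equal finite dimensions suffice. The equivalence is needed because `sprayCoeff`
uses `inverse`, whose value has no meaning for a map that is not invertible. -/
theorem exists_fibreMetric_equiv {x y : E} (hz : (x, y) ∈ slit O) :
    ∃ e : E ≃L[ℝ] (E →L[ℝ] ℝ), (e : E →L[ℝ] E →L[ℝ] ℝ) = fibreMetric (f x) y := by
  have hinj : Function.Injective (fibreMetric (f x) y) := by
    intro a b hab
    refine hf.fderiv_fderiv_nondegenerate hz fun v => ?_
    have h1 := congrArg (fun T : E →L[ℝ] ℝ => T v) hab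
    rw [hf.fibreMetric_eq hz, hf.fibreMetric_eq hz] at h1
    linarith
  have hrank : Module.finrank ℝ E = Module.finrank ℝ (E →L[ℝ] ℝ) := by
    rw [← LinearMap.toContinuousLinearMap.finrank_eq]
    exact (Subspace.dual_finrank_eq (K := ℝ) (V := E)).symm
  refine ⟨(LinearEquiv.ofInjectiveOfFinrankEq
    (fibreMetric (f x) y : E →ₗ[ℝ] E →L[ℝ] ℝ) hinj hrank).toContinuousLinearEquiv, ?_⟩
  ext u v
  rfl

omit [FiniteDimensional ℝ E] in
/-- The right-hand side `2 ∂g_{jl}/∂x^k y^j y^k - ∂g_{jk}/∂x^l y^j y^k` of the geodesic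
equation. -/
theorem sprayCovector_eq {x y : E} (hz : (x, y) ∈ slit O) (v : E) :
    ((2 : ℝ) • fderiv ℝ (fun x' => fibreMetric (f x') y y) x y
      - fderiv ℝ (fun x' => fibreMetric (f x') y y y) x) v
    = fderiv ℝ (fderiv ℝ (energy f)) (x, y) (y, 0) (0, v)
      - fderiv ℝ (energy f) (x, y) (v, 0) := by
  have hL := hf.contDiffAt_energy hz
  have hO := hf.isOpen.mem_nhds hz.1
  -- By Euler's identities g(y, ·) is half the vertical differential of f² and g(y, y) is f². The
  -- derivatives of the metric in x thus reduce to derivatives of the energy.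
  have h1 : (fun x' => fibreMetric (f x') y y) =ᶠ[𝓝 x]
      fun x' => (1 / 2 : ℝ) • (fderiv ℝ (energy f) (x', y)).comp (.inr ℝ E E) := by
    filter_upwards [hO] with x' hx'
    ext v
    rw [hf.fibreMetric_eq ⟨hx', hz.2⟩, hf.fderiv_fderiv_radial ⟨hx', hz.2⟩]
    simp
  have h2 : (fun x' => fibreMetric (f x') y y y) =ᶠ[𝓝 x] fun x' => energy f (x', y) := by
    filter_upwards [hO] with x' hx'
    rw [hf.fibreMetric_eq ⟨hx', hz.2⟩, hf.fderiv_fderiv_radial ⟨hx', hz.2⟩,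
      hf.euler (z := (x', y)) ⟨hx', hz.2⟩]
    ring
  have h3 := hasFDerivAt_slice_left (φ := fderiv ℝ (energy f))
    hL.fderiv_infty.differentiableAt_infty
  have h4 := ((((ContinuousLinearMap.compL ℝ E (E × E) ℝ).flip (.inr ℝ E E)).hasFDerivAt
    (x := fderiv ℝ (energy f) (x, y))).comp x h3).const_smul (1 / 2 : ℝ)
  have h5 := hasFDerivAt_slice_left (φ := energy f) hL.differentiableAt_infty
  rw [h1.fderiv_eq, h2.fderiv_eq, h5.fderiv]
  erw [h4.fderiv]
  simp

/-- The Euler-Lagrange equation which characterizes the geodesic coefficients. -/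
theorem euler_lagrange {x y : E} (hz : (x, y) ∈ slit O) (v : E) :
    2 * fderiv ℝ (fderiv ℝ (energy f)) (x, y) (0, sprayCoeff f x y) (0, v)
      = fderiv ℝ (fderiv ℝ (energy f)) (x, y) (y, 0) (0, v)
        - fderiv ℝ (energy f) (x, y) (v, 0) := by
  obtain ⟨e, he⟩ := hf.exists_fibreMetric_equiv hz
  have h1 : fibreMetric (f x) y (sprayCoeff f x y) = (1 / 4 : ℝ) •
      ((2 : ℝ) • fderiv ℝ (fun x' => fibreMetric (f x') y y) x y
        - fderiv ℝ (fun x' => fibreMetric (f x') y y y) x) := by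
    rw [sprayCoeff, ← he, ContinuousLinearMap.inverse_equiv]
    simp only [map_smul]
    simp
  have h2 := congrArg (fun T : E →L[ℝ] ℝ => T v) h1
  rw [hf.fibreMetric_eq hz, smul_apply, hf.sprayCovector_eq hz,
    smul_eq_mul] at h2
  linarith

/-- Together with `euler_lagrange` this replaces the formula with the inverse metric: homogeneity
and the transformation law are proved by testing a candidate in the equation. -/
theorem sprayCoeff_unique {x y : E} (hz : (x, y) ∈ slit O) {G : E}
    (h : ∀ v, 2 * fderiv ℝ (fderiv ℝ (energy f)) (x, y) (0, G) (0, v)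
      = fderiv ℝ (fderiv ℝ (energy f)) (x, y) (y, 0) (0, v)
        - fderiv ℝ (energy f) (x, y) (v, 0)) : sprayCoeff f x y = G := by
  refine hf.fderiv_fderiv_nondegenerate hz fun v => ?_
  have h1 := hf.euler_lagrange hz v
  have h2 := h v
  linarith

/-- Near z the coefficient is the inverse of a smooth operator-valued function applied to a smooth
covector, and operator inversion is smooth at an invertible operator. -/
theorem contDiffAt_sprayCoeff {z : E × E} (hz : z ∈ slit O) :
    ContDiffAt ℝ ∞ (fun z : E × E => sprayCoeff f z.1 z.2) z := by
  have hL := hf.contDiffAt_energy hz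
  let R : (E × E →L[ℝ] ℝ) →L[ℝ] (E →L[ℝ] ℝ) :=
    (ContinuousLinearMap.compL ℝ E (E × E) ℝ).flip (.inr ℝ E E)
  let R' : (E × E →L[ℝ] ℝ) →L[ℝ] (E →L[ℝ] ℝ) :=
    (ContinuousLinearMap.compL ℝ E (E × E) ℝ).flip (.inl ℝ E E)
  let g : E × E → E →L[ℝ] E →L[ℝ] ℝ := fun z =>
    (1 / 2 : ℝ) • R.comp ((fderiv ℝ (fderiv ℝ (energy f)) z).comp (.inr ℝ E E))
  let cov : E × E → E →L[ℝ] ℝ := fun z =>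
    (1 / 4 : ℝ) • (R (fderiv ℝ (fderiv ℝ (energy f)) z (z.2, 0)) - R' (fderiv ℝ (energy f) z))
  have hg : ∀ z ∈ slit O, g z = fibreMetric (f z.1) z.2 := by
    intro z hz
    ext u v
    rw [hf.fibreMetric_eq hz]
    simp [g, R]
  have hev : (fun z : E × E => sprayCoeff f z.1 z.2) =ᶠ[𝓝 z] fun z => (g z).inverse (cov z) := by
    filter_upwards [hf.isOpen_slit.mem_nhds hz] with z hz
    rw [hg z hz, sprayCoeff, ← map_smul]
    congr 1
    ext v
    rw [smul_apply, hf.sprayCovector_eq hz]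
    simp [cov, R, R']
  refine ContDiffAt.congr_of_eventuallyEq ?_ hev
  have h2 := hL.fderiv_infty.fderiv_infty
  have h1 := hL.fderiv_infty
  have hgs : ContDiffAt ℝ ∞ g z :=
    (contDiffAt_const.clm_comp (h2.clm_comp contDiffAt_const)).const_smul _
  have hcov : ContDiffAt ℝ ∞ cov z :=
    ((R.contDiff.contDiffAt.comp z (h2.clm_apply (contDiffAt_snd.prodMk contDiffAt_const))).sub
      (R'.contDiff.contDiffAt.comp z h1)).const_smul _
  obtain ⟨e, he⟩ := hf.exists_fibreMetric_equiv hz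
  have hinv : ContDiffAt ℝ ∞ (ContinuousLinearMap.inverse : (E →L[ℝ] E →L[ℝ] ℝ) → _) (g z) := by
    rw [hg z hz, ← he]
    exact contDiffAt_map_inverse e
  exact (hinv.comp z hgs).clm_apply hcov

theorem hasFDerivAt_sprayCoeff {x y : E} (hz : (x, y) ∈ slit O) :
    HasFDerivAt (sprayCoeff f x) (connCoeff f x y) y := by
  have h := hasFDerivAt_slice_right (φ := fun z : E × E => sprayCoeff f z.1 z.2)
    (hf.contDiffAt_sprayCoeff hz).differentiableAt_infty
  exact h.differentiableAt.hasFDerivAt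

theorem connCoeff_eq {x y : E} (hz : (x, y) ∈ slit O) (v : E) :
    connCoeff f x y v = fderiv ℝ (fun z : E × E => sprayCoeff f z.1 z.2) (x, y) (0, v) := by
  have h := hasFDerivAt_slice_right (φ := fun z : E × E => sprayCoeff f z.1 z.2)
    (hf.contDiffAt_sprayCoeff hz).differentiableAt_infty
  rw [connCoeff]
  erw [h.fderiv]
  simp

theorem contDiffAt_connCoeff {z : E × E} (hz : z ∈ slit O) :
    ContDiffAt ℝ ∞ (fun z : E × E => connCoeff f z.1 z.2) z := by
  have h1 : (fun z : E × E => connCoeff f z.1 z.2) =ᶠ[𝓝 z]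
      fun z => (fderiv ℝ (fun z : E × E => sprayCoeff f z.1 z.2) z).comp (.inr ℝ E E) := by
    filter_upwards [hf.isOpen_slit.mem_nhds hz] with z hz
    ext v
    rw [hf.connCoeff_eq hz]
    simp
  exact ((hf.contDiffAt_sprayCoeff hz).fderiv_infty.clm_comp
    contDiffAt_const).congr_of_eventuallyEq h1

/-- The Finsler function is constant along horizontal directions. -/
theorem fderiv_energy_horizontal {x y : E} (hz : (x, y) ∈ slit O) (v : E) :
    fderiv ℝ (energy f) (x, y) (v, -connCoeff f x y v) = 0 := by
  have hL := hf.contDiffAt_energy hz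
  have hS := hf.contDiffAt_sprayCoeff hz
  -- The Euler-Lagrange equation contracted with y: the energy is constant along the spray.
  have hrad : ∀ z ∈ slit O, 2 * fderiv ℝ (energy f) z (0, sprayCoeff f z.1 z.2)
      = fderiv ℝ (energy f) z (z.2, 0) := by
    intro z hz
    have hL := hf.contDiffAt_energy hz
    have h1 := hf.euler_lagrange hz z.2
    have h2 := hf.euler_fderiv hz (0, sprayCoeff f z.1 z.2)
    have h3 := hf.euler_fderiv hz (z.2, 0)
    have h4 : ((0, (0 : E)) : E × E) = 0 := rfl
    dsimp only at h1 h2 h3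
    rw [h4, map_zero] at h3
    linarith
  have hA : HasFDerivAt
      (fun z : E × E => 2 * fderiv ℝ (energy f) z (0, sprayCoeff f z.1 z.2)) _ (x, y) :=
    (hL.fderiv_infty.differentiableAt_infty.hasFDerivAt.clm_apply
      ((hasFDerivAt_const (0 : E) (x, y)).prodMk
        hS.differentiableAt_infty.hasFDerivAt)).const_mul 2
  have hB : HasFDerivAt (fun z : E × E => fderiv ℝ (energy f) z (z.2, 0)) _ (x, y) :=
    hL.fderiv_infty.differentiableAt_infty.hasFDerivAt.clm_apply
      ((ContinuousLinearMap.inl ℝ E E).comp (.snd ℝ E E)).hasFDerivAt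
  have hAB := hA.unique (hB.congr_of_eventuallyEq (by
    filter_upwards [hf.isOpen_slit.mem_nhds hz] with z hz
    exact hrad z hz))
  -- The vertical derivative of the contracted identity, minus the Euler-Lagrange equation itself,
  -- loses all second derivatives of the energy and leaves the claim.
  have h := congrArg (fun T : E × E →L[ℝ] ℝ => T (0, v)) hAB
  have hEL := hf.euler_lagrange hz v
  simp only [FunLike.coe_smul, Pi.smul_apply, add_apply,
    ContinuousLinearMap.comp_apply, ContinuousLinearMap.flip_apply,
    ContinuousLinearMap.prod_apply, zero_apply, smul_eq_mul,
    ContinuousLinearMap.coe_snd', ContinuousLinearMap.inl_apply] at h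
  rw [← hf.connCoeff_eq hz, hL.fderiv_fderiv_comm (0, v), hL.fderiv_fderiv_comm (0, v)] at h
  have hs : ((v, -connCoeff f x y v) : E × E) = (v, 0) - (0, connCoeff f x y v) := by simp
  rw [hs, map_sub]
  linarith

end IsLocalFinsler

variable {E : Type u} [NormedAddCommGroup E] [NormedSpace ℝ E]

/-! ### Changes of coordinates -/

/-- The change of coordinates of the tangent bundle induced by the change of coordinates `φ` of
the base. -/
def tangentLift (φ : E → E) (z : E × E) : E × E := (φ z.1, fderiv ℝ φ z.1 z.2)

/-- On the open set `U`, the map `φ` is a change of coordinates between the Finsler functions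
`f` and `f'`. -/
structure IsCoordChange (f f' : E → E → ℝ) (O O' : Set E) (φ : E → E) (U : Set E) : Prop where
  isOpen : IsOpen U
  subset : U ⊆ O
  mapsTo : ∀ x ∈ U, φ x ∈ O'
  smooth : ∀ x ∈ U, ContDiffAt ℝ ∞ φ x
  bijective : ∀ x ∈ U, Function.Bijective (fderiv ℝ φ x)
  eq : ∀ x ∈ U, ∀ y, f x y = f' (φ x) (fderiv ℝ φ x y)

namespace IsLocalFinsler

variable {f : E → E → ℝ} {O : Set E} [FiniteDimensional ℝ E] (hf : IsLocalFinsler f O)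
include hf

/-- One total derivative along the horizontal vector (u, -N u) replaces the separate partial
derivatives, because the chain rule for `tangentLift` acts on such vectors. -/
theorem berwaldCoeff_eq {x y : E} (hz : (x, y) ∈ slit O) {ξ : E → E → E}
    (hξ : DifferentiableAt ℝ (fun z : E × E => ξ z.1 z.2) (x, y)) (u : E) :
    berwaldCoeff f ξ x y u
      = fderiv ℝ (fun z : E × E => ξ z.1 z.2) (x, y) (u, -connCoeff f x y u)
        + fderiv ℝ (fun z : E × E => connCoeff f z.1 z.2) (x, y) (0, ξ x y) u := by
  have hN := (hf.contDiffAt_connCoeff hz).differentiableAt_infty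
  have h1 := (hasFDerivAt_slice_left hξ).fderiv
  have h2 : fderiv ℝ (ξ x) y = _ := (hasFDerivAt_slice_right hξ).fderiv
  have h3 : fderiv ℝ (connCoeff f x) y = _ := (hasFDerivAt_slice_right hN).fderiv
  rw [berwaldCoeff, h1, h2, h3]
  have h4 : ((u, -connCoeff f x y u) : E × E) = (u, 0) - (0, connCoeff f x y u) := by simp
  rw [h4, map_sub]
  simp

theorem curvatureCoeff_eq {x y : E} (hz : (x, y) ∈ slit O) (u v : E) :
    curvatureCoeff f x y u v
      = fderiv ℝ (fun z : E × E => connCoeff f z.1 z.2) (x, y) (v, -connCoeff f x y v) u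
        - fderiv ℝ (fun z : E × E => connCoeff f z.1 z.2) (x, y) (u, -connCoeff f x y u) v := by
  have hN := (hf.contDiffAt_connCoeff hz).differentiableAt_infty
  have h1 := (hasFDerivAt_slice_left hN).fderiv
  have h3 : fderiv ℝ (connCoeff f x) y = _ := (hasFDerivAt_slice_right hN).fderiv
  rw [curvatureCoeff, h1, h3]
  have h4 : ∀ u : E, ((u, -connCoeff f x y u) : E × E) = (u, 0) - (0, connCoeff f x y u) := by
    simp
  rw [h4, h4, map_sub, map_sub]
  simp only [ContinuousLinearMap.comp_apply, ContinuousLinearMap.inl_apply,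
    ContinuousLinearMap.inr_apply, sub_apply]
  abel

end IsLocalFinsler

namespace IsCoordChange

variable {f f' : E → E → ℝ} {O O' U : Set E} {φ : E → E}
  (hc : IsCoordChange f f' O O' φ U)
include hc

theorem mem_slit {z : E × E} (hz : z ∈ slit U) : z ∈ slit O := ⟨hc.subset hz.1, hz.2⟩

theorem tangentLift_mem {z : E × E} (hz : z ∈ slit U) : tangentLift φ z ∈ slit O' :=
  ⟨hc.mapsTo _ hz.1, fun h => hz.2 ((hc.bijective _ hz.1).1 (h.trans (map_zero _).symm))⟩

theorem isOpen_slit : IsOpen (slit U) := hc.isOpen.prod isOpen_compl_singleton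

theorem hasFDerivAt_fderiv_apply {z : E × E} (hz : z.1 ∈ U) {g : E × E → E}
    {g' : E × E →L[ℝ] E} (hg : HasFDerivAt g g' z) :
    HasFDerivAt (fun z : E × E => fderiv ℝ φ z.1 (g z))
      ((fderiv ℝ φ z.1).comp g'
        + ((fderiv ℝ (fderiv ℝ φ) z.1).comp (.fst ℝ E E)).flip (g z)) z := by
  have h2 : HasFDerivAt (fun z : E × E => fderiv ℝ φ z.1)
      ((fderiv ℝ (fderiv ℝ φ) z.1).comp (.fst ℝ E E)) z :=
    HasFDerivAt.comp (f := fun z : E × E => z.1) z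
      (hc.smooth _ hz).fderiv_infty.differentiableAt_infty.hasFDerivAt hasFDerivAt_fst
  exact h2.clm_apply hg

theorem hasFDerivAt_tangentLift {z : E × E} (hz : z.1 ∈ U) :
    HasFDerivAt (tangentLift φ)
      (((fderiv ℝ φ z.1).comp (.fst ℝ E E)).prod ((fderiv ℝ φ z.1).comp (.snd ℝ E E)
        + ((fderiv ℝ (fderiv ℝ φ) z.1).comp (.fst ℝ E E)).flip z.2)) z := by
  have h1 : HasFDerivAt (fun z : E × E => φ z.1) ((fderiv ℝ φ z.1).comp (.fst ℝ E E)) z :=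
    HasFDerivAt.comp (f := fun z : E × E => z.1) z
      (hc.smooth _ hz).differentiableAt_infty.hasFDerivAt hasFDerivAt_fst
  exact h1.prodMk (hc.hasFDerivAt_fderiv_apply hz hasFDerivAt_snd)

variable (hf' : IsLocalFinsler f' O')
include hf'

theorem fderiv_energy {z : E × E} (hz : z ∈ slit U) (a b : E) :
    fderiv ℝ (energy f) z (a, b) = fderiv ℝ (energy f') (tangentLift φ z)
      (fderiv ℝ φ z.1 a, fderiv ℝ φ z.1 b + fderiv ℝ (fderiv ℝ φ) z.1 a z.2) := by
  have h1 : energy f =ᶠ[𝓝 z] fun z => energy f' (tangentLift φ z) := by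
    filter_upwards [hc.isOpen_slit.mem_nhds hz] with z hz
    simp [energy, hc.eq z.1 hz.1, tangentLift]
  have h2 := (hf'.contDiffAt_energy (hc.tangentLift_mem hz)).differentiableAt_infty.hasFDerivAt.comp
    z (hc.hasFDerivAt_tangentLift hz.1)
  rw [h1.fderiv_eq]
  erw [h2.fderiv]
  simp

theorem fderiv_fderiv_energy {z : E × E} (hz : z ∈ slit U) (a b v : E) :
    fderiv ℝ (fderiv ℝ (energy f)) z (a, b) (0, v)
      = fderiv ℝ (fderiv ℝ (energy f')) (tangentLift φ z)
          (fderiv ℝ φ z.1 a, fderiv ℝ φ z.1 b + fderiv ℝ (fderiv ℝ φ) z.1 a z.2)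
          (0, fderiv ℝ φ z.1 v)
        + fderiv ℝ (energy f') (tangentLift φ z) (0, fderiv ℝ (fderiv ℝ φ) z.1 a v) := by
  have hL' := hf'.contDiffAt_energy (hc.tangentLift_mem hz)
  have hL : ContDiffAt ℝ ∞ (energy f) z := by
    have h1 : energy f =ᶠ[𝓝 z] fun z => energy f' (tangentLift φ z) := by
      filter_upwards [hc.isOpen_slit.mem_nhds hz] with z hz
      simp [energy, hc.eq z.1 hz.1, tangentLift]
    refine ContDiffAt.congr_of_eventuallyEq ?_ h1
    have hφ := hc.smooth _ hz.1
    have h2 : ContDiffAt ℝ ∞ (tangentLift φ) z :=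
      (hφ.comp z contDiffAt_fst).prodMk
        ((hφ.fderiv_infty.comp z contDiffAt_fst).clm_apply contDiffAt_snd)
    exact hL'.comp z h2
  have h1 : (fun z => fderiv ℝ (energy f) z (0, v)) =ᶠ[𝓝 z]
      fun z => fderiv ℝ (energy f') (tangentLift φ z) (0, fderiv ℝ φ z.1 v) := by
    filter_upwards [hc.isOpen_slit.mem_nhds hz] with z hz
    rw [hc.fderiv_energy hf' hz]
    simp
  have h2 : HasFDerivAt (fun z => fderiv ℝ (energy f) z (0, v)) _ z :=
    hL.fderiv_infty.differentiableAt_infty.hasFDerivAt.clm_apply (hasFDerivAt_const _ _)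
  have h3 : HasFDerivAt
      (fun z => fderiv ℝ (energy f') (tangentLift φ z) (0, fderiv ℝ φ z.1 v)) _ z :=
    (hL'.fderiv_infty.differentiableAt_infty.hasFDerivAt.comp z
      (hc.hasFDerivAt_tangentLift hz.1)).clm_apply
      ((hasFDerivAt_const (0 : E) z).prodMk
        (hc.hasFDerivAt_fderiv_apply hz.1 (hasFDerivAt_const v z)))
  have h4 := congrArg (fun T : E × E →L[ℝ] ℝ => T (a, b)) (h2.unique (h3.congr_of_eventuallyEq h1))
  simpa [add_comm] using h4

variable (hf : IsLocalFinsler f O) [FiniteDimensional ℝ E]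
include hf

/-- The right-hand side solves the Euler-Lagrange equation of f'. In the chain rule for the energy
the two first-order terms with d²φ(y, v) cancel, and what remains of d²φ is absorbed by the shift by
d²φ(y, y)/2. Bijectivity of dφ lets the test vector be written as dφ(v). -/
theorem sprayCoeff {x y : E} (hz : (x, y) ∈ slit U) :
    sprayCoeff f' (φ x) (fderiv ℝ φ x y)
      = fderiv ℝ φ x (sprayCoeff f x y) - (1 / 2 : ℝ) • fderiv ℝ (fderiv ℝ φ) x y y := by
  have hz' := hc.tangentLift_mem hz
  refine hf'.sprayCoeff_unique hz' fun v' => ?_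
  obtain ⟨v, rfl⟩ := (hc.bijective x hz.1).2 v'
  have hEL := hf.euler_lagrange (hc.mem_slit hz) v
  rw [hc.fderiv_fderiv_energy hf' hz, hc.fderiv_fderiv_energy hf' hz, hc.fderiv_energy hf' hz,
    (hc.smooth x hz.1).fderiv_fderiv_comm y v] at hEL
  simp only [map_zero, zero_apply, zero_add, add_zero, tangentLift] at hEL
  have h0 : ((0, (0 : E)) : E × E) = 0 := rfl
  rw [h0, map_zero] at hEL
  set D2 := fderiv ℝ (fderiv ℝ (energy f')) (φ x, fderiv ℝ φ x y)
  set D1 := fderiv ℝ (energy f') (φ x, fderiv ℝ φ x y)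
  set q := fderiv ℝ (fderiv ℝ φ) x y y
  set r := fderiv ℝ (fderiv ℝ φ) x v y
  have e1 : ((0, fderiv ℝ φ x (_root_.sprayCoeff f x y) - (1 / 2 : ℝ) • q) : E × E)
      = (0, fderiv ℝ φ x (_root_.sprayCoeff f x y)) - (1 / 2 : ℝ) • (0, q) := by simp
  have e2 : ((fderiv ℝ φ x y, q) : E × E) = (fderiv ℝ φ x y, 0) + (0, q) := by simp
  have e3 : ((fderiv ℝ φ x v, r) : E × E) = (fderiv ℝ φ x v, 0) + (0, r) := by simp
  rw [e2, e3] at hEL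
  rw [e1]
  simp only [map_add, map_sub, map_smul, add_apply, sub_apply, smul_apply, smul_eq_mul]
    at hEL ⊢
  linarith

/-- The transformation law of the spray differentiated in the fibre variable; the factor 1/2
disappears by symmetry of the second derivative of φ. -/
theorem connCoeff {x y : E} (hz : (x, y) ∈ slit U) (u : E) :
    connCoeff f' (φ x) (fderiv ℝ φ x y) (fderiv ℝ φ x u)
      = fderiv ℝ φ x (connCoeff f x y u) - fderiv ℝ (fderiv ℝ φ) x y u := by
  have h1 := (hf'.hasFDerivAt_sprayCoeff (hc.tangentLift_mem hz)).comp y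
    (fderiv ℝ φ x).hasFDerivAt
  have h2 := ((fderiv ℝ φ x).hasFDerivAt.comp y (hf.hasFDerivAt_sprayCoeff (hc.mem_slit hz))).sub
    (((fderiv ℝ (fderiv ℝ φ) x).hasFDerivAt.clm_apply (hasFDerivAt_id y)).const_smul (1 / 2 : ℝ))
  have h3 := h1.unique (h2.congr_of_eventuallyEq (by
    filter_upwards [isOpen_compl_singleton.mem_nhds (show y ∈ ({0}ᶜ : Set E) from hz.2)]
      with y' hy'
    exact hc.sprayCoeff hf' hf ⟨hz.1, hy'⟩))
  have h4 := congrArg (fun T : E →L[ℝ] E => T u) h3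
  simp only [ContinuousLinearMap.comp_apply, sub_apply, smul_apply, add_apply,
    ContinuousLinearMap.flip_apply, id, ContinuousLinearMap.id_apply,
    (hc.smooth x hz.1).fderiv_fderiv_comm u y] at h4
  refine h4.trans ?_
  module

/-- The derivative of the transformation law of the connection coefficients. -/
theorem fderiv_connCoeff {x y : E} (hz : (x, y) ∈ slit U) (u a b : E) :
    fderiv ℝ (fun z : E × E => _root_.connCoeff f' z.1 z.2) (tangentLift φ (x, y))
        (fderiv ℝ φ x a, fderiv ℝ φ x b + fderiv ℝ (fderiv ℝ φ) x a y) (fderiv ℝ φ x u)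
      + _root_.connCoeff f' (φ x) (fderiv ℝ φ x y) (fderiv ℝ (fderiv ℝ φ) x a u)
      = fderiv ℝ φ x (fderiv ℝ (fun z : E × E => _root_.connCoeff f z.1 z.2) (x, y) (a, b) u)
        + fderiv ℝ (fderiv ℝ φ) x a (_root_.connCoeff f x y u)
        - (fderiv ℝ (fderiv ℝ (fderiv ℝ φ)) x a y u + fderiv ℝ (fderiv ℝ φ) x b u) := by
  have hN := (hf.contDiffAt_connCoeff (hc.mem_slit hz)).differentiableAt_infty.hasFDerivAt
  have hN' := (hf'.contDiffAt_connCoeff (hc.tangentLift_mem hz)).differentiableAt_infty.hasFDerivAt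
  have h1 : HasFDerivAt (fun z : E × E =>
      _root_.connCoeff f' (tangentLift φ z).1 (tangentLift φ z).2 (fderiv ℝ φ z.1 u)) _ (x, y) :=
    (hN'.comp (x, y) (hc.hasFDerivAt_tangentLift hz.1)).clm_apply
      (hc.hasFDerivAt_fderiv_apply hz.1 (hasFDerivAt_const u (x, y)))
  have h2 : HasFDerivAt (fun z : E × E => fderiv ℝ φ z.1 (_root_.connCoeff f z.1 z.2 u)) _ (x, y) :=
    hc.hasFDerivAt_fderiv_apply hz.1 (hN.clm_apply (hasFDerivAt_const u (x, y)))
  have hφ2 : HasFDerivAt (fun z : E × E => fderiv ℝ (fderiv ℝ φ) z.1)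
      ((fderiv ℝ (fderiv ℝ (fderiv ℝ φ)) x).comp (.fst ℝ E E)) (x, y) :=
    HasFDerivAt.comp (f := fun z : E × E => z.1) (x, y)
      (hc.smooth _ hz.1).fderiv_infty.fderiv_infty.differentiableAt_infty.hasFDerivAt
      hasFDerivAt_fst
  have h3 : HasFDerivAt (fun z : E × E => fderiv ℝ (fderiv ℝ φ) z.1 z.2 u) _ (x, y) :=
    (hφ2.clm_apply hasFDerivAt_snd).clm_apply (hasFDerivAt_const u (x, y))
  have h4 := h1.unique ((h2.sub h3).congr_of_eventuallyEq (by
    filter_upwards [hc.isOpen_slit.mem_nhds hz] with z hz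
    exact hc.connCoeff hf' hf hz u))
  have h5 := congrArg (fun T : E × E →L[ℝ] E => T (a, b)) h4
  simpa [tangentLift, add_comm, add_left_comm, add_assoc] using h5

/-- The tangent lift of φ sends horizontal vectors to horizontal vectors: the second derivative of φ
in its differential cancels the inhomogeneous term in the law of N. -/
theorem horizontal {x y : E} (hz : (x, y) ∈ slit U) (u : E) :
    fderiv ℝ φ x (-_root_.connCoeff f x y u) + fderiv ℝ (fderiv ℝ φ) x u y
      = -_root_.connCoeff f' (φ x) (fderiv ℝ φ x y) (fderiv ℝ φ x u) := by
  rw [hc.connCoeff hf' hf hz, (hc.smooth x hz.1).fderiv_fderiv_comm y u, map_neg]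
  abel

/-- The horizontal Berwald derivative does not depend on the coordinates. -/
theorem berwaldCoeff {x y : E} (hz : (x, y) ∈ slit U) {ξ ξ' : E → E → E}
    (hξ : DifferentiableAt ℝ (fun z : E × E => ξ z.1 z.2) (x, y))
    (hξ' : DifferentiableAt ℝ (fun z : E × E => ξ' z.1 z.2) (tangentLift φ (x, y)))
    (h : ∀ᶠ z in 𝓝 (x, y), fderiv ℝ φ z.1 (ξ z.1 z.2) = ξ' (φ z.1) (fderiv ℝ φ z.1 z.2))
    (u : E) :
    berwaldCoeff f' ξ' (φ x) (fderiv ℝ φ x y) (fderiv ℝ φ x u)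
      = fderiv ℝ φ x (berwaldCoeff f ξ x y u) := by
  have h1 : HasFDerivAt (fun z : E × E => fderiv ℝ φ z.1 (ξ z.1 z.2)) _ (x, y) :=
    hc.hasFDerivAt_fderiv_apply hz.1 hξ.hasFDerivAt
  have h2 := hξ'.hasFDerivAt.comp (x, y) (hc.hasFDerivAt_tangentLift hz.1)
  have h3 := congrArg (fun T : E × E →L[ℝ] E => T (u, -_root_.connCoeff f x y u))
    (h2.unique (h1.congr_of_eventuallyEq (by
      filter_upwards [h] with z hz
      exact hz.symm)))
  simp only [ContinuousLinearMap.comp_apply, ContinuousLinearMap.prod_apply, add_apply,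
    ContinuousLinearMap.flip_apply, ContinuousLinearMap.coe_fst', ContinuousLinearMap.coe_snd',
    hc.horizontal hf' hf hz] at h3
  have h4 := hc.fderiv_connCoeff hf' hf hz u 0 (ξ x y)
  have h5 := h.self_of_nhds
  dsimp only at h5
  simp only [map_zero, zero_apply, add_zero, zero_add, h5] at h4
  rw [hf'.berwaldCoeff_eq (hc.tangentLift_mem hz) hξ', hf.berwaldCoeff_eq (hc.mem_slit hz) hξ,
    map_add]
  erw [h3, h4]
  rw [(hc.smooth x hz.1).fderiv_fderiv_comm (ξ x y) u]
  abel

-- Symmetry of the second derivative of `fderiv ℝ φ` exchanges the first two arguments;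
-- differentiating the symmetry of the second derivative of φ exchanges the last two.
omit hf' hf [FiniteDimensional ℝ E] in
theorem fderiv_fderiv_fderiv_symm {x : E} (hx : x ∈ U) (u v y : E) :
    fderiv ℝ (fderiv ℝ (fderiv ℝ φ)) x v y u = fderiv ℝ (fderiv ℝ (fderiv ℝ φ)) x u y v := by
  have hφ := (hc.smooth x hx).fderiv_infty
  have key : ∀ a b : E, fderiv ℝ (fderiv ℝ (fderiv ℝ φ)) x y a b
      = fderiv ℝ (fderiv ℝ (fderiv ℝ φ)) x y b a := by
    intro a b
    have h2 := hφ.fderiv_infty.differentiableAt_infty.hasFDerivAt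
    have h3 : ∀ a b : E, HasFDerivAt (fun x => fderiv ℝ (fderiv ℝ φ) x a b) _ x := fun a b =>
      (h2.clm_apply (hasFDerivAt_const a x)).clm_apply (hasFDerivAt_const b x)
    have h4 := (h3 a b).unique ((h3 b a).congr_of_eventuallyEq (by
      filter_upwards [hc.isOpen.mem_nhds hx] with x' hx'
      exact (hc.smooth x' hx').fderiv_fderiv_comm a b))
    have h5 := congrArg (fun T : E →L[ℝ] E => T y) h4
    simpa using h5
  rw [hφ.fderiv_fderiv_comm v y, key, hφ.fderiv_fderiv_comm y u]

/-- The curvature does not depend on the coordinates. -/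
theorem curvatureCoeff {x y : E} (hz : (x, y) ∈ slit U) (u v : E) :
    curvatureCoeff f' (φ x) (fderiv ℝ φ x y) (fderiv ℝ φ x u) (fderiv ℝ φ x v)
      = fderiv ℝ φ x (curvatureCoeff f x y u v) := by
  have h1 := hc.fderiv_connCoeff hf' hf hz u v (-_root_.connCoeff f x y v)
  have h2 := hc.fderiv_connCoeff hf' hf hz v u (-_root_.connCoeff f x y u)
  rw [hc.horizontal hf' hf hz] at h1 h2
  rw [hf'.curvatureCoeff_eq (hc.tangentLift_mem hz), hf.curvatureCoeff_eq (hc.mem_slit hz),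
    map_sub]
  have hφ := hc.smooth x hz.1
  -- Curvature is antisymmetric in u and v, so the symmetric third-order terms, like the remaining
  -- second-order ones, cancel in the difference.
  rw [hc.fderiv_fderiv_fderiv_symm hz.1 u v y, hφ.fderiv_fderiv_comm v u,
    hφ.fderiv_fderiv_comm v, map_neg, neg_apply] at h1
  rw [hφ.fderiv_fderiv_comm u (_root_.connCoeff f x y v), map_neg, neg_apply] at h2
  simp only [tangentLift] at h1 h2 ⊢
  rw [eq_sub_of_add_eq h1, eq_sub_of_add_eq h2]
  abel

end IsCoordChange

variable {E : Type u} [NormedAddCommGroup E] [NormedSpace ℝ E]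

/-! ### Parallel transport along straight segments in coordinates -/

theorem eq_of_hasDerivWithinAt_zero {g : ℝ → E}
    (h : ∀ s ∈ Icc (0 : ℝ) 1, HasDerivWithinAt g 0 (Icc 0 1) s) {s : ℝ} (hs : s ∈ Icc (0 : ℝ) 1) :
    g s = g 0 := by
  have := (convex_Icc (0 : ℝ) 1).norm_image_sub_le_of_norm_hasDerivWithin_le (C := 0) h
    (fun _ _ => by simp) (left_mem_Icc.2 zero_le_one) hs
  rw [zero_mul] at this
  exact sub_eq_zero.1 (norm_le_zero_iff.1 this)

/-- `V` is a parallel field of nonzero vectors along the segment from `x` to `x + u`. -/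
def IsTransport (f : E → E → ℝ) (x u : E) (V : ℝ → E) : Prop :=
  ∀ s ∈ Icc (0 : ℝ) 1, V s ≠ 0 ∧
    HasDerivWithinAt V (-(connCoeff f (x + s • u) (V s) u)) (Icc 0 1) s

/-- The segment from `x` to `x + u` lies in `O`. -/
def SegmentIn (O : Set E) (x u : E) : Prop := ∀ s ∈ Icc (0 : ℝ) 1, x + s • u ∈ O

theorem SegmentIn.left {O : Set E} {x u : E} (h : SegmentIn O x u) : x ∈ O := by
  simpa using h 0 (by simp)

theorem SegmentIn.reverse {O : Set E} {x u : E} (h : SegmentIn O x u) :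
    SegmentIn O (x + u) (-u) := by
  intro s hs
  have := h (1 - s) ⟨by linarith [hs.2], by linarith [hs.1]⟩
  convert this using 1
  module

open Classical in
/-- Parallel transport along the segment from `x` to `x + u`, at `z = ((x, u), y)`. -/
def transport (f : E → E → ℝ) (z : (E × E) × E) : E :=
  -- The default value y keeps transport positively homogeneous in y even where no parallel field
  -- exists.
  if h : ∃ V, IsTransport f z.1.1 z.1.2 V ∧ V 0 = z.2 then h.choose 1 else z.2

theorem IsTransport.continuousOn {f : E → E → ℝ} {x u : E} {V : ℝ → E}
    (hV : IsTransport f x u V) : ContinuousOn V (Icc 0 1) :=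
  fun s hs => (hV s hs).2.continuousWithinAt

theorem IsTransport.reverse {f : E → E → ℝ} {x u : E} {V : ℝ → E}
    (hV : IsTransport f x u V) : IsTransport f (x + u) (-u) (fun s => V (1 - s)) := by
  intro s hs
  have hs' : 1 - s ∈ Icc (0 : ℝ) 1 := ⟨by linarith [hs.2], by linarith [hs.1]⟩
  obtain ⟨h1, h2⟩ := hV (1 - s) hs'
  refine ⟨h1, ?_⟩
  have h3 : HasDerivWithinAt (fun s : ℝ => 1 - s) (-1) (Icc 0 1) s := by
    simpa using (hasDerivWithinAt_id s (Icc 0 1)).const_sub 1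
  have h4 := HasDerivWithinAt.scomp s h2 h3
    (fun r hr => ⟨by linarith [hr.2], by linarith [hr.1]⟩)
  refine h4.congr_deriv ?_
  have e : x + u + s • -u = x + (1 - s) • u := by module
  rw [e]
  simp

/-- Transport along r u is read off from the field along u at time r. This turns the derivative of
transport in the displacement into the time derivative of one parallel field. -/
theorem IsTransport.rescale {f : E → E → ℝ} {x u : E} {V : ℝ → E}
    (hV : IsTransport f x u V) {r : ℝ} (hr : r ∈ Icc (0 : ℝ) 1) :
    IsTransport f x (r • u) (fun s => V (r * s)) := by
  intro s hs
  have hm : ∀ s ∈ Icc (0 : ℝ) 1, r * s ∈ Icc (0 : ℝ) 1 := fun s hs =>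
    ⟨mul_nonneg hr.1 hs.1, mul_le_one₀ hr.2 hs.1 hs.2⟩
  obtain ⟨h1, h2⟩ := hV (r * s) (hm s hs)
  refine ⟨h1, ?_⟩
  have h3 : HasDerivWithinAt (fun s : ℝ => r * s) r (Icc 0 1) s := by
    simpa using (hasDerivWithinAt_id s (Icc 0 1)).const_mul r
  have h4 := HasDerivWithinAt.scomp s h2 h3 hm
  refine h4.congr_deriv ?_
  rw [smul_smul, mul_comm s r]
  simp

namespace IsLocalFinsler

variable {f : E → E → ℝ} {O : Set E} (hf : IsLocalFinsler f O)
include hf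

/-- By Euler's identity g(y, y) = f², which is positive. The sign of f itself is not determined by
this, so the indicatrix is studied below on the cone where the Finsler function is positive. -/
theorem ne_zero {x y : E} (hz : (x, y) ∈ slit O) : f x y ≠ 0 := by
  intro h
  have h1 := hf.posDef x hz.1 y hz.2 y hz.2
  rw [hf.fibreMetric_eq hz, hf.fderiv_fderiv_radial hz, hf.euler (z := (x, y)) hz] at h1
  simp [energy, h] at h1

theorem zero {x : E} (hx : x ∈ O) : f x 0 = 0 := by
  have := hf.homog x hx 0 2 (by norm_num)
  rw [smul_zero] at this
  linarith

theorem fderiv_energy_smul {x y : E} (hz : (x, y) ∈ slit O) {r : ℝ} (hr : 0 < r) (a b : E) :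
    fderiv ℝ (energy f) (x, r • y) (a, r • b) = r ^ 2 * fderiv ℝ (energy f) (x, y) (a, b) := by
  have hz' : (x, r • y) ∈ slit O := ⟨hz.1, smul_ne_zero hr.ne' hz.2⟩
  let δ : E × E →L[ℝ] E × E := (ContinuousLinearMap.fst ℝ E E).prod (r • .snd ℝ E E)
  have h1 := HasFDerivAt.comp (f := δ) (x, y)
    (hf.contDiffAt_energy hz').differentiableAt_infty.hasFDerivAt δ.hasFDerivAt
  have h2 := (hf.contDiffAt_energy hz).differentiableAt_infty.hasFDerivAt.const_mul (r ^ 2)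
  have h3 := h1.unique (h2.congr_of_eventuallyEq (by
    filter_upwards [hf.isOpen_slit.mem_nhds hz] with z hz
    exact hf.energy_smul hz.1 z.2 hr))
  exact congrArg (fun T : E × E →L[ℝ] ℝ => T (a, b)) h3

theorem fderiv_fderiv_energy_smul {x y : E} (hz : (x, y) ∈ slit O) {r : ℝ} (hr : 0 < r)
    (a b v : E) :
    fderiv ℝ (fderiv ℝ (energy f)) (x, r • y) (a, r • b) (0, r • v)
      = r ^ 2 * fderiv ℝ (fderiv ℝ (energy f)) (x, y) (a, b) (0, v) := by
  have hz' : (x, r • y) ∈ slit O := ⟨hz.1, smul_ne_zero hr.ne' hz.2⟩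
  let δ : E × E →L[ℝ] E × E := (ContinuousLinearMap.fst ℝ E E).prod (r • .snd ℝ E E)
  have h1 := (HasFDerivAt.comp (f := δ) (x, y)
    (hf.contDiffAt_energy hz').fderiv_infty.differentiableAt_infty.hasFDerivAt
      δ.hasFDerivAt).clm_apply (hasFDerivAt_const ((0, r • v) : E × E) (x, y))
  have h2 := ((hf.contDiffAt_energy hz).fderiv_infty.differentiableAt_infty.hasFDerivAt.clm_apply
    (hasFDerivAt_const ((0, v) : E × E) (x, y))).const_mul (r ^ 2)
  have h3 := h1.unique (h2.congr_of_eventuallyEq (by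
    filter_upwards [hf.isOpen_slit.mem_nhds hz] with z hz
    exact hf.fderiv_energy_smul hz hr 0 v))
  have h4 := congrArg (fun T : E × E →L[ℝ] ℝ => T (a, b)) h3
  simpa [δ] using h4

variable [FiniteDimensional ℝ E]

/-- Degree two in y, by uniqueness. Hence N has degree one, and positive multiples of a parallel
field are parallel. -/
theorem sprayCoeff_smul {x y : E} (hz : (x, y) ∈ slit O) {r : ℝ} (hr : 0 < r) :
    sprayCoeff f x (r • y) = r ^ 2 • sprayCoeff f x y := by
  have hz' : (x, r • y) ∈ slit O := ⟨hz.1, smul_ne_zero hr.ne' hz.2⟩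
  refine hf.sprayCoeff_unique hz' fun v' => ?_
  obtain ⟨v, rfl⟩ : ∃ v, v' = r • v := ⟨r⁻¹ • v', by rw [smul_smul, mul_inv_cancel₀ hr.ne', one_smul]⟩
  have h := hf.euler_lagrange hz v
  have h1 := hf.fderiv_fderiv_energy_smul hz hr 0 (sprayCoeff f x y) v
  have h2 := hf.fderiv_fderiv_energy_smul hz hr y 0 v
  have h3 := hf.fderiv_energy_smul hz hr v 0
  have e1 : ((0, r ^ 2 • sprayCoeff f x y) : E × E) = r • (0, r • sprayCoeff f x y) := by
    simp [smul_smul, pow_two]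
  have e2 : ((r • y, 0) : E × E) = r • (y, r • 0) := by simp
  have e3 : ((r • v, 0) : E × E) = r • (v, r • 0) := by simp
  rw [e1, e2, e3, map_smul, map_smul, map_smul, smul_apply, smul_apply, h1, h2, h3]
  simp only [smul_eq_mul]
  linear_combination r ^ 3 * h

theorem connCoeff_smul {x y : E} (hz : (x, y) ∈ slit O) {r : ℝ} (hr : 0 < r) :
    connCoeff f x (r • y) = r • connCoeff f x y := by
  have hz' : (x, r • y) ∈ slit O := ⟨hz.1, smul_ne_zero hr.ne' hz.2⟩
  have h1 : HasFDerivAt (fun y' => sprayCoeff f x (r • y'))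
      ((connCoeff f x (r • y)).comp (r • ContinuousLinearMap.id ℝ E)) y :=
    HasFDerivAt.comp (f := fun y : E => r • y) y (hf.hasFDerivAt_sprayCoeff hz')
      ((hasFDerivAt_id y).const_smul r)
  have h2 : HasFDerivAt (fun y' => r ^ 2 • sprayCoeff f x y') (r ^ 2 • connCoeff f x y) y :=
    (hf.hasFDerivAt_sprayCoeff hz).const_smul (r ^ 2)
  have h3 : (fun y' => sprayCoeff f x (r • y')) =ᶠ[𝓝 y] fun y' => r ^ 2 • sprayCoeff f x y' := by
    filter_upwards [isOpen_compl_singleton.mem_nhds (show y ∈ ({0}ᶜ : Set E) from hz.2)]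
      with y' hy'
    exact hf.sprayCoeff_smul (x := x) (y := y') ⟨hz.1, hy'⟩ hr
  have h4 := h1.unique (h2.congr_of_eventuallyEq h3)
  ext u
  have h5 : connCoeff f x (r • y) (r • u) = r ^ 2 • connCoeff f x y u :=
    congrArg (fun T : E →L[ℝ] E => T u) h4
  rw [map_smul, pow_two, mul_smul] at h5
  exact smul_right_injective E hr.ne' h5

theorem fderiv_horizontal {x y : E} (hz : (x, y) ∈ slit O) (v : E) :
    fderiv ℝ (fun z : E × E => f z.1 z.2) (x, y) (v, -connCoeff f x y v) = 0 := by
  have h1 := (hf.smooth x hz.1 y hz.2).differentiableAt_infty.hasFDerivAt.pow 2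
  have h2 := hf.fderiv_energy_horizontal hz v
  have h3 : fderiv ℝ (energy f) (x, y) = _ := h1.fderiv
  rw [h3] at h2
  simpa [hf.ne_zero hz] using h2

/-- Parallel transport preserves the Finsler function. -/
theorem isTransport_const {x u : E} {V : ℝ → E} (hV : IsTransport f x u V)
    (hx : SegmentIn O x u) {s : ℝ} (hs : s ∈ Icc (0 : ℝ) 1) : f (x + s • u) (V s) = f x (V 0) := by
  have key : ∀ s ∈ Icc (0 : ℝ) 1, HasDerivWithinAt (fun s => f (x + s • u) (V s)) 0 (Icc 0 1) s := by
    intro s hs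
    have hz : (x + s • u, V s) ∈ slit O := ⟨hx s hs, (hV s hs).1⟩
    have h1 : HasDerivWithinAt (fun s : ℝ => x + s • u) u (Icc 0 1) s := by
      simpa using ((hasDerivWithinAt_id s (Icc 0 1)).smul_const u).const_add x
    have h2 := HasFDerivAt.comp_hasDerivWithinAt (f := fun s => (x + s • u, V s)) s
      (hf.smooth _ hz.1 _ hz.2).differentiableAt_infty.hasFDerivAt (h1.prodMk (hV s hs).2)
    rw [hf.fderiv_horizontal hz] at h2
    exact h2
  simpa using eq_of_hasDerivWithinAt_zero key hs

/-- The connection is regular only away from the zero vector. Both solutions stay in a compact set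
of nonzero vectors, on which a locally Lipschitz field is Lipschitz, so Grönwall uniqueness applies.
-/
theorem isTransport_unique {x u : E} {V V' : ℝ → E} (hV : IsTransport f x u V)
    (hV' : IsTransport f x u V') (hx : SegmentIn O x u) (h0 : V 0 = V' 0) :
    EqOn V V' (Icc 0 1) := by
  let S : Set E := V '' Icc 0 1 ∪ V' '' Icc 0 1
  have hS : IsCompact S := (isCompact_Icc.image_of_continuousOn hV.continuousOn).union
    (isCompact_Icc.image_of_continuousOn hV'.continuousOn)
  have hS0 : ∀ y ∈ S, y ≠ 0 := by
    rintro y (⟨s, hs, rfl⟩ | ⟨s, hs, rfl⟩)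
    · exact (hV s hs).1
    · exact (hV' s hs).1
  let v : ℝ × E → E := fun q => -(connCoeff f (x + q.1 • u) q.2 u)
  have hv : LocallyLipschitzOn (Icc (0 : ℝ) 1 ×ˢ S) v := by
    rintro ⟨s, y⟩ ⟨hs, hy⟩
    have hz : (x + s • u, y) ∈ slit O := ⟨hx s hs, hS0 y hy⟩
    have h1 : ContDiffAt ℝ ∞ v (s, y) :=
      ((ContDiffAt.comp (f := fun q : ℝ × E => (x + q.1 • u, q.2)) (s, y)
        (hf.contDiffAt_connCoeff hz) (by fun_prop)).clm_apply contDiffAt_const).neg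
    obtain ⟨K, t, ht, hK⟩ := (h1.of_le (by simp : (1 : WithTop ℕ∞) ≤ ∞)).exists_lipschitzOnWith
    exact ⟨K, t, mem_nhdsWithin_of_mem_nhds ht, hK⟩
  obtain ⟨K, hK⟩ := hv.exists_lipschitzOnWith_of_compact (isCompact_Icc.prod hS)
  have hder : ∀ {V : ℝ → E}, IsTransport f x u V → ∀ t ∈ Ico (0 : ℝ) 1,
      HasDerivWithinAt V (v (t, V t)) (Ici t) t := fun hV t ht =>
    ((hV t (Ico_subset_Icc_self ht)).2.mono (Icc_subset_Icc_left ht.1)).mono_of_mem_nhdsWithin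
      (Icc_mem_nhdsGE ht.2)
  refine ODE_solution_unique_of_mem_Icc_right (v := fun t y => v (t, y)) (K := K)
    (s := fun _ => S) (fun t ht => ?_)
    hV.continuousOn (hder hV) (fun t ht => Or.inl ⟨t, Ico_subset_Icc_self ht, rfl⟩)
    hV'.continuousOn (hder hV') (fun t ht => Or.inr ⟨t, Ico_subset_Icc_self ht, rfl⟩) h0
  intro y hy y' hy'
  have := hK (x := (t, y)) ⟨Ico_subset_Icc_self ht, hy⟩ (y := (t, y'))
    ⟨Ico_subset_Icc_self ht, hy'⟩
  simpa [Prod.edist_eq] using this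

theorem transport_eq {x u : E} {V : ℝ → E} (hV : IsTransport f x u V) (hx : SegmentIn O x u) :
    transport f ((x, u), V 0) = V 1 := by
  have h : ∃ V', IsTransport f x u V' ∧ V' 0 = V 0 := ⟨V, hV, rfl⟩
  rw [transport, dif_pos h]
  exact hf.isTransport_unique h.choose_spec.1 hV hx h.choose_spec.2 (right_mem_Icc.2 zero_le_one)

theorem isTransport_smul {x u : E} {V : ℝ → E} (hV : IsTransport f x u V) (hx : SegmentIn O x u)
    {r : ℝ} (hr : 0 < r) : IsTransport f x u (fun s => r • V s) := by
  intro s hs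
  refine ⟨smul_ne_zero hr.ne' (hV s hs).1, ?_⟩
  rw [hf.connCoeff_smul ⟨hx s hs, (hV s hs).1⟩ hr, smul_apply, ← smul_neg]
  exact (hV s hs).2.const_smul r

theorem transport_smul {x u : E} (hx : SegmentIn O x u) (y : E) {r : ℝ} (hr : 0 < r) :
    transport f ((x, u), r • y) = r • transport f ((x, u), y) := by
  by_cases h : ∃ V, IsTransport f x u V ∧ V 0 = y
  · obtain ⟨V, hV, rfl⟩ := h
    rw [hf.transport_eq hV hx]
    exact hf.transport_eq (hf.isTransport_smul hV hx hr) hx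
  · have h' : ¬ ∃ V, IsTransport f x u V ∧ V 0 = r • y := by
      rintro ⟨V, hV, hV0⟩
      refine h ⟨_, hf.isTransport_smul hV hx (inv_pos.2 hr), ?_⟩
      simp only [hV0, smul_smul, inv_mul_cancel₀ hr.ne', one_smul]
    rw [transport, transport, dif_neg h, dif_neg h']

omit hf [FiniteDimensional ℝ E] in
theorem _root_.isTransport_zero {x y : E} (hy : y ≠ 0) : IsTransport f x 0 (fun _ => y) := by
  intro s _
  refine ⟨hy, ?_⟩
  simpa using hasDerivWithinAt_const s (Icc (0 : ℝ) 1) y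

theorem transport_zero {x y : E} (hx : x ∈ O) (hy : y ≠ 0) : transport f ((x, 0), y) = y :=
  hf.transport_eq (isTransport_zero (x := x) hy) (fun s _ => by simpa using hx)

/-- Near a point of the zero section over a nonzero vector, parallel transport is defined and
smooth. -/
theorem exists_transport_near {x₀ y₀ : E} (hz₀ : (x₀, y₀) ∈ slit O) :
    ∀ᶠ z in 𝓝 (((x₀, 0), y₀) : (E × E) × E), SegmentIn O z.1.1 z.1.2 ∧
      (∃ V, IsTransport f z.1.1 z.1.2 V ∧ V 0 = z.2) ∧ ContDiffAt ℝ ∞ (transport f) z := by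
  -- The autonomous system x' = u, u' = 0, y' = -N(x, y)u, with the displacement u as a conserved
  -- variable.
  let h : (E × E) × E → (E × E) × E := fun z => ((z.1.2, 0), -(connCoeff f z.1.1 z.2 z.1.2))
  have hh : GermSmooth h ((x₀, 0), y₀) := by
    refine GermSmooth.of_eventually_contDiffAt ?_
    have hp : Continuous fun z : (E × E) × E => (z.1.1, z.2) := by fun_prop
    filter_upwards [hp.continuousAt.preimage_mem_nhds (hf.isOpen_slit.mem_nhds hz₀)] with z hz
    have h1 : ContDiffAt ℝ ∞ (fun z : (E × E) × E => connCoeff f z.1.1 z.2) z :=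
      ContDiffAt.comp (f := fun z : (E × E) × E => (z.1.1, z.2)) z
        (hf.contDiffAt_connCoeff hz) (by fun_prop)
    have h2 : ContDiffAt ℝ ∞ (fun z : (E × E) × E => z.1.2) z := by fun_prop
    exact (h2.prodMk contDiffAt_const).prodMk (h1.clm_apply h2).neg
  obtain ⟨g, hg, hgh⟩ := hh
  -- On W the globally smooth replacement g equals h and the vector is nonzero; a flow of g that
  -- stays in W is a genuine transport.
  let W : Set ((E × E) × E) := {z | h z = g z ∧ (z.1.1, z.2) ∈ slit O}
  have hW : W ∈ 𝓝 (((x₀, 0), y₀) : (E × E) × E) := by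
    have hp : Continuous fun z : (E × E) × E => (z.1.1, z.2) := by fun_prop
    filter_upwards [hp.continuousAt.preimage_mem_nhds (hf.isOpen_slit.mem_nhds hz₀), hgh]
      with z h1 h2 using ⟨h2, h1⟩
  obtain ⟨ε, hε, γ, hγ, hγs⟩ := exists_smooth_flow hg _ hW
  -- The flow lemma integrates ε h; starting with displacement u/ε restores the segment from x to x
  -- + u.
  let σ : (E × E) × E → (E × E) × E := fun z => ((z.1.1, ε⁻¹ • z.1.2), z.2)
  have hσ : Tendsto σ (𝓝 ((x₀, 0), y₀)) (𝓝 ((x₀, 0), y₀)) := by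
    have := (by fun_prop : Continuous σ).tendsto ((x₀, 0), y₀)
    simpa [σ] using this
  have key : ∀ᶠ z in 𝓝 (((x₀, 0), y₀) : (E × E) × E), SegmentIn O z.1.1 z.1.2 ∧
      IsTransport f z.1.1 z.1.2 (fun s => (γ (σ z) s).2) ∧ (γ (σ z) 0).2 = z.2 := by
    filter_upwards [hσ.eventually hγ] with z hz
    obtain ⟨hz0, hz1⟩ := hz
    have hd : ∀ s ∈ Icc (0 : ℝ) 1,
        HasDerivWithinAt (γ (σ z)) (ε • h (γ (σ z) s)) (Icc 0 1) s := fun s hs => by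
      rw [(hz1 s hs).1.1]
      exact (hz1 s hs).2
    have hd1 : ∀ s ∈ Icc (0 : ℝ) 1, HasDerivWithinAt (fun s => (γ (σ z) s).1)
        (ε • h (γ (σ z) s)).1 (Icc 0 1) s := fun s hs =>
      (ContinuousLinearMap.fst ℝ (E × E) E).hasFDerivAt.comp_hasDerivWithinAt s (hd s hs)
    have hd2 : ∀ s ∈ Icc (0 : ℝ) 1, HasDerivWithinAt (fun s => (γ (σ z) s).2)
        (ε • h (γ (σ z) s)).2 (Icc 0 1) s := fun s hs =>
      (ContinuousLinearMap.snd ℝ (E × E) E).hasFDerivAt.comp_hasDerivWithinAt s (hd s hs)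
    have hd12 : ∀ s ∈ Icc (0 : ℝ) 1, HasDerivWithinAt (fun s => (γ (σ z) s).1.2)
        (ε • h (γ (σ z) s)).1.2 (Icc 0 1) s := fun s hs =>
      (ContinuousLinearMap.snd ℝ E E).hasFDerivAt.comp_hasDerivWithinAt s (hd1 s hs)
    have hd11 : ∀ s ∈ Icc (0 : ℝ) 1, HasDerivWithinAt (fun s => (γ (σ z) s).1.1)
        (ε • h (γ (σ z) s)).1.1 (Icc 0 1) s := fun s hs =>
      (ContinuousLinearMap.fst ℝ E E).hasFDerivAt.comp_hasDerivWithinAt s (hd1 s hs)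
    have hu : ∀ s ∈ Icc (0 : ℝ) 1, (γ (σ z) s).1.2 = ε⁻¹ • z.1.2 := fun s hs => by
      rw [eq_of_hasDerivWithinAt_zero (g := fun s => (γ (σ z) s).1.2)
        (fun s hs => by simpa [h] using hd12 s hs) hs, hz0]
    have hx : ∀ s ∈ Icc (0 : ℝ) 1, (γ (σ z) s).1.1 = z.1.1 + s • z.1.2 := fun s hs => by
      have hc : ∀ s ∈ Icc (0 : ℝ) 1,
          HasDerivWithinAt (fun s => (γ (σ z) s).1.1 - s • z.1.2) 0 (Icc 0 1) s := fun s hs => by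
        have h1 := (hd11 s hs).sub ((hasDerivWithinAt_id s (Icc 0 1)).smul_const z.1.2)
        refine h1.congr_deriv ?_
        simp [h, hu s hs, smul_smul, mul_inv_cancel₀ hε.ne']
      have := eq_of_hasDerivWithinAt_zero hc hs
      simp only [hz0, zero_smul, sub_zero] at this
      exact sub_eq_iff_eq_add.1 this
    refine ⟨fun s hs => ?_, fun s hs => ⟨(hz1 s hs).1.2.2, ?_⟩, by rw [hz0]⟩
    · rw [← hx s hs]
      exact (hz1 s hs).1.2.1
    · refine (hd2 s hs).congr_deriv ?_
      simp [h, hu s hs, hx s hs, smul_smul, mul_inv_cancel₀ hε.ne']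
  filter_upwards [key, key.eventually_nhds, hσ.eventually hγs] with z hz hz' hzs
  refine ⟨hz.1, ⟨_, hz.2⟩, ?_⟩
  have h1 : transport f =ᶠ[𝓝 z] fun z => (γ (σ z) 1).2 := by
    filter_upwards [hz'] with w hw
    have := hf.transport_eq hw.2.1 hw.1
    rw [hw.2.2] at this
    exact this
  refine ContDiffAt.congr_of_eventuallyEq ?_ h1
  exact contDiffAt_snd.comp z (hzs.comp z (by fun_prop : ContDiffAt ℝ ∞ σ z))

/-- Parallel transport along short segments is defined and smooth on all nonzero vectors. -/
theorem eventually_transport {x₀ : E} (hx₀ : x₀ ∈ O) :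
    ∀ᶠ q in 𝓝 ((x₀, 0) : E × E), SegmentIn O q.1 q.2 ∧ ∀ y, y ≠ 0 →
      (∃ V, IsTransport f q.1 q.2 V ∧ V 0 = y) ∧ GermSmooth (transport f) (q, y) := by
  have hseg : ∀ᶠ q in 𝓝 ((x₀, 0) : E × E), SegmentIn O q.1 q.2 := by
    refine isCompact_Icc.eventually_forall_of_forall_eventually fun s _ => ?_
    have hc : Continuous fun z : (E × E) × ℝ => z.1.1 + z.2 • z.1.2 := by fun_prop
    refine hc.continuousAt.eventually (hf.isOpen.mem_nhds ?_)
    simpa using hx₀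
  have hsph : ∀ᶠ q in 𝓝 ((x₀, 0) : E × E), ∀ y ∈ Metric.sphere (0 : E) 1,
      (∃ V, IsTransport f q.1 q.2 V ∧ V 0 = y) ∧ GermSmooth (transport f) (q, y) := by
    -- Compactness of the unit sphere gives one neighbourhood of (x₀, 0) valid for all unit vectors;
    -- homogeneity then extends it to all nonzero vectors.
    refine (isCompact_sphere (0 : E) 1).eventually_forall_of_forall_eventually fun y hy => ?_
    have hy0 : y ≠ 0 := by
      rintro rfl
      simp at hy
    have h1 := hf.exists_transport_near ⟨hx₀, hy0⟩
    filter_upwards [h1, h1.eventually_nhds] with z hz hz'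
    exact ⟨hz.2.1, GermSmooth.of_eventually_contDiffAt (hz'.mono fun w hw => hw.2.2)⟩
  filter_upwards [hseg, hseg.eventually_nhds, hsph] with q h1 h2 h3
  refine ⟨h1, fun y hy => ?_⟩
  have hy' : 0 < ‖y‖ := norm_pos_iff.2 hy
  have hys : ‖y‖⁻¹ • y ∈ Metric.sphere (0 : E) 1 := by
    rw [mem_sphere_zero_iff_norm, norm_smul, norm_inv, norm_norm, inv_mul_cancel₀ hy'.ne']
  obtain ⟨⟨V, hV, hV0⟩, hs⟩ := h3 _ hys
  refine ⟨⟨fun s => ‖y‖ • V s, hf.isTransport_smul hV h1 hy', ?_⟩, ?_⟩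
  · simp only [hV0, smul_smul, mul_inv_cancel₀ hy'.ne', one_smul]
  · have h4 : transport f =ᶠ[𝓝 (q, y)] fun z => ‖y‖ • transport f (z.1, ‖y‖⁻¹ • z.2) := by
      filter_upwards [continuousAt_fst.eventually h2] with z hz
      have := hf.transport_smul hz (‖y‖⁻¹ • z.2) hy'
      rw [smul_smul, mul_inv_cancel₀ hy'.ne', one_smul] at this
      exact this
    refine GermSmooth.congr ?_ h4
    have h5 : GermSmooth (fun z : (E × E) × E => transport f (z.1, ‖y‖⁻¹ • z.2)) (q, y) :=
      GermSmooth.comp (h := fun z : (E × E) × E => (z.1, ‖y‖⁻¹ • z.2)) hs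
        (ContDiff.germSmooth (by fun_prop) _)
    exact GermSmooth.comp (f := fun y' : E => ‖y‖ • y') (ContDiff.germSmooth (by fun_prop) _) h5

theorem transport_ne_zero {x u y : E} (hx : SegmentIn O x u)
    (h : ∃ V, IsTransport f x u V ∧ V 0 = y) : transport f ((x, u), y) ≠ 0 := by
  obtain ⟨V, hV, rfl⟩ := h
  rw [hf.transport_eq hV hx]
  exact (hV 1 (right_mem_Icc.2 zero_le_one)).1

theorem apply_transport {x u y : E} (hx : SegmentIn O x u)
    (h : ∃ V, IsTransport f x u V ∧ V 0 = y) :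
    f (x + u) (transport f ((x, u), y)) = f x y := by
  obtain ⟨V, hV, rfl⟩ := h
  rw [hf.transport_eq hV hx]
  simpa using hf.isTransport_const hV hx (right_mem_Icc.2 zero_le_one)

theorem transport_reverse {x u y : E} (hx : SegmentIn O x u)
    (h : ∃ V, IsTransport f x u V ∧ V 0 = y) :
    transport f ((x + u, -u), transport f ((x, u), y)) = y := by
  obtain ⟨V, hV, rfl⟩ := h
  rw [hf.transport_eq hV hx]
  have := hf.transport_eq hV.reverse hx.reverse
  simpa using this

/-- The first-order expansion of parallel transport along short segments. -/
theorem fderiv_transport {x y : E} (hz : (x, y) ∈ slit O) (u : E) :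
    fderiv ℝ (transport f) ((x, 0), y) ((0, u), 0) = -connCoeff f x y u := by
  have hev := hf.eventually_transport hz.1
  have hd := ((hev.self_of_nhds).2 y hz.2).2.contDiffAt.differentiableAt_infty
  have hlim : Tendsto (fun t : ℝ => (x, t • u)) (𝓝[>] 0) (𝓝 (x, 0)) := by
    have : Continuous fun t : ℝ => (x, t • u) := by fun_prop
    have := this.tendsto 0
    rw [zero_smul] at this
    exact this.mono_left nhdsWithin_le_nhds
  -- For a fixed small t > 0, transport along r t u is V(r) for r in [0, 1]. Comparing the two
  -- derivatives at r = 0 gives the claim multiplied by t.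
  obtain ⟨t, ⟨hseg, ht⟩, ht0 : 0 < t⟩ :=
    ((hlim.eventually hev).and self_mem_nhdsWithin).exists
  obtain ⟨⟨V, hV, hV0⟩, -⟩ := ht y hz.2
  have h1 : ∀ r ∈ Icc (0 : ℝ) 1, transport f ((x, r • t • u), y) = V r := by
    intro r hr
    have hs : SegmentIn O x (r • t • u) := fun s hs => by
      rw [smul_smul]
      exact hseg _ ⟨mul_nonneg hs.1 hr.1, mul_le_one₀ hs.2 hr.1 hr.2⟩
    have := hf.transport_eq (hV.rescale hr) hs
    simpa [hV0] using this
  have h2 := (hV 0 (left_mem_Icc.2 zero_le_one)).2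
  rw [zero_smul, add_zero, hV0, map_smul] at h2
  have h3 : HasDerivAt (fun r : ℝ => transport f ((x, r • t • u), y))
      (fderiv ℝ (transport f) ((x, 0), y) ((0, t • u), 0)) 0 := by
    have hl : HasDerivAt (fun r : ℝ => (((x, r • t • u), y) : (E × E) × E)) ((0, t • u), 0) 0 :=
      ((hasDerivAt_const _ _).prodMk
        (by simpa using (hasDerivAt_id (0 : ℝ)).smul_const (t • u))).prodMk (hasDerivAt_const _ _)
    have hd' : HasFDerivAt (transport f) (fderiv ℝ (transport f) ((x, 0), y))
        ((x, (0 : ℝ) • t • u), y) := by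
      rw [zero_smul]
      exact hd.hasFDerivAt
    exact HasFDerivAt.comp_hasDerivAt (f := fun r : ℝ => (((x, r • t • u), y) : (E × E) × E))
      0 hd' hl
  have h4 := (h3.hasDerivWithinAt (s := Icc (0 : ℝ) 1)).congr (fun r hr => (h1 r hr).symm)
    (h1 0 (left_mem_Icc.2 zero_le_one)).symm
  have h5 := (uniqueDiffOn_Icc zero_lt_one 0 (left_mem_Icc.2 zero_le_one)).eq_deriv _ h4 h2
  have e : (((0, t • u), 0) : (E × E) × E) = t • ((0, u), 0) := by simp
  rw [e, map_smul, ← smul_neg] at h5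
  exact smul_right_injective E ht0.ne' h5

end IsLocalFinsler

/-! ### Charts of the tangent bundle -/

section Charts

variable {E : Type u} [NormedAddCommGroup E] [NormedSpace ℝ E]
  {M : Type*} [TopologicalSpace M] [ChartedSpace E M] [IsManifold 𝓘(ℝ, E) ∞ M]

/-- The point with coordinate `x` in the preferred chart at `p`. -/
def chartPt (p : M) (x : E) : M := (extChartAt 𝓘(ℝ, E) p).symm x

/-- The domain of the coordinates of the preferred chart at `p`. -/
def chartDom (p : M) : Set E := (extChartAt 𝓘(ℝ, E) p).target

/-- The tangent vector at `chartPt p x` with given coordinates in the chart at `p`. -/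
def fromChart (p : M) (x : E) : E →L[ℝ] E :=
  tangentCoordChange 𝓘(ℝ, E) p (chartPt p x) (chartPt p x)

/-- The coordinates in the chart at `p` of a tangent vector at `chartPt p x`. -/
def toChart (p : M) (x : E) : E →L[ℝ] E :=
  tangentCoordChange 𝓘(ℝ, E) (chartPt p x) p (chartPt p x)

/-- The transition map from the chart at `p` to the chart at `m`. -/
def transition (p m : M) (x : E) : E := extChartAt 𝓘(ℝ, E) m (chartPt p x)

/-- The domain of the transition map from the chart at `p` to the chart at `m`. -/
def transitionDom (p m : M) : Set E :=
  chartDom p ∩ (extChartAt 𝓘(ℝ, E) p).symm ⁻¹' (extChartAt 𝓘(ℝ, E) m).source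

theorem isOpen_chartDom (p : M) : IsOpen (chartDom p : Set E) := isOpen_extChartAt_target p

theorem chartPt_mem_source {p : M} {x : E} (hx : x ∈ chartDom p) :
    chartPt p x ∈ (extChartAt 𝓘(ℝ, E) p).source := (extChartAt 𝓘(ℝ, E) p).map_target hx

theorem mem_source_self (m : M) : m ∈ (extChartAt 𝓘(ℝ, E) m).source := mem_extChartAt_source m

theorem chartPt_center (p : M) : chartPt p (extChartAt 𝓘(ℝ, E) p p) = p :=
  extChartAt_to_inv p

theorem center_mem (p : M) : extChartAt 𝓘(ℝ, E) p p ∈ (chartDom p : Set E) :=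
  mem_extChartAt_target p

theorem isOpen_transitionDom (p m : M) : IsOpen (transitionDom p m : Set E) :=
  (continuousOn_extChartAt_symm p).isOpen_inter_preimage (isOpen_chartDom p)
    (isOpen_extChartAt_source m)

theorem mem_transitionDom_self {p : M} {x : E} (hx : x ∈ chartDom p) :
    x ∈ transitionDom p (chartPt p x) := ⟨hx, mem_source_self _⟩

theorem tangentCoordChange_inv {p m z : M} (hp : z ∈ (extChartAt 𝓘(ℝ, E) p).source)
    (hm : z ∈ (extChartAt 𝓘(ℝ, E) m).source) (v : E) :
    tangentCoordChange 𝓘(ℝ, E) m p z (tangentCoordChange 𝓘(ℝ, E) p m z v) = v := by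
  rw [tangentCoordChange_comp ⟨⟨hp, hm⟩, hp⟩, tangentCoordChange_self hp]

theorem toChart_fromChart {p : M} {x : E} (hx : x ∈ chartDom p) (v : E) :
    toChart p x (fromChart p x v) = v :=
  tangentCoordChange_inv (chartPt_mem_source hx) (mem_source_self _) v

theorem fromChart_toChart {p : M} {x : E} (hx : x ∈ chartDom p) (v : E) :
    fromChart p x (toChart p x v) = v :=
  tangentCoordChange_inv (mem_source_self _) (chartPt_mem_source hx) v

theorem fromChart_center (p : M) (v : E) :
    fromChart p (extChartAt 𝓘(ℝ, E) p p) v = v := by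
  rw [fromChart, chartPt_center]
  exact tangentCoordChange_self (mem_source_self p)

theorem toChart_center (p : M) (v : E) :
    toChart p (extChartAt 𝓘(ℝ, E) p p) v = v := by
  rw [toChart, chartPt_center]
  exact tangentCoordChange_self (mem_source_self p)

theorem transition_mem {p m : M} {x : E} (hx : x ∈ transitionDom p m) :
    transition p m x ∈ chartDom m := (extChartAt 𝓘(ℝ, E) m).map_source hx.2

theorem chartPt_transition {p m : M} {x : E} (hx : x ∈ transitionDom p m) :
    chartPt m (transition p m x) = chartPt p x := (extChartAt 𝓘(ℝ, E) m).left_inv hx.2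

theorem transition_mem_transitionDom {p m : M} {x : E} (hx : x ∈ transitionDom p m) :
    transition p m x ∈ transitionDom m p := by
  refine ⟨transition_mem hx, ?_⟩
  change chartPt m (transition p m x) ∈ (extChartAt 𝓘(ℝ, E) p).source
  rw [chartPt_transition hx]
  exact chartPt_mem_source hx.1

theorem transition_transition {p m : M} {x : E} (hx : x ∈ transitionDom p m) :
    transition m p (transition p m x) = x := by
  rw [transition, chartPt_transition hx]
  exact (extChartAt 𝓘(ℝ, E) p).right_inv hx.1

theorem contDiffAt_transition {p m : M} {x : E} (hx : x ∈ transitionDom p m) :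
    ContDiffAt ℝ ∞ (transition p m) x := by
  have h := contDiffOn_ext_coord_change (I := 𝓘(ℝ, E)) (n := ∞) m p
  refine h.contDiffAt (Filter.mem_of_superset ((isOpen_transitionDom p m).mem_nhds hx) ?_)
  intro y hy
  rw [PartialEquiv.trans_source]
  exact hy

/-- Identifies the fibre coordinate change of the tangent bundle with the derivative of the
transition map, so that the transformation laws for `IsCoordChange` apply to charts of M. -/
theorem fderiv_transition {p m : M} {x : E} (hx : x ∈ transitionDom p m) :
    fderiv ℝ (transition p m) x = tangentCoordChange 𝓘(ℝ, E) p m (chartPt p x) := by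
  have h := hasFDerivWithinAt_tangentCoordChange (I := 𝓘(ℝ, E)) (x := p) (y := m)
    (z := chartPt p x) ⟨chartPt_mem_source hx.1, hx.2⟩
  rw [modelWithCornersSelf_coe, range_id, hasFDerivWithinAt_univ] at h
  have e : extChartAt 𝓘(ℝ, E) p (chartPt p x) = x := (extChartAt 𝓘(ℝ, E) p).right_inv hx.1
  rw [e] at h
  exact h.fderiv

theorem bijective_fderiv_transition {p m : M} {x : E} (hx : x ∈ transitionDom p m) :
    Function.Bijective (fderiv ℝ (transition p m) x) := by
  rw [fderiv_transition hx]
  exact Function.bijective_iff_has_inverse.2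
    ⟨tangentCoordChange 𝓘(ℝ, E) m p (chartPt p x),
      tangentCoordChange_inv (chartPt_mem_source hx.1) hx.2,
      tangentCoordChange_inv hx.2 (chartPt_mem_source hx.1)⟩

theorem fromChart_transition {p m : M} {x : E} (hx : x ∈ transitionDom p m) (y : E) :
    fromChart m (transition p m x) (fderiv ℝ (transition p m) x y) = fromChart p x y := by
  rw [fromChart, chartPt_transition hx, fderiv_transition hx]
  exact tangentCoordChange_comp ⟨⟨chartPt_mem_source hx.1, hx.2⟩, mem_source_self _⟩

theorem toChart_transition {p m : M} {x : E} (hx : x ∈ transitionDom p m) (y : E) :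
    toChart m (transition p m x) y = fderiv ℝ (transition p m) x (toChart p x y) := by
  rw [toChart, chartPt_transition hx, fderiv_transition hx]
  exact (tangentCoordChange_comp
    ⟨⟨mem_source_self _, chartPt_mem_source hx.1⟩, hx.2⟩).symm

theorem contMDiffOn_chartPt (p : M) :
    ContMDiffOn 𝓘(ℝ, E) 𝓘(ℝ, E) ∞ (chartPt p : E → M) (chartDom p) :=
  contMDiffOn_extChartAt_symm p

/-- The coordinates `(x, y)` of the tangent bundle are smooth. -/
theorem contMDiffAt_tangentPt {p : M} {z : E × E} (hz : z.1 ∈ chartDom p) :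
    ContMDiffAt 𝓘(ℝ, E × E) 𝓘(ℝ, E).tangent ∞
      (fun z : E × E => (⟨chartPt p z.1, fromChart p z.1 z.2⟩ : TangentBundle 𝓘(ℝ, E) M)) z := by
  rw [Bundle.contMDiffAt_totalSpace]
  constructor
  · exact ContMDiffAt.comp (g := (chartPt p : E → M)) (f := fun w : E × E => w.1) z
      ((contMDiffOn_chartPt p).contMDiffAt
      ((isOpen_chartDom p).mem_nhds hz)) contDiff_fst.contMDiff.contMDiffAt
  · have hx := mem_transitionDom_self hz
    have h1 : ContDiffAt ℝ ∞ (fun w : E × E =>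
        fderiv ℝ (transition p (chartPt p z.1)) w.1 w.2) z :=
      (ContDiffAt.comp (f := fun w : E × E => w.1) z
        (contDiffAt_transition hx).fderiv_infty contDiffAt_fst).clm_apply contDiffAt_snd
    refine h1.contMDiffAt.congr_of_eventuallyEq ?_
    have h2 : ∀ᶠ w in 𝓝 z, w.1 ∈ transitionDom p (chartPt p z.1) :=
      continuousAt_fst.eventually ((isOpen_transitionDom _ _).mem_nhds hx)
    filter_upwards [h2] with w hw
    rw [fderiv_transition hw]
    exact tangentCoordChange_comp
      ⟨⟨chartPt_mem_source hw.1, mem_source_self (chartPt p w.1)⟩, hw.2⟩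

/-- The coordinate expression in the chart at `p` of a vector field on `M`. -/
def chartField (p : M) (X : (x : M) → TangentSpace 𝓘(ℝ, E) x) (x : E) : E :=
  toChart p x (X (chartPt p x))

/-- Smoothness of a section is expressed in the trivialization at the point itself; multiplication
by the derivative of the transition map carries it to the chart at p. -/
theorem contDiffAt_chartField {X : (x : M) → TangentSpace 𝓘(ℝ, E) x} (hX : IsSmoothField X)
    {p : M} {x : E} (hx : x ∈ chartDom p) : ContDiffAt ℝ ∞ (chartField p X) x := by
  have h1 : ContMDiffAt 𝓘(ℝ, E) 𝓘(ℝ, E).tangent ∞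
      (fun x => (⟨chartPt p x, X (chartPt p x)⟩ : TangentBundle 𝓘(ℝ, E) M)) x :=
    ContMDiffAt.comp x (hX (chartPt p x)) ((contMDiffOn_chartPt p).contMDiffAt
      ((isOpen_chartDom p).mem_nhds hx))
  rw [Bundle.contMDiffAt_totalSpace] at h1
  have h2 := h1.2.contDiffAt
  set m := chartPt p x with hm
  have hxm : x ∈ transitionDom p m := mem_transitionDom_self hx
  have hx' := transition_mem_transitionDom hxm
  have h3 : ContDiffAt ℝ ∞ (fun w : E => fderiv ℝ (transition m p) (transition p m w)) x :=
    (contDiffAt_transition hx').fderiv_infty.comp x (contDiffAt_transition hxm)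
  refine (h3.clm_apply h2).congr_of_eventuallyEq ?_
  filter_upwards [(isOpen_transitionDom p m).mem_nhds hxm] with w hw
  rw [fderiv_transition (transition_mem_transitionDom hw), chartPt_transition hw]
  exact (tangentCoordChange_comp
    ⟨⟨mem_source_self (chartPt p w), hw.2⟩, chartPt_mem_source hw.1⟩).symm

end Charts

/-! ### Finsler functions on a manifold read in charts -/

namespace FinslerFunction

variable {E : Type u} [NormedAddCommGroup E] [NormedSpace ℝ E]
  {M : Type*} [TopologicalSpace M] [ChartedSpace E M] [IsManifold 𝓘(ℝ, E) ∞ M]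
  (F : FinslerFunction E M)

theorem coordFun_eq (p : M) (x y : E) :
    F.coordFun p x y = F.val (chartPt p x) (fromChart p x y) := rfl

theorem contDiffAt_coordFun {p : M} {x y : E} (hx : x ∈ chartDom p) (hy : y ≠ 0) :
    ContDiffAt ℝ ∞ (fun z : E × E => F.coordFun p z.1 z.2) (x, y) := by
  have h1 : ContMDiffOn 𝓘(ℝ, E × E) 𝓘(ℝ, E).tangent ∞
      (fun z : E × E => (⟨chartPt p z.1, fromChart p z.1 z.2⟩ : TangentBundle 𝓘(ℝ, E) M))
      (slit (chartDom p)) := fun z hz => (contMDiffAt_tangentPt hz.1).contMDiffWithinAt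
  have h2 := F.smooth_toFun.comp h1 (fun z hz h => hz.2 (by
    have h3 := toChart_fromChart hz.1 z.2
    have h4 : fromChart p z.1 z.2 = 0 := h
    rwa [h4, map_zero, eq_comm] at h3))
  have hopen : IsOpen (slit (chartDom p : Set E)) :=
    (isOpen_chartDom p).prod isOpen_compl_singleton
  exact (h2.contMDiffAt (hopen.mem_nhds (show (x, y) ∈ slit _ from ⟨hx, hy⟩))).contDiffAt

theorem contDiffAt_val (m : M) {y : E} (hy : y ≠ 0) : ContDiffAt ℝ ∞ (F.val m) y := by
  have h := F.contDiffAt_coordFun (center_mem m) hy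
  have h1 : ContDiffAt ℝ ∞ (fun y => F.coordFun m (extChartAt 𝓘(ℝ, E) m m) y) y :=
    ContDiffAt.comp (f := fun y : E => (extChartAt 𝓘(ℝ, E) m m, y)) y h (by fun_prop)
  refine h1.congr_of_eventuallyEq (Eventually.of_forall fun y => ?_)
  simp only [coordFun_eq, fromChart_center, chartPt_center]

/-- Definiteness is assumed in the chart of the point, whereas `coordFun p` is the Finsler function
after the linear change `fromChart p x`; the Hessian is pulled back along it. -/
theorem fibreMetric_comp {g : E → ℝ} (A : E →L[ℝ] E)
    (hg : ∀ y, y ≠ 0 → ContDiffAt ℝ ∞ g y) {y : E} (hA : Function.Injective A) (hy : y ≠ 0)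
    (u v : E) : fibreMetric (fun y => g (A y)) y u v = fibreMetric g (A y) (A u) (A v) := by
  have hA0 : ∀ y, y ≠ 0 → A y ≠ 0 := fun y hy h => hy (hA (h.trans (map_zero A).symm))
  have hg2 : ∀ y, y ≠ 0 → ContDiffAt ℝ ∞ (fun y => g y ^ 2) (A y) := fun y hy =>
    (hg (A y) (hA0 y hy)).pow 2
  have h1 : (fderiv ℝ fun y => g (A y) ^ 2) =ᶠ[𝓝 y]
      fun y => (fderiv ℝ (fun y => g y ^ 2) (A y)).comp A := by
    filter_upwards [isOpen_compl_singleton.mem_nhds (show y ∈ ({0}ᶜ : Set E) from hy)]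
      with y' hy'
    exact (HasFDerivAt.comp (f := A) y' (hg2 y' hy').differentiableAt_infty.hasFDerivAt
      A.hasFDerivAt).fderiv
  have h2 := (HasFDerivAt.comp (f := A) y
    (hg2 y hy).fderiv_infty.differentiableAt_infty.hasFDerivAt A.hasFDerivAt).clm_comp
    (hasFDerivAt_const A y)
  rw [fibreMetric, fibreMetric, h1.fderiv_eq]
  erw [h2.fderiv]
  simp

theorem isLocalFinsler (p : M) : IsLocalFinsler (F.coordFun p) (chartDom p) where
  isOpen := isOpen_chartDom p
  smooth := fun _ hx _ hy => F.contDiffAt_coordFun hx hy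
  homog := fun x _ y r hr => by
    rw [coordFun_eq, coordFun_eq, map_smul]
    exact F.homogeneous _ _ r hr
  posDef := fun x hx y hy u hu => by
    have hinj : Function.Injective (fromChart p x) :=
      Function.LeftInverse.injective (toChart_fromChart hx)
    have h0 : ∀ y, y ≠ 0 → fromChart p x y ≠ 0 := fun y hy h =>
      hy (hinj (h.trans (map_zero _).symm))
    have h := fibreMetric_comp (g := F.val (chartPt p x)) (fromChart p x)
      (fun y hy => F.contDiffAt_val _ hy) hinj hy u u
    change 0 < fibreMetric (fun y => F.val (chartPt p x) (fromChart p x y)) y u u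
    rw [h]
    exact F.posDef _ _ (h0 y hy) _ (h0 u hu)

theorem isCoordChange (p m : M) :
    IsCoordChange (F.coordFun p) (F.coordFun m) (chartDom p) (chartDom m) (transition p m)
      (transitionDom p m) where
  isOpen := isOpen_transitionDom p m
  subset := inter_subset_left
  mapsTo := fun _ hx => transition_mem hx
  smooth := fun _ hx => contDiffAt_transition hx
  bijective := fun _ hx => bijective_fderiv_transition hx
  eq := fun x hx y => by
    rw [coordFun_eq, coordFun_eq, fromChart_transition hx, chartPt_transition hx]

end FinslerFunction

namespace FinslerFunction

variable {E : Type u} [NormedAddCommGroup E] [NormedSpace ℝ E]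
  {M : Type*} [TopologicalSpace M] [ChartedSpace E M] [IsManifold 𝓘(ℝ, E) ∞ M]
  (F : FinslerFunction E M)

/-! ### Maps of the indicatrices in coordinates -/

/-- The cone over the indicatrix, in the coordinates of the chart at `p`. -/
def coordCone (p : M) (x : E) : Set E := {y | 0 < F.coordFun p x y}

variable {F} {p : M} {x : E}

theorem ne_zero_of_mem_coordCone (hx : x ∈ chartDom p) {y : E} (hy : y ∈ F.coordCone p x) :
    y ≠ 0 := by
  rintro rfl
  have h : 0 < F.coordFun p x 0 := hy
  rw [(F.isLocalFinsler p).zero hx] at h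
  exact lt_irrefl _ h

theorem smul_mem_coordCone (hx : x ∈ chartDom p) {y : E} (hy : y ∈ F.coordCone p x) {r : ℝ}
    (hr : 0 < r) : r • y ∈ F.coordCone p x := by
  change 0 < F.coordFun p x (r • y)
  rw [(F.isLocalFinsler p).homog x hx y r hr]
  exact mul_pos hr hy

theorem mem_coordCone_of_eq_one {y : E} (hy : F.coordFun p x y = 1) : y ∈ F.coordCone p x := by
  change 0 < F.coordFun p x y
  rw [hy]
  exact one_pos

theorem isOpen_setOf_coordCone (F : FinslerFunction E M) (p : M) :
    IsOpen {z : E × E | z.1 ∈ chartDom p ∧ z.2 ∈ F.coordCone p z.1} := by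
  rw [isOpen_iff_mem_nhds]
  rintro z ⟨hz1, hz2⟩
  have hc := (F.contDiffAt_coordFun hz1 (ne_zero_of_mem_coordCone hz1 hz2)).continuousAt
  filter_upwards [hc.eventually (lt_mem_nhds hz2),
    continuousAt_fst.eventually ((isOpen_chartDom p).mem_nhds hz1)] with w h1 h2
  exact ⟨h2, h1⟩

theorem coordFun_toChart (hx : x ∈ chartDom p) (v : E) :
    F.coordFun p x (toChart p x v) = F.val (chartPt p x) v := by
  rw [coordFun_eq, fromChart_toChart hx]

theorem toChart_mem_coordCone (hx : x ∈ chartDom p) {v : E}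
    (hv : v ∈ F.cone (chartPt p x)) : toChart p x v ∈ F.coordCone p x := by
  change 0 < F.coordFun p x (toChart p x v)
  rw [coordFun_toChart hx]
  exact hv

theorem coordFun_toChart_indicatrix (hx : x ∈ chartDom p) (z : F.Indicatrix (chartPt p x)) :
    F.coordFun p x (toChart p x z.1) = 1 := by
  rw [coordFun_toChart hx, z.2]

theorem toChart_indicatrix_mem (hx : x ∈ chartDom p) (z : F.Indicatrix (chartPt p x)) :
    toChart p x z.1 ∈ F.coordCone p x :=
  mem_coordCone_of_eq_one (coordFun_toChart_indicatrix hx z)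

/-- The map `ψ` is the coordinate expression of the map `g` of the indicatrix at
`chartPt p x`. -/
structure Represents (F : FinslerFunction E M) (p : M) (x : E)
    (g : F.Indicatrix (chartPt p x) → F.Indicatrix (chartPt p x)) (ψ : E → E) : Prop where
  apply : ∀ z, toChart p x (g z).1 = ψ (toChart p x z.1)
  homog : ∀ y ∈ F.coordCone p x, ∀ r : ℝ, 0 < r → ψ (r • y) = r • ψ y

theorem toChart_normalize (hx : x ∈ chartDom p) {y : E} (hy : y ∈ F.coordCone p x) :
    toChart p x (normalize (F := F) (p := chartPt p x) (fromChart p x y) hy).1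
      = (F.coordFun p x y)⁻¹ • y := by
  change toChart p x ((F.val (chartPt p x) (fromChart p x y))⁻¹ • fromChart p x y) = _
  rw [map_smul, toChart_fromChart hx, coordFun_eq]

namespace Represents

variable {g h : F.Indicatrix (chartPt p x) → F.Indicatrix (chartPt p x)} {ψ χ : E → E}

theorem toChart_homExt (hg : F.Represents p x g ψ) (hx : x ∈ chartDom p) {y : E}
    (hy : y ∈ F.coordCone p x) :
    toChart p x (homExt (fun z => (g z).1) (fromChart p x y)) = ψ y := by
  have hpos : 0 < F.coordFun p x y := hy
  have hpos' : 0 < F.val (chartPt p x) (fromChart p x y) := hy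
  rw [homExt, dif_pos hpos', map_smul, hg.apply, toChart_normalize hx hy,
    hg.homog y hy _ (inv_pos.2 hpos), smul_smul, ← coordFun_eq, mul_inv_cancel₀ hpos.ne',
    one_smul]

theorem coordFun_apply (hg : F.Represents p x g ψ) (hx : x ∈ chartDom p) {y : E}
    (hy : y ∈ F.coordCone p x) : F.coordFun p x (ψ y) = F.coordFun p x y := by
  rw [← hg.toChart_homExt hx hy, coordFun_toChart hx]
  exact val_homExt_of_mem g hy

theorem mapsTo (hg : F.Represents p x g ψ) (hx : x ∈ chartDom p) {y : E}
    (hy : y ∈ F.coordCone p x) : ψ y ∈ F.coordCone p x := by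
  change 0 < F.coordFun p x (ψ y)
  rw [hg.coordFun_apply hx hy]
  exact hy

theorem homExt_eq (hg : F.Represents p x g ψ) (hx : x ∈ chartDom p) {v : E}
    (hv : v ∈ F.cone (chartPt p x)) :
    homExt (fun z => (g z).1) v = fromChart p x (ψ (toChart p x v)) := by
  rw [← hg.toChart_homExt hx (toChart_mem_coordCone hx hv), fromChart_toChart hx,
    fromChart_toChart hx]

theorem isSmoothOnIndicatrix (hg : F.Represents p x g ψ) (hx : x ∈ chartDom p)
    (hψ : ∀ y ∈ F.coordCone p x, ContDiffAt ℝ ∞ ψ y) :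
    IsSmoothOnIndicatrix (fun z => (g z).1) := by
  have h : ContDiffOn ℝ ∞ (fun v => fromChart p x (ψ (toChart p x v)))
      (F.cone (chartPt p x)) := fun v hv =>
    ((fromChart p x).contDiff.contDiffAt.comp v ((hψ _ (toChart_mem_coordCone hx hv)).comp v
      (toChart p x).contDiff.contDiffAt)).contDiffWithinAt
  exact h.congr fun v hv => hg.homExt_eq hx hv

theorem id (F : FinslerFunction E M) (p : M) (x : E) :
    F.Represents p x (fun z => z) (fun y => y) := ⟨fun _ => rfl, fun _ _ _ _ => rfl⟩

theorem comp (hg : F.Represents p x g ψ) (hh : F.Represents p x h χ) (hx : x ∈ chartDom p) :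
    F.Represents p x (g ∘ h) (fun y => ψ (χ y)) where
  apply := fun z => by rw [Function.comp_apply, hg.apply, hh.apply]
  homog := fun y hy r hr => by
    rw [hh.homog y hy r hr, hg.homog _ (hh.mapsTo hx hy) r hr]

theorem congr (hg : F.Represents p x g ψ) (hx : x ∈ chartDom p)
    (h : ∀ y ∈ F.coordCone p x, χ y = ψ y) : F.Represents p x g χ where
  apply := fun z => by rw [hg.apply, h _ (toChart_indicatrix_mem hx z)]
  homog := fun y hy r hr => by
    rw [h _ (smul_mem_coordCone hx hy hr), h y hy, hg.homog y hy r hr]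

end Represents

theorem isOpen_cone (hx : x ∈ chartDom p) : IsOpen (F.coordCone p x) := by
  have h := (isOpen_setOf_coordCone F p).preimage (by fun_prop : Continuous fun y : E => (x, y))
  convert h using 1
  ext y
  simp [hx]

theorem isOpen_cone' (F : FinslerFunction E M) (m : M) : IsOpen (F.cone m) := by
  have h := isOpen_cone (F := F) (center_mem m)
  convert h using 1
  ext y
  change 0 < F.val m y ↔ 0 < F.coordFun m (extChartAt 𝓘(ℝ, E) m m) y
  rw [coordFun_eq, fromChart_center, chartPt_center]

theorem homExt_of_eq_one {m : M} (f : F.Indicatrix m → E) {v : E} (hv : F.val m v = 1) :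
    homExt f v = f ⟨v, hv⟩ := by
  have hpos : 0 < F.val m v := by rw [hv]; exact one_pos
  have h1 : normalize (F := F) v hpos = ⟨v, hv⟩ := by
    apply Subtype.ext
    change (F.val m v)⁻¹ • v = v
    rw [hv, inv_one, one_smul]
  rw [homExt, dif_pos hpos, h1, hv, one_smul]

theorem homExt_smul {m : M} (f : F.Indicatrix m → E) {v : E} (hv : v ∈ F.cone m) {r : ℝ}
    (hr : 0 < r) : homExt f (r • v) = r • homExt f v := by
  have hpos : 0 < F.val m v := hv
  have h1 : F.val m (r • v) = r * F.val m v := F.homogeneous m v r hr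
  have hpos' : 0 < F.val m (r • v) := by
    rw [h1]
    exact mul_pos hr hpos
  have h2 : normalize (F := F) (r • v) hpos' = normalize (F := F) v hpos := by
    apply Subtype.ext
    change (F.val m (r • v))⁻¹ • r • v = (F.val m v)⁻¹ • v
    rw [h1, smul_smul, mul_inv, mul_comm r⁻¹, mul_assoc, inv_mul_cancel₀ hr.ne', mul_one]
  rw [homExt, homExt, dif_pos hpos, dif_pos hpos', h2, h1, mul_smul]

/-- The coordinate expression of a smooth map of the indicatrix. -/
theorem exists_represents (hx : x ∈ chartDom p)
    {g : F.Indicatrix (chartPt p x) → F.Indicatrix (chartPt p x)}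
    (hg : IsSmoothOnIndicatrix (fun z => (g z).1)) :
    ∃ ψ : E → E, F.Represents p x g ψ ∧ ∀ y ∈ F.coordCone p x, ContDiffAt ℝ ∞ ψ y := by
  refine ⟨fun y => toChart p x (homExt (fun z => (g z).1) (fromChart p x y)), ⟨fun z => ?_,
    fun y hy r hr => ?_⟩, fun y hy => ?_⟩
  · rw [fromChart_toChart hx, homExt_of_eq_one _ z.2]
    rfl
  · rw [map_smul]
    exact (congrArg _ (homExt_smul (F := F) (m := chartPt p x) _ (v := fromChart p x y) hy
      hr)).trans (map_smul _ _ _)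
  · have h1 : ContDiffAt ℝ ∞ (homExt (fun z => (g z).1)) (fromChart p x y) :=
      hg.contDiffAt ((isOpen_cone' F _).mem_nhds hy)
    exact (toChart p x).contDiff.contDiffAt.comp y
      (h1.comp y (fromChart p x).contDiff.contDiffAt)

/-- The maps `ψ` and `ψ'` are the coordinate expressions of an element of the holonomy group at
`chartPt p x` and of its inverse. -/
def IsHolonomy (F : FinslerFunction E M) (p : M) (x : E) (ψ ψ' : E → E) : Prop :=
  ∃ g : F.diffGroup (chartPt p x), g ∈ F.holonomyGroup (chartPt p x) ∧
    F.Represents p x g.1 ψ ∧ F.Represents p x g⁻¹.1 ψ'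

namespace IsHolonomy

variable {ψ ψ' χ χ' : E → E}

theorem id (F : FinslerFunction E M) (p : M) (x : E) :
    F.IsHolonomy p x (fun y => y) (fun y => y) :=
  ⟨1, one_mem _, Represents.id F p x, Represents.id F p x⟩

theorem inv (h : F.IsHolonomy p x ψ ψ') : F.IsHolonomy p x ψ' ψ := by
  obtain ⟨g, hg, h1, h2⟩ := h
  refine ⟨g⁻¹, inv_mem hg, h2, ?_⟩
  rw [inv_inv]
  exact h1

theorem comp (h : F.IsHolonomy p x ψ ψ') (h' : F.IsHolonomy p x χ χ') (hx : x ∈ chartDom p) :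
    F.IsHolonomy p x (fun y => ψ (χ y)) (fun y => χ' (ψ' y)) := by
  obtain ⟨g, hg, h1, h2⟩ := h
  obtain ⟨k, hk, h3, h4⟩ := h'
  refine ⟨g * k, mul_mem hg hk, h1.comp h3 hx, ?_⟩
  rw [mul_inv_rev]
  exact h4.comp h2 hx

theorem left_inv (h : F.IsHolonomy p x ψ ψ') (hx : x ∈ chartDom p) {y : E}
    (hy : y ∈ F.coordCone p x) : ψ' (ψ y) = y := by
  obtain ⟨g, hg, h1, h2⟩ := h
  have h3 := (h2.comp h1 hx).toChart_homExt hx hy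
  have h4 : ∀ z, (g⁻¹.1 ∘ g.1) z = z := fun z => g.1.symm_apply_apply z
  simp only [h4] at h3
  rw [← h3, homExt_id (F := F) (p := chartPt p x) (y := fromChart p x y) hy,
    toChart_fromChart hx]

theorem mapsTo (h : F.IsHolonomy p x ψ ψ') (hx : x ∈ chartDom p) {y : E}
    (hy : y ∈ F.coordCone p x) : ψ y ∈ F.coordCone p x := by
  obtain ⟨g, hg, h1, h2⟩ := h
  exact h1.mapsTo hx hy

theorem homog (h : F.IsHolonomy p x ψ ψ') {y : E}
    (hy : y ∈ F.coordCone p x) {r : ℝ} (hr : 0 < r) : ψ (r • y) = r • ψ y := by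
  obtain ⟨g, hg, h1, h2⟩ := h
  exact h1.homog y hy r hr

theorem of_translation (hx : x ∈ chartDom p) (τ : Equiv.Perm (F.Indicatrix (chartPt p x)))
    (hτ : F.IsParallelTranslation (chartPt p x) (chartPt p x) τ)
    (h : F.Represents p x τ ψ) (h' : F.Represents p x τ.symm ψ')
    (hψ : ∀ y ∈ F.coordCone p x, ContDiffAt ℝ ∞ ψ y)
    (hψ' : ∀ y ∈ F.coordCone p x, ContDiffAt ℝ ∞ ψ' y) : F.IsHolonomy p x ψ ψ' :=
  ⟨⟨τ, h.isSmoothOnIndicatrix hx hψ, h'.isSmoothOnIndicatrix hx hψ'⟩,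
    Subgroup.subset_closure hτ, h, h'⟩

end IsHolonomy

/-! ### Parallel translation along segments -/

/-- The tangent vector with coordinates `(x, y)` in the chart at `p`. -/
def tangentPt (p : M) (x y : E) : TangentBundle 𝓘(ℝ, E) M := ⟨chartPt p x, fromChart p x y⟩

variable [FiniteDimensional ℝ E]

/-- The definition of a parallel field uses, at each time t, the chart at c(t), while the transport
equation is in the fixed chart at p. The law `IsCoordChange.horizontal` converts one equation into
the other. -/
theorem isParallelAlong_of_isTransport {u : E} {V : ℝ → E}
    (hx : SegmentIn (chartDom p) x u) (hV : IsTransport (F.coordFun p) x u V) :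
    F.IsParallelAlong (fun s => chartPt p (x + s • u)) (fun s => tangentPt p (x + s • u) (V s)) where
  proj_eq := fun _ _ => rfl
  ne_zero := fun s hs h => (hV s hs).1 (by
    have h1 := toChart_fromChart (hx s hs) (V s)
    have h2 : fromChart p (x + s • u) (V s) = 0 := h
    rwa [h2, map_zero, eq_comm] at h1)
  hasDeriv := fun t ht => by
    set m := chartPt p (x + t • u) with hm
    have hxt : x + t • u ∈ transitionDom p m := mem_transitionDom_self (hx t ht)
    have hc := F.isCoordChange p m
    have hz : (x + t • u, V t) ∈ slit (transitionDom p m) := ⟨hxt, (hV t ht).1⟩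
    have hcoord : ∀ s, x + s • u ∈ transitionDom p m →
        fibreCoord m (tangentPt p (x + s • u) (V s))
          = fderiv ℝ (transition p m) (x + s • u) (V s) := fun s hs => by
      rw [fderiv_transition hs]
      exact tangentCoordChange_comp ⟨⟨chartPt_mem_source hs.1, mem_source_self _⟩, hs.2⟩
    have hline : HasDerivWithinAt (fun s : ℝ => x + s • u) u (Icc 0 1) t := by
      simpa using ((hasDerivWithinAt_id t (Icc 0 1)).smul_const u).const_add x
    have h1 := HasFDerivAt.comp_hasDerivWithinAt (f := fun s => (x + s • u, V s)) t
      (hc.hasFDerivAt_tangentLift (z := (x + t • u, V t)) hxt) (hline.prodMk (hV t ht).2)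
    have h2 : HasDerivWithinAt (fun s => fderiv ℝ (transition p m) (x + s • u) (V s))
        (fderiv ℝ (transition p m) (x + t • u) (-(connCoeff (F.coordFun p) (x + t • u) (V t) u))
          + fderiv ℝ (fderiv ℝ (transition p m)) (x + t • u) u (V t)) (Icc 0 1) t :=
      (ContinuousLinearMap.snd ℝ E E).hasFDerivAt.comp_hasDerivWithinAt t h1
    have h3 : HasDerivWithinAt (fun s => extChartAt 𝓘(ℝ, E) m (chartPt p (x + s • u)))
        (fderiv ℝ (transition p m) (x + t • u) u) (Icc 0 1) t :=
      HasFDerivAt.comp_hasDerivWithinAt (f := fun s : ℝ => x + s • u) t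
        (contDiffAt_transition hxt).differentiableAt_infty.hasFDerivAt hline
    rw [hc.horizontal (F.isLocalFinsler m) (F.isLocalFinsler p) hz, ← hcoord t hxt] at h2
    have h4 : derivWithin (fun s => extChartAt 𝓘(ℝ, E) m (chartPt p (x + s • u))) (Icc 0 1) t
        = fderiv ℝ (transition p m) (x + t • u) u :=
      h3.derivWithin (uniqueDiffOn_Icc zero_lt_one t ht)
    rw [h4]
    refine h2.congr_of_eventuallyEq ?_ (hcoord t hxt)
    have hcont : ContinuousAt (fun s : ℝ => x + s • u) t := by fun_prop
    exact (hcont.eventually ((isOpen_transitionDom p m).mem_nhds hxt)).filter_mono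
      nhdsWithin_le_nhds |>.mono fun s hs => hcoord s hs

/-- Parallel transport from `x` to `x'` along the segment, in coordinates. -/
def segTransport (F : FinslerFunction E M) (p : M) (x x' y : E) : E :=
  transport (F.coordFun p) ((x, x' - x), y)

/-- Parallel transport along the segment from `x` to `x'` is defined and smooth. -/
def IsTransportable (F : FinslerFunction E M) (p : M) (x x' : E) : Prop :=
  SegmentIn (chartDom p) x (x' - x) ∧ ∀ y, y ≠ 0 →
    (∃ V, IsTransport (F.coordFun p) x (x' - x) V ∧ V 0 = y) ∧
      GermSmooth (transport (F.coordFun p)) ((x, x' - x), y)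

/-- Parallel transport along the segment joining `x` and `x'` is defined and smooth in both
directions. -/
structure Linked (F : FinslerFunction E M) (p : M) (x x' : E) : Prop where
  forward : F.IsTransportable p x x'
  backward : F.IsTransportable p x' x

theorem Linked.symm {x' : E} (h : F.Linked p x x') : F.Linked p x' x := ⟨h.2, h.1⟩

theorem Linked.mem_left {x' : E} (h : F.Linked p x x') : x ∈ chartDom p := h.1.1.left

theorem Linked.mem_right {x' : E} (h : F.Linked p x x') : x' ∈ chartDom p := h.2.1.left

theorem eventually_linked (F : FinslerFunction E M) (p : M) {x₀ : E} (hx₀ : x₀ ∈ chartDom p) :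
    ∀ᶠ q in 𝓝 ((x₀, x₀) : E × E), F.Linked p q.1 q.2 := by
  have h := (F.isLocalFinsler p).eventually_transport hx₀
  have t1 : Tendsto (fun q : E × E => (q.1, q.2 - q.1)) (𝓝 (x₀, x₀)) (𝓝 (x₀, 0)) := by
    have := (by fun_prop : Continuous fun q : E × E => (q.1, q.2 - q.1)).tendsto (x₀, x₀)
    simpa using this
  have t2 : Tendsto (fun q : E × E => (q.2, q.1 - q.2)) (𝓝 (x₀, x₀)) (𝓝 (x₀, 0)) := by
    have := (by fun_prop : Continuous fun q : E × E => (q.2, q.1 - q.2)).tendsto (x₀, x₀)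
    simpa using this
  filter_upwards [t1.eventually h, t2.eventually h] with q h1 h2 using ⟨h1, h2⟩

namespace Linked

variable {x' : E} (h : F.Linked p x x')
include h

theorem segTransport_ne_zero {y : E} (hy : y ≠ 0) : F.segTransport p x x' y ≠ 0 :=
  (F.isLocalFinsler p).transport_ne_zero h.1.1 (h.1.2 y hy).1

theorem coordFun_segTransport {y : E} (hy : y ≠ 0) :
    F.coordFun p x' (F.segTransport p x x' y) = F.coordFun p x y := by
  have := (F.isLocalFinsler p).apply_transport h.1.1 (h.1.2 y hy).1
  rwa [add_sub_cancel] at this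

theorem segTransport_mem {y : E} (hy : y ∈ F.coordCone p x) :
    F.segTransport p x x' y ∈ F.coordCone p x' := by
  change 0 < F.coordFun p x' _
  rw [h.coordFun_segTransport (ne_zero_of_mem_coordCone h.mem_left hy)]
  exact hy

theorem segTransport_inv {y : E} (hy : y ≠ 0) :
    F.segTransport p x' x (F.segTransport p x x' y) = y := by
  have := (F.isLocalFinsler p).transport_reverse h.1.1 (h.1.2 y hy).1
  rwa [add_sub_cancel, neg_sub] at this

theorem segTransport_smul (y : E) {r : ℝ} (hr : 0 < r) :
    F.segTransport p x x' (r • y) = r • F.segTransport p x x' y :=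
  (F.isLocalFinsler p).transport_smul h.1.1 y hr

theorem contDiffAt_segTransport {y : E} (hy : y ≠ 0) :
    ContDiffAt ℝ ∞ (F.segTransport p x x') y :=
  ContDiffAt.comp (f := fun y : E => (((x, x' - x), y) : (E × E) × E)) y
    (h.1.2 y hy).2.contDiffAt (by fun_prop)

/-- Parallel translation of the indicatrix along the segment from `x` to `x'`. -/
def translate (z : F.Indicatrix (chartPt p x)) : F.Indicatrix (chartPt p x') :=
  ⟨fromChart p x' (F.segTransport p x x' (toChart p x z.1)), by
    change F.coordFun p x' _ = 1
    rw [h.coordFun_segTransport (ne_zero_of_mem_coordCone h.mem_left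
      (toChart_indicatrix_mem h.mem_left z)), coordFun_toChart_indicatrix h.mem_left]⟩

theorem toChart_translate (z : F.Indicatrix (chartPt p x)) :
    toChart p x' (h.translate z).1 = F.segTransport p x x' (toChart p x z.1) :=
  toChart_fromChart h.mem_right _

theorem translate_translate (z : F.Indicatrix (chartPt p x)) :
    h.symm.translate (h.translate z) = z := by
  apply Subtype.ext
  change fromChart p x (F.segTransport p x' x (toChart p x' (h.translate z).1)) = z.1
  rw [h.toChart_translate, h.segTransport_inv (ne_zero_of_mem_coordCone h.mem_left
      (toChart_indicatrix_mem h.mem_left z)), fromChart_toChart h.mem_left]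

/-- Parallel translation of the indicatrix along a segment, as a bijection. -/
def translateEquiv : F.Indicatrix (chartPt p x) ≃ F.Indicatrix (chartPt p x') where
  toFun := h.translate
  invFun := h.symm.translate
  left_inv := h.translate_translate
  right_inv := h.symm.translate_translate

theorem isParallelTranslation :
    F.IsParallelTranslation (chartPt p x) (chartPt p x') h.translate := by
  refine .smooth _ _ (fun s => chartPt p (x + s • (x' - x))) ?_ (by simp) (by simp) _
    fun z => ?_
  · have h1 : ContMDiff 𝓘(ℝ, ℝ) 𝓘(ℝ, E) ∞ (fun s : ℝ => x + s • (x' - x)) := by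
      rw [contMDiff_iff_contDiff]
      fun_prop
    exact (contMDiffOn_chartPt p).comp h1.contMDiffOn h.1.1
  · have hz := ne_zero_of_mem_coordCone h.mem_left (toChart_indicatrix_mem h.mem_left z)
    obtain ⟨⟨V, hV, hV0⟩, -⟩ := h.1.2 _ hz
    refine ⟨_, isParallelAlong_of_isTransport h.1.1 hV, ?_, ?_⟩
    · have e : x + (0 : ℝ) • (x' - x) = x := by simp
      change tangentPt p (x + (0 : ℝ) • (x' - x)) (V 0) = _
      rw [e, hV0, tangentPt, fromChart_toChart h.mem_left]
    · have h1 := (F.isLocalFinsler p).transport_eq hV h.1.1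
      rw [hV0] at h1
      have e : x + (1 : ℝ) • (x' - x) = x' := by simp
      change tangentPt p (x + (1 : ℝ) • (x' - x)) (V 1) = _
      rw [e, ← h1]
      rfl

end Linked

/-- Conjugates of holonomies by parallel translations are holonomies. -/
theorem IsHolonomy.conj {x' : E} {ψ ψ' : E → E} (hψ : F.IsHolonomy p x' ψ ψ')
    (h : F.Linked p x x') :
    F.IsHolonomy p x (fun y => F.segTransport p x' x (ψ (F.segTransport p x x' y)))
      (fun y => F.segTransport p x' x (ψ' (F.segTransport p x x' y))) := by
  have hx := h.mem_left
  have hx' := h.mem_right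
  have hne : ∀ {y}, y ∈ F.coordCone p x → y ≠ 0 := fun hy => ne_zero_of_mem_coordCone hx hy
  have hne' : ∀ {y}, y ∈ F.coordCone p x' → y ≠ 0 := fun hy => ne_zero_of_mem_coordCone hx' hy
  let c : Equiv.Perm (F.Indicatrix (chartPt p x')) → Equiv.Perm (F.Indicatrix (chartPt p x)) :=
    fun g => (h.translateEquiv.trans g).trans h.translateEquiv.symm
  have hrep : ∀ (g : Equiv.Perm (F.Indicatrix (chartPt p x'))) (χ : E → E),
      F.Represents p x' g χ → F.Represents p x (c g)
        (fun y => F.segTransport p x' x (χ (F.segTransport p x x' y))) := by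
    intro g χ hg
    refine ⟨fun z => ?_, fun y hy r hr => ?_⟩
    · change toChart p x (h.symm.translate (g (h.translate z))).1 = _
      rw [h.symm.toChart_translate, hg.apply, h.toChart_translate]
    · rw [h.segTransport_smul y hr, hg.homog _ (h.segTransport_mem hy) r hr,
        h.symm.segTransport_smul _ hr]
  -- Generators of the holonomy group come without a given coordinate expression; one is built from
  -- the homogeneous extension in order to see that the conjugate is smooth.
  have hsm : ∀ (g : Equiv.Perm (F.Indicatrix (chartPt p x'))),
      IsSmoothOnIndicatrix (fun z => (g z).1) → IsSmoothOnIndicatrix (fun z => (c g z).1) := by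
    intro g hg
    obtain ⟨χ, hχ, hχs⟩ := exists_represents hx' hg
    refine (hrep g χ hχ).isSmoothOnIndicatrix hx fun y hy => ?_
    have hy1 := h.segTransport_mem hy
    exact ContDiffAt.comp (g := F.segTransport p x' x)
      (f := fun y => χ (F.segTransport p x x' y)) y
      (h.symm.contDiffAt_segTransport (hne' (hχ.mapsTo hx' hy1)))
      (ContDiffAt.comp (f := F.segTransport p x x') y (hχs _ hy1)
        (h.contDiffAt_segTransport (hne hy)))
  -- The holonomy group is a closure, so the conjugation is checked on parallel translations, where
  -- the loop is preceded and followed by a segment, and then on products and inverses.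
  have hconj : ∀ g ∈ F.holonomyGroup (chartPt p x'),
      ∃ k ∈ F.holonomyGroup (chartPt p x), k.1 = c g.1 := by
    intro g hg
    induction hg using Subgroup.closure_induction with
    | mem g hg =>
      refine ⟨⟨c g.1, hsm _ g.2.1, hsm g.1.symm g.2.2⟩, Subgroup.subset_closure ?_, rfl⟩
      exact .trans _ _ _ (g.1 ∘ h.translate) h.symm.translate
        (.trans _ _ _ h.translate g.1 h.isParallelTranslation hg) h.symm.isParallelTranslation
    | one =>
      refine ⟨1, one_mem _, Equiv.ext fun z => ?_⟩
      exact (h.translate_translate z).symm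
    | mul g₁ g₂ _ _ h₁ h₂ =>
      obtain ⟨k₁, hk₁, e₁⟩ := h₁
      obtain ⟨k₂, hk₂, e₂⟩ := h₂
      refine ⟨k₁ * k₂, mul_mem hk₁ hk₂, Equiv.ext fun z => ?_⟩
      change k₁.1 (k₂.1 z) = h.symm.translate (g₁.1 (g₂.1 (h.translate z)))
      rw [e₁, e₂]
      change h.symm.translate (g₁.1 (h.translate (h.symm.translate
        (g₂.1 (h.translate z))))) = _
      rw [h.symm.translate_translate]
    | inv g _ h₁ =>
      obtain ⟨k, hk, e⟩ := h₁
      refine ⟨k⁻¹, inv_mem hk, ?_⟩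
      change k.1.symm = _
      rw [e]
      rfl
  obtain ⟨g, hg, h1, h2⟩ := hψ
  obtain ⟨k, hk, e⟩ := hconj g hg
  refine ⟨k, hk, ?_, ?_⟩
  · rw [e]
    exact hrep _ _ h1
  · have e' : (k⁻¹).1 = c (g⁻¹).1 := by
      change k.1.symm = _
      rw [e]
      rfl
    rw [e']
    exact hrep _ _ h2

/-- Parallel transport around a quadrilateral is a holonomy. -/
theorem isHolonomy_quadrilateral {x₁ x₂ x₃ : E} (h₁ : F.Linked p x x₁) (h₂ : F.Linked p x₁ x₂)
    (h₃ : F.Linked p x₂ x₃) (h₄ : F.Linked p x₃ x) :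
    F.IsHolonomy p x
      (fun y => F.segTransport p x₃ x (F.segTransport p x₂ x₃ (F.segTransport p x₁ x₂
        (F.segTransport p x x₁ y))))
      (fun y => F.segTransport p x₁ x (F.segTransport p x₂ x₁ (F.segTransport p x₃ x₂
        (F.segTransport p x x₃ y)))) := by
  -- Stated for arbitrary vertices, since the inverse is transport around the same quadrilateral in
  -- reverse.
  have key : ∀ {x₁ x₂ x₃ : E} (h₁ : F.Linked p x x₁) (h₂ : F.Linked p x₁ x₂)
      (h₃ : F.Linked p x₂ x₃) (h₄ : F.Linked p x₃ x),
      F.Represents p x (fun z => h₄.translate (h₃.translate (h₂.translate (h₁.translate z))))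
        (fun y => F.segTransport p x₃ x (F.segTransport p x₂ x₃ (F.segTransport p x₁ x₂
          (F.segTransport p x x₁ y)))) ∧
      ∀ y ∈ F.coordCone p x, ContDiffAt ℝ ∞ (fun y => F.segTransport p x₃ x
        (F.segTransport p x₂ x₃ (F.segTransport p x₁ x₂ (F.segTransport p x x₁ y)))) y := by
    intro x₁ x₂ x₃ h₁ h₂ h₃ h₄
    refine ⟨⟨fun z => ?_, fun y hy r hr => ?_⟩, fun y hy => ?_⟩
    · rw [h₄.toChart_translate, h₃.toChart_translate, h₂.toChart_translate,
        h₁.toChart_translate]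
    · rw [h₁.segTransport_smul _ hr, h₂.segTransport_smul _ hr, h₃.segTransport_smul _ hr,
        h₄.segTransport_smul _ hr]
    · have n0 := ne_zero_of_mem_coordCone h₁.mem_left hy
      have n1 := h₁.segTransport_ne_zero n0
      have n2 := h₂.segTransport_ne_zero n1
      have n3 := h₃.segTransport_ne_zero n2
      have c2 := ContDiffAt.comp (g := F.segTransport p x₁ x₂) (f := F.segTransport p x x₁) y
        (h₂.contDiffAt_segTransport n1) (h₁.contDiffAt_segTransport n0)
      have c3 := ContDiffAt.comp (g := F.segTransport p x₂ x₃) y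
        (h₃.contDiffAt_segTransport n2) c2
      exact ContDiffAt.comp (g := F.segTransport p x₃ x) y (h₄.contDiffAt_segTransport n3) c3
  have k1 := key h₁ h₂ h₃ h₄
  have k2 := key h₄.symm h₃.symm h₂.symm h₁.symm
  refine IsHolonomy.of_translation h₁.mem_left
    (((h₁.translateEquiv.trans h₂.translateEquiv).trans h₃.translateEquiv).trans
      h₄.translateEquiv) ?_ k1.1 k2.1 k1.2 k2.2
  exact .trans _ _ _ (h₃.translate ∘ h₂.translate ∘ h₁.translate) h₄.translate
    (.trans _ _ _ (h₂.translate ∘ h₁.translate) h₃.translate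
      (.trans _ _ _ h₁.translate h₂.translate h₁.isParallelTranslation h₂.isParallelTranslation)
      h₃.isParallelTranslation) h₄.isParallelTranslation

end FinslerFunction

/-! ### Hadamard's lemma for germs -/

theorem GermSmooth.exists_hadamard {Z F : Type u} [NormedAddCommGroup Z] [NormedSpace ℝ Z]
    [NormedAddCommGroup F] [NormedSpace ℝ F] [CompleteSpace F] {f : ℝ × Z → F} {z₀ : Z}
    (hf : GermSmooth f (0, z₀)) :
    ∃ g : ℝ × Z → F, ContDiff ℝ ∞ g ∧
      (∀ᶠ q in 𝓝 ((0, z₀) : ℝ × Z), f q = f (0, q.2) + q.1 • g q) ∧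
      ∀ᶠ z in 𝓝 z₀, g (0, z) = fderiv ℝ f (0, z) (1, 0) := by
  obtain ⟨f', hf', he⟩ := hf
  obtain ⟨g, hg, h1, h2⟩ := _root_.exists_hadamard hf'
  have t1 : Tendsto (fun q : ℝ × Z => ((0 : ℝ), q.2)) (𝓝 (0, z₀)) (𝓝 (0, z₀)) :=
    (by fun_prop : Continuous fun q : ℝ × Z => ((0 : ℝ), q.2)).tendsto (0, z₀)
  have t2 : Tendsto (fun z : Z => ((0 : ℝ), z)) (𝓝 z₀) (𝓝 (0, z₀)) :=
    (by fun_prop : Continuous fun z : Z => ((0 : ℝ), z)).tendsto z₀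
  refine ⟨g, hg, ?_, ?_⟩
  · filter_upwards [he, t1.eventually he] with q a b
    rw [a, b]
    exact h1 q.1 q.2
  · filter_upwards [t2.eventually he.eventuallyEq_nhds] with z a
    rw [h2, a.fderiv_eq]

namespace FinslerFunction

variable {E : Type u} [NormedAddCommGroup E] [NormedSpace ℝ E]
  {M : Type*} [TopologicalSpace M] [ChartedSpace E M] [IsManifold 𝓘(ℝ, E) ∞ M]
  {F : FinslerFunction E M} {p : M} {x₀ : E}

/-! ### Families of holonomies -/

/-- The maps `Φ(t, x, ·)` are the coordinate expressions of a smooth family of elements of the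
holonomy groups at the points near `x₀`, with inverses `Φ'(t, x, ·)`, and
`Φ(t, x, y) = y + t ^ k ξ(x, y) + O(t ^ (k + 1))`. -/
structure HolonomyFamily (F : FinslerFunction E M) (p : M) (x₀ : E) (k : ℕ) (ξ : E → E → E)
    (Φ Φ' : ℝ × E × E → E) : Prop where
  ne_zero : k ≠ 0
  isHolonomy : ∀ᶠ q in 𝓝 ((0, x₀) : ℝ × E),
    F.IsHolonomy p q.2 (fun y => Φ (q.1, q.2, y)) (fun y => Φ' (q.1, q.2, y))
  smooth : ∀ᶠ q in 𝓝 ((0, x₀) : ℝ × E), ∀ y ∈ F.coordCone p q.2,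
    GermSmooth Φ (q.1, q.2, y) ∧ GermSmooth Φ' (q.1, q.2, y)
  expansion : ∀ y ∈ F.coordCone p x₀, ∃ A : ℝ × E × E → E, ContDiff ℝ ∞ A ∧
    (∀ᶠ z in 𝓝 ((0, x₀, y) : ℝ × E × E), Φ z = z.2.2 + z.1 ^ k • A z) ∧
    ∀ᶠ w in 𝓝 ((x₀, y) : E × E), A (0, w) = ξ w.1 w.2

theorem tendsto_zero_prodMk {X : Type*} [TopologicalSpace X] (w : X) :
    Tendsto (fun w : X => ((0 : ℝ), w)) (𝓝 w) (𝓝 (0, w)) :=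
  (by fun_prop : Continuous fun w : X => ((0 : ℝ), w)).tendsto w

theorem eventually_mem_coordCone (hx₀ : x₀ ∈ chartDom p) {y : E} (hy : y ∈ F.coordCone p x₀) :
    ∀ᶠ w in 𝓝 ((x₀, y) : E × E), w.1 ∈ chartDom p ∧ w.2 ∈ F.coordCone p w.1 :=
  (isOpen_setOf_coordCone F p).mem_nhds ⟨hx₀, hy⟩

namespace HolonomyFamily

variable {k l : ℕ} {ξ η : E → E → E} {Φ Φ' Ψ Ψ' : ℝ × E × E → E}

theorem eventually_isHolonomy (h : F.HolonomyFamily p x₀ k ξ Φ Φ') (hx₀ : x₀ ∈ chartDom p)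
    {y : E} (hy : y ∈ F.coordCone p x₀) :
    ∀ᶠ z in 𝓝 ((0, x₀, y) : ℝ × E × E), z.2.1 ∈ chartDom p ∧ z.2.2 ∈ F.coordCone p z.2.1 ∧
      F.IsHolonomy p z.2.1 (fun y => Φ (z.1, z.2.1, y)) (fun y => Φ' (z.1, z.2.1, y)) := by
  have t1 : Tendsto (fun z : ℝ × E × E => (z.1, z.2.1)) (𝓝 (0, x₀, y)) (𝓝 (0, x₀)) :=
    (by fun_prop : Continuous fun z : ℝ × E × E => (z.1, z.2.1)).tendsto (0, x₀, y)
  have t2 : Tendsto (fun z : ℝ × E × E => z.2) (𝓝 (0, x₀, y)) (𝓝 (x₀, y)) :=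
    (by fun_prop : Continuous fun z : ℝ × E × E => z.2).tendsto (0, x₀, y)
  filter_upwards [t1.eventually h.isHolonomy, t2.eventually (eventually_mem_coordCone hx₀ hy)]
    with z h1 h2 using ⟨h2.1, h2.2, h1⟩

theorem germSmooth (h : F.HolonomyFamily p x₀ k ξ Φ Φ') {y : E}
    (hy : y ∈ F.coordCone p x₀) : GermSmooth Φ (0, x₀, y) ∧ GermSmooth Φ' (0, x₀, y) :=
  h.smooth.self_of_nhds y hy

theorem eventually_inv (h : F.HolonomyFamily p x₀ k ξ Φ Φ') (hx₀ : x₀ ∈ chartDom p)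
    {y : E} (hy : y ∈ F.coordCone p x₀) :
    ∀ᶠ z in 𝓝 ((0, x₀, y) : ℝ × E × E), Φ (z.1, z.2.1, Φ' z) = z.2.2 := by
  filter_upwards [h.eventually_isHolonomy hx₀ hy] with z hz
  exact hz.2.2.inv.left_inv hz.1 hz.2.1

theorem eventually_zero (h : F.HolonomyFamily p x₀ k ξ Φ Φ') (hx₀ : x₀ ∈ chartDom p)
    {y : E} (hy : y ∈ F.coordCone p x₀) :
    ∀ᶠ w in 𝓝 ((x₀, y) : E × E), Φ (0, w) = w.2 ∧ Φ' (0, w) = w.2 := by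
  obtain ⟨A, hA, h1, h2⟩ := h.expansion y hy
  have t := tendsto_zero_prodMk ((x₀, y) : E × E)
  filter_upwards [t.eventually h1, t.eventually (h.eventually_isHolonomy hx₀ hy)] with w a b
  have e : Φ (0, w) = w.2 := by
    rw [a]
    simp [zero_pow h.ne_zero]
  refine ⟨e, ?_⟩
  have := b.2.2.left_inv b.1 b.2.1
  change Φ' (0, w.1, Φ (0, w)) = w.2 at this
  rwa [e] at this

theorem tendsto_inv (h : F.HolonomyFamily p x₀ k ξ Φ Φ') (hx₀ : x₀ ∈ chartDom p)
    {y : E} (hy : y ∈ F.coordCone p x₀) :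
    Tendsto (fun z : ℝ × E × E => (z.1, z.2.1, Φ' z)) (𝓝 (0, x₀, y)) (𝓝 (0, x₀, y)) := by
  have h1 : ContinuousAt (fun z : ℝ × E × E => (z.1, z.2.1, Φ' z)) (0, x₀, y) :=
    continuousAt_fst.prodMk (ContinuousAt.prodMk (by fun_prop) (h.germSmooth hy).2.continuousAt)
  rwa [ContinuousAt, (h.eventually_zero hx₀ hy).self_of_nhds.2] at h1

theorem zero (F : FinslerFunction E M) (p : M) (x₀ : E) :
    F.HolonomyFamily p x₀ 1 0 (fun z => z.2.2) (fun z => z.2.2) where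
  ne_zero := one_ne_zero
  isHolonomy := Eventually.of_forall fun q => IsHolonomy.id F p q.2
  smooth := Eventually.of_forall fun q y _ => by
    have : GermSmooth (fun z : ℝ × E × E => z.2.2) (q.1, q.2, y) :=
      ContDiff.germSmooth (by fun_prop) _
    exact ⟨this, this⟩
  expansion := fun y _ => ⟨fun _ => 0, contDiff_const, by simp, by simp⟩

/-- Compositions of families of holonomies. -/
theorem isHolonomy_smooth_comp (hx₀ : x₀ ∈ chartDom p)
    (h1 : ∀ᶠ q in 𝓝 ((0, x₀) : ℝ × E), F.IsHolonomy p q.2 (fun y => Φ (q.1, q.2, y))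
      (fun y => Φ' (q.1, q.2, y)))
    (h2 : ∀ᶠ q in 𝓝 ((0, x₀) : ℝ × E), ∀ y ∈ F.coordCone p q.2,
      GermSmooth Φ (q.1, q.2, y) ∧ GermSmooth Φ' (q.1, q.2, y))
    (h3 : ∀ᶠ q in 𝓝 ((0, x₀) : ℝ × E), F.IsHolonomy p q.2 (fun y => Ψ (q.1, q.2, y))
      (fun y => Ψ' (q.1, q.2, y)))
    (h4 : ∀ᶠ q in 𝓝 ((0, x₀) : ℝ × E), ∀ y ∈ F.coordCone p q.2,
      GermSmooth Ψ (q.1, q.2, y) ∧ GermSmooth Ψ' (q.1, q.2, y)) :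
    (∀ᶠ q in 𝓝 ((0, x₀) : ℝ × E), F.IsHolonomy p q.2
      (fun y => Φ (q.1, q.2, Ψ (q.1, q.2, y))) (fun y => Ψ' (q.1, q.2, Φ' (q.1, q.2, y)))) ∧
    ∀ᶠ q in 𝓝 ((0, x₀) : ℝ × E), ∀ y ∈ F.coordCone p q.2,
      GermSmooth (fun z => Φ (z.1, z.2.1, Ψ z)) (q.1, q.2, y) ∧
      GermSmooth (fun z => Ψ' (z.1, z.2.1, Φ' z)) (q.1, q.2, y) := by
  have hd : ∀ᶠ q in 𝓝 ((0, x₀) : ℝ × E), q.2 ∈ chartDom p :=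
    continuousAt_snd.eventually ((isOpen_chartDom p).mem_nhds hx₀)
  have key : ∀ {Φ Ψ : ℝ × E × E → E} {q : ℝ × E} {y : E},
      GermSmooth Φ (q.1, q.2, Ψ (q.1, q.2, y)) → GermSmooth Ψ (q.1, q.2, y) →
      GermSmooth (fun z => Φ (z.1, z.2.1, Ψ z)) (q.1, q.2, y) := by
    intro Φ Ψ q y ha hb
    refine GermSmooth.comp (h := fun z : ℝ × E × E => (z.1, z.2.1, Ψ z)) ha ?_
    exact (ContDiff.germSmooth contDiff_fst _).prodMk
      ((ContDiff.germSmooth (f := fun z : ℝ × E × E => z.2.1) (by fun_prop) _).prodMk hb)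
  constructor
  · filter_upwards [hd, h1, h3] with q hq a b using a.comp b hq
  · filter_upwards [hd, h1, h2, h3, h4] with q hq a a' b b' y hy
    exact ⟨key (a' _ (b.mapsTo hq hy)).1 (b' y hy).1,
      key (b' _ (a.inv.mapsTo hq hy)).2 (a' y hy).2⟩

/-- Substituting y + t ^ k B into the coefficient A changes it only at positive order in t, so the
leading coefficients add. The two orders must agree. -/
theorem add (h : F.HolonomyFamily p x₀ k ξ Φ Φ') (h' : F.HolonomyFamily p x₀ k η Ψ Ψ')
    (hx₀ : x₀ ∈ chartDom p) :
    F.HolonomyFamily p x₀ k (fun x y => ξ x y + η x y) (fun z => Φ (z.1, z.2.1, Ψ z))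
      (fun z => Ψ' (z.1, z.2.1, Φ' z)) where
  ne_zero := h.ne_zero
  isHolonomy := (isHolonomy_smooth_comp hx₀ h.isHolonomy h.smooth h'.isHolonomy h'.smooth).1
  smooth := (isHolonomy_smooth_comp hx₀ h.isHolonomy h.smooth h'.isHolonomy h'.smooth).2
  expansion := fun y hy => by
    obtain ⟨A, hA, hA1, hA2⟩ := h.expansion y hy
    obtain ⟨B, hB, hB1, hB2⟩ := h'.expansion y hy
    have hk := h.ne_zero
    have t : Tendsto (fun z : ℝ × E × E => (z.1, z.2.1, z.2.2 + z.1 ^ k • B z))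
        (𝓝 (0, x₀, y)) (𝓝 (0, x₀, y)) := by
      have := (by fun_prop : Continuous fun z : ℝ × E × E =>
        (z.1, z.2.1, z.2.2 + z.1 ^ k • B z)).tendsto (0, x₀, y)
      simpa [zero_pow hk] using this
    refine ⟨fun z => B z + A (z.1, z.2.1, z.2.2 + z.1 ^ k • B z), by fun_prop, ?_, ?_⟩
    · filter_upwards [hB1, t.eventually hA1] with z b a
      rw [b, a, smul_add, add_assoc]
    · filter_upwards [hA2, hB2] with w a b
      simp only [zero_pow hk, zero_smul, add_zero]
      rw [b, a, add_comm]

/-- Reparametrization: the family `Φ_{t + (r / k) t ^ 2} ∘ Φ_t⁻¹`. -/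
theorem smul_succ [FiniteDimensional ℝ E] (h : F.HolonomyFamily p x₀ k ξ Φ Φ')
    (hx₀ : x₀ ∈ chartDom p) (r : ℝ) :
    F.HolonomyFamily p x₀ (k + 1) (fun x y => r • ξ x y)
      (fun z => Φ (z.1 + r / k * z.1 ^ 2, z.2.1, Φ' z))
      (fun z => Φ (z.1, z.2.1, Φ' (z.1 + r / k * z.1 ^ 2, z.2.1, z.2.2))) := by
  set c : ℝ := r / k with hc
  have t : Tendsto (fun q : ℝ × E => (q.1 + c * q.1 ^ 2, q.2)) (𝓝 (0, x₀)) (𝓝 (0, x₀)) := by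
    have := (by fun_prop : Continuous fun q : ℝ × E => (q.1 + c * q.1 ^ 2, q.2)).tendsto (0, x₀)
    simpa using this
  have h1 := t.eventually h.isHolonomy
  have h2 : ∀ᶠ q in 𝓝 ((0, x₀) : ℝ × E), ∀ y ∈ F.coordCone p q.2,
      GermSmooth (fun z : ℝ × E × E => Φ (z.1 + c * z.1 ^ 2, z.2.1, z.2.2)) (q.1, q.2, y) ∧
      GermSmooth (fun z : ℝ × E × E => Φ' (z.1 + c * z.1 ^ 2, z.2.1, z.2.2)) (q.1, q.2, y) := by
    filter_upwards [t.eventually h.smooth] with q hq y hy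
    have hs : GermSmooth (fun z : ℝ × E × E => (z.1 + c * z.1 ^ 2, z.2.1, z.2.2))
      (q.1, q.2, y) := ContDiff.germSmooth (by fun_prop) _
    exact ⟨GermSmooth.comp (h := fun z : ℝ × E × E => (z.1 + c * z.1 ^ 2, z.2.1, z.2.2))
      (hq y hy).1 hs, GermSmooth.comp
        (h := fun z : ℝ × E × E => (z.1 + c * z.1 ^ 2, z.2.1, z.2.2)) (hq y hy).2 hs⟩
  have h3 := h.isHolonomy.mono fun q hq => hq.inv
  have h4 := h.smooth.mono fun q hq y hy => (hq y hy).symm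
  have h5 := isHolonomy_smooth_comp
    (Φ := fun z : ℝ × E × E => Φ (z.1 + c * z.1 ^ 2, z.2.1, z.2.2))
    (Φ' := fun z : ℝ × E × E => Φ' (z.1 + c * z.1 ^ 2, z.2.1, z.2.2)) hx₀ h1 h2 h3 h4
  refine ⟨k.succ_ne_zero, h5.1, h5.2, fun y hy => ?_⟩
  obtain ⟨A, hA, hA1, hA2⟩ := h.expansion y hy
  obtain ⟨P, hP, hP1⟩ := (h.germSmooth hy).2
  have hk := h.ne_zero
  -- With c = r/k, (t + c t ^ 2) ^ k = t ^ k (1 + c t) ^ k, so Φ_{t + c t ^ 2}(w) - Φ_t(w) is t ^ k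
  -- times f at s = t. The variable s is kept apart from t: f vanishes at s = 0, Hadamard's lemma
  -- extracts one further factor t, and the quotient at t = 0 is k c A = r A.
  let f : ℝ × (ℝ × E × E) → E := fun q =>
    (1 + c * q.1) ^ k • A (q.2.1 + c * q.1 * q.2.1, q.2.2) - A q.2
  have hf : ContDiff ℝ ∞ f := by simp only [f]; fun_prop
  obtain ⟨g, hg, hg1, hg2⟩ := exists_hadamard hf
  have hf0 : ∀ w, f (0, w) = 0 := fun w => by simp [f]
  have hg0 : ∀ w, g (0, (0, w)) = r • A (0, w) := by
    intro w
    rw [hg2]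
    have hd := hasDerivAt_prodMk_left (hf.differentiable (by simp) (0, (0, w)))
    refine hd.unique ?_
    have e : (fun s : ℝ => f (s, (0, w))) = fun s => (1 + c * s) ^ k • A (0, w) - A (0, w) := by
      funext s
      simp [f]
    have hl : HasDerivAt (fun s : ℝ => (1 + c * s) ^ k) r 0 := by
      have h6 : HasDerivAt (fun s : ℝ => (1 + c * s) ^ k)
          (k * (1 + c * 0) ^ (k - 1) * (c * 1)) 0 :=
        (((hasDerivAt_id (0 : ℝ)).const_mul c).const_add 1).pow k
      have hk' : (k : ℝ) ≠ 0 := Nat.cast_ne_zero.2 hk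
      refine h6.congr_deriv ?_
      rw [mul_zero, add_zero, one_pow, mul_one, mul_one, hc, mul_div_cancel₀ _ hk']
    rw [e]
    exact (hl.smul_const _).sub_const _
  have t' := h.tendsto_inv hx₀ hy
  have t'' : Tendsto (fun z : ℝ × E × E => (z.1 + c * z.1 ^ 2, z.2.1, Φ' z)) (𝓝 (0, x₀, y))
      (𝓝 (0, x₀, y)) := by
    have := (by fun_prop : Continuous fun z : ℝ × E × E =>
      (z.1 + c * z.1 ^ 2, z.2)).tendsto (0, x₀, y)
    simp only [ne_eq, OfNat.ofNat_ne_zero, not_false_eq_true, zero_pow, mul_zero,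
      add_zero] at this
    exact this.comp t'
  refine ⟨fun z => g (z.1, (z.1, z.2.1, P z)), by fun_prop, ?_, ?_⟩
  · filter_upwards [h.eventually_inv hx₀ hy, t'.eventually hA1, t''.eventually hA1, hP1]
      with z a1 a2 a3 a4
    rw [a3, ← a4]
    rw [a1] at a2
    have e := hg1 z.1 (z.1, z.2.1, Φ' z)
    rw [hf0, zero_add] at e
    rw [pow_succ z.1 k, mul_smul (z.1 ^ k), ← e]
    simp only [f]
    have e2 : z.1 + c * z.1 * z.1 = z.1 + c * z.1 ^ 2 := by ring
    have e3 : (z.1 + c * z.1 ^ 2) ^ k = z.1 ^ k * (1 + c * z.1) ^ k := by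
      rw [← mul_pow]; ring
    rw [e2, smul_sub, smul_smul, ← e3]
    rw [a2]
    abel
  · filter_upwards [hA2, h.eventually_zero hx₀ hy,
      (tendsto_zero_prodMk ((x₀, y) : E × E)).eventually hP1] with w a1 a2 a3
    rw [hg0, ← a3, a2.2, a1]

/-- A family of holonomies is determined to first order by its values on the indicatrix. -/
theorem congr (h : F.HolonomyFamily p x₀ k ξ Φ Φ') (hx₀ : x₀ ∈ chartDom p)
    (hη : ∀ x ∈ chartDom p, ∀ y ∈ F.coordCone p x, ∀ r : ℝ, 0 < r → η x (r • y) = r • η x y)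
    (he : ∀ y, F.coordFun p x₀ y = 1 → ∀ᶠ w in 𝓝 ((x₀, y) : E × E),
      F.coordFun p w.1 w.2 = 1 → ξ w.1 w.2 = η w.1 w.2) :
    F.HolonomyFamily p x₀ k η Φ Φ' := by
  refine ⟨h.ne_zero, h.isHolonomy, h.smooth, fun y hy => ?_⟩
  obtain ⟨A, hA, hA1, hA2⟩ := h.expansion y hy
  refine ⟨A, hA, hA1, ?_⟩
  have hr₀ : 0 < F.coordFun p x₀ y := hy
  set r₀ := F.coordFun p x₀ y with hr₀d
  have hy₁1 : F.coordFun p x₀ (r₀⁻¹ • y) = 1 := by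
    rw [(F.isLocalFinsler p).homog x₀ hx₀ y _ (inv_pos.2 hr₀), inv_mul_cancel₀ hr₀.ne']
  have hy₁ : r₀⁻¹ • y ∈ F.coordCone p x₀ := smul_mem_coordCone hx₀ hy (inv_pos.2 hr₀)
  obtain ⟨B, hB, hB1, hB2⟩ := h.expansion _ hy₁
  have hcont : ContinuousAt (fun w : E × E => (w.1, (F.coordFun p w.1 w.2)⁻¹ • w.2)) (x₀, y) :=
    continuousAt_fst.prodMk
      (((F.contDiffAt_coordFun hx₀ (ne_zero_of_mem_coordCone hx₀ hy)).continuousAt.inv₀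
        hr₀.ne').smul continuousAt_snd)
  filter_upwards [eventually_mem_coordCone hx₀ hy,
    (tendsto_zero_prodMk ((x₀, y) : E × E)).eventually hA1.eventually_nhds,
    hcont.eventually (he _ hy₁1), hcont.eventually hB2,
    hcont.eventually ((tendsto_zero_prodMk ((x₀, r₀⁻¹ • y) : E × E)).eventually
      hB1.eventually_nhds),
    (tendsto_zero_prodMk ((x₀, y) : E × E)).eventually
      (h.eventually_isHolonomy hx₀ hy).eventually_nhds] with w w1 w2 w3 w4 w5 w6
  obtain ⟨x, y'⟩ := w
  simp only at w1 w2 w3 w4 w5 w6 ⊢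
  have hr : 0 < F.coordFun p x y' := w1.2
  set r := F.coordFun p x y' with hrd
  have e1 : F.coordFun p x (r⁻¹ • y') = 1 := by
    rw [(F.isLocalFinsler p).homog x w1.1 y' _ (inv_pos.2 hr), inv_mul_cancel₀ hr.ne']
  have e2 := hη x w1.1 y' w1.2 r⁻¹ (inv_pos.2 hr)
  rw [w3 e1, e2] at w4
  -- Holonomies are homogeneous in y, so for t ≠ 0 the factor t ^ k can be cancelled; letting t tend
  -- to 0 shows that the leading coefficient is homogeneous too. Agreement on the indicatrix then
  -- suffices.
  have key : A (0, x, y') = r • B (0, x, r⁻¹ • y') := by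
    have c1 : Tendsto (fun t : ℝ => A (t, x, y')) (𝓝[≠] 0) (𝓝 (A (0, x, y'))) :=
      ((by fun_prop : Continuous fun t : ℝ => A (t, x, y')).tendsto 0).mono_left
        nhdsWithin_le_nhds
    have c2 : Tendsto (fun t : ℝ => r • B (t, x, r⁻¹ • y')) (𝓝[≠] 0)
        (𝓝 (r • B (0, x, r⁻¹ • y'))) :=
      ((by fun_prop : Continuous fun t : ℝ => r • B (t, x, r⁻¹ • y')).tendsto 0).mono_left
        nhdsWithin_le_nhds
    have s1 : ∀ v : E × E, Tendsto (fun t : ℝ => (t, v)) (𝓝[≠] 0) (𝓝 (0, v)) := fun v =>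
      ((by fun_prop : Continuous fun t : ℝ => (t, v)).tendsto 0).mono_left nhdsWithin_le_nhds
    refine tendsto_nhds_unique (c1.congr' ?_) c2
    filter_upwards [(s1 _).eventually w2, (s1 _).eventually w5, (s1 _).eventually w6,
      self_mem_nhdsWithin] with t a1 a2 a3 ht
    have a4 := a3.2.2.homog a3.2.1 (inv_pos.2 hr)
    change Φ (t, x, r⁻¹ • y') = r⁻¹ • Φ (t, x, y') at a4
    rw [a1, a2, smul_add, add_right_inj] at a4
    have htk : t ^ k ≠ 0 := pow_ne_zero _ ht
    rw [smul_comm] at a4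
    have a5 := smul_right_injective E htk a4
    rw [a5, smul_smul, mul_inv_cancel₀ hr.ne', one_smul]
  rw [key, w4, smul_smul, mul_inv_cancel₀ hr.ne', one_smul]

end HolonomyFamily

end FinslerFunction

/-! ### Commutators of families of holonomies -/

namespace FinslerFunction

variable {E : Type u} [NormedAddCommGroup E] [NormedSpace ℝ E]
  {M : Type*} [TopologicalSpace M] [ChartedSpace E M] [IsManifold 𝓘(ℝ, E) ∞ M]
  {F : FinslerFunction E M} {p : M} {x₀ : E}

namespace HolonomyFamily

variable {k l : ℕ} {ξ η : E → E → E} {Φ Φ' Ψ Ψ' : ℝ × E × E → E}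

theorem germSmooth_field (h : F.HolonomyFamily p x₀ k ξ Φ Φ') {y : E}
    (hy : y ∈ F.coordCone p x₀) : GermSmooth (fun w : E × E => ξ w.1 w.2) (x₀, y) := by
  obtain ⟨A, hA, -, hA2⟩ := h.expansion y hy
  exact (ContDiff.germSmooth (f := fun w : E × E => A (0, w)) (by fun_prop) _).congr
    (hA2.mono fun w hw => hw.symm)

/-- Commutators of families of holonomies. -/
theorem commutator [FiniteDimensional ℝ E] (h : F.HolonomyFamily p x₀ k ξ Φ Φ')
    (h' : F.HolonomyFamily p x₀ l η Ψ Ψ') (hx₀ : x₀ ∈ chartDom p) :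
    F.HolonomyFamily p x₀ (k + l) (fun x y => VectorField.lieBracket ℝ (η x) (ξ x) y)
      (fun z => Ψ' (z.1, z.2.1, Φ (z.1, z.2.1, Ψ (z.1, z.2.1, Φ' z))))
      (fun z => Φ (z.1, z.2.1, Ψ' (z.1, z.2.1, Φ' (z.1, z.2.1, Ψ z)))) := by
  have hi := h.isHolonomy.mono fun q hq => hq.inv
  have hs := h.smooth.mono fun q hq y hy => (hq y hy).symm
  have hi' := h'.isHolonomy.mono fun q hq => hq.inv
  have hs' := h'.smooth.mono fun q hq y hy => (hq y hy).symm
  have c1 := isHolonomy_smooth_comp hx₀ h'.isHolonomy h'.smooth hi hs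
  have c2 := isHolonomy_smooth_comp (Ψ := fun z => Ψ (z.1, z.2.1, Φ' z))
    (Ψ' := fun z => Φ (z.1, z.2.1, Ψ' z)) hx₀ h.isHolonomy h.smooth c1.1 c1.2
  have c3 := isHolonomy_smooth_comp (Ψ := fun z => Φ (z.1, z.2.1, Ψ (z.1, z.2.1, Φ' z)))
    (Ψ' := fun z => Φ (z.1, z.2.1, Ψ' (z.1, z.2.1, Φ' z))) hx₀ hi' hs' c2.1 c2.2
  refine ⟨fun e => h.ne_zero (by omega), c3.1, c3.2, fun y hy => ?_⟩
  obtain ⟨A, hA, hA1, hA2⟩ := h.expansion y hy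
  obtain ⟨B, hB, hB1, hB2⟩ := h'.expansion y hy
  have hbase : ∀ {X X' : ℝ × E × E → E}, GermSmooth X' (0, x₀, y) →
      GermSmooth (fun q : ℝ × E × E => (q.2.1, X' q)) (0, x₀, y) := fun hX' =>
    (ContDiff.germSmooth (f := fun z : ℝ × E × E => z.2.1) (by fun_prop) _).prodMk hX'
  -- The base point is carried along as a fixed coordinate. The fields have no base component, so
  -- their bracket involves fibre derivatives only.
  obtain ⟨C, hC, hC1, hC2⟩ := exists_commutator (Z := E × E) (z₀ := (x₀, y))
    (Φ := fun q => (q.2.1, Φ q)) (Φ' := fun q => (q.2.1, Φ' q))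
    (Ψ := fun q => (q.2.1, Ψ q)) (Ψ' := fun q => (q.2.1, Ψ' q))
    (A := fun q => (0, A q)) (B := fun q => (0, B q)) h.ne_zero h'.ne_zero
    (by fun_prop) (by fun_prop)
    (hA1.mono fun q hq => by ext <;> simp [hq])
    (hB1.mono fun q hq => by ext <;> simp [hq])
    (hbase (X := Φ) (h.germSmooth hy).2) (hbase (X := Ψ) (h'.germSmooth hy).2)
    ((h.eventually_inv hx₀ hy).mono fun q hq => by ext <;> simp [hq])
    (((h'.eventually_isHolonomy hx₀ hy)).mono fun q hq => by
      have := hq.2.2.left_inv hq.1 hq.2.1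
      ext <;> simp [this])
    ((h.eventually_zero hx₀ hy).mono fun w hw => by ext <;> simp [hw.2])
  refine ⟨fun q => (C q).2, by fun_prop, ?_, ?_⟩
  · filter_upwards [hC1] with z hz using congrArg Prod.snd hz
  · filter_upwards [hC2, hA2.eventually_nhds, hB2.eventually_nhds] with w a1 a2 a3
    obtain ⟨x, y'⟩ := w
    have hA' : DifferentiableAt ℝ (fun w : E × E => A (0, w)) (x, y') :=
      (by fun_prop : ContDiff ℝ ∞ fun w : E × E => A (0, w)).differentiable (by simp) _
    have hB' : DifferentiableAt ℝ (fun w : E × E => B (0, w)) (x, y') :=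
      (by fun_prop : ContDiff ℝ ∞ fun w : E × E => B (0, w)).differentiable (by simp) _
    have a4 : fderiv ℝ (fun w : E × E => A (0, w)) (x, y')
        = fderiv ℝ (fun w : E × E => ξ w.1 w.2) (x, y') := EventuallyEq.fderiv_eq a2
    have a5 : fderiv ℝ (fun w : E × E => B (0, w)) (x, y')
        = fderiv ℝ (fun w : E × E => η w.1 w.2) (x, y') := EventuallyEq.fderiv_eq a3
    have dξ := (hA'.congr_of_eventuallyEq (f₁ := fun w : E × E => ξ w.1 w.2)
      (a2.mono fun _ hw => hw.symm))
    have dη := (hB'.congr_of_eventuallyEq (f₁ := fun w : E × E => η w.1 w.2)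
      (a3.mono fun _ hw => hw.symm))
    have s1 : fderiv ℝ (ξ x) y' = _ := (hasFDerivAt_slice_right dξ).fderiv
    have s2 : fderiv ℝ (η x) y' = _ := (hasFDerivAt_slice_right dη).fderiv
    have e1 : A (0, x, y') = ξ x y' := a2.self_of_nhds
    have e2 : B (0, x, y') = η x y' := a3.self_of_nhds
    have f1 : fderiv ℝ (fun w : E × E => ((0 : E), A (0, w))) (x, y') = _ :=
      ((hasFDerivAt_const (0 : E) (x, y')).prodMk hA'.hasFDerivAt).fderiv
    have f2 : fderiv ℝ (fun w : E × E => ((0 : E), B (0, w))) (x, y') = _ :=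
      ((hasFDerivAt_const (0 : E) (x, y')).prodMk hB'.hasFDerivAt).fderiv
    rw [a1, VectorField.lieBracket, VectorField.lieBracket, s1, s2, f1, f2, a4, a5, e1, e2]
    simp

end HolonomyFamily

variable [FiniteDimensional ℝ E]

/-! ### Horizontal lifts -/

theorem germSmooth_segTransport {W : Type*} [NormedAddCommGroup W] [NormedSpace ℝ W]
    {a b c : W → E} {w : W} (h : F.Linked p (a w) (b w)) (h0 : c w ≠ 0) (ha : GermSmooth a w)
    (hb : GermSmooth b w) (hc : GermSmooth c w) :
    GermSmooth (fun w => F.segTransport p (a w) (b w) (c w)) w := by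
  refine GermSmooth.comp (f := transport (F.coordFun p))
    (h := fun w => ((a w, b w - a w), c w)) (h.1.2 _ h0).2 ?_
  exact (ha.prodMk ((ContDiff.germSmooth (f := fun q : E × E => q.1 - q.2)
    (by fun_prop) _).comp (h := fun w => (b w, a w)) (hb.prodMk ha))).prodMk hc

/-- First order expansion of parallel transport. -/
theorem exists_segTransport_expansion {Z : Type u} [NormedAddCommGroup Z] [NormedSpace ℝ Z]
    {a u c : Z → E} (ha : ContDiff ℝ ∞ a) (hu : ContDiff ℝ ∞ u) (hc : ContDiff ℝ ∞ c)
    {z₀ : Z} (h1 : a z₀ ∈ chartDom p) (h2 : c z₀ ≠ 0) :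
    ∃ b : ℝ × Z → E, ContDiff ℝ ∞ b ∧
      (∀ᶠ q in 𝓝 ((0, z₀) : ℝ × Z), F.segTransport p (a q.2) (a q.2 + q.1 • u q.2) (c q.2)
        = c q.2 + q.1 ^ 1 • b q) ∧
      ∀ᶠ z in 𝓝 z₀, b (0, z) = -connCoeff (F.coordFun p) (a z) (c z) (u z) := by
  have hd : ∀ᶠ z in 𝓝 z₀, a z ∈ chartDom p ∧ c z ≠ 0 :=
    (ha.continuous.continuousAt.eventually ((isOpen_chartDom p).mem_nhds h1)).and
      (hc.continuous.continuousAt.eventually (isOpen_compl_singleton.mem_nhds h2))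
  let T : ℝ × Z → E := fun q => F.segTransport p (a q.2) (a q.2 + q.1 • u q.2) (c q.2)
  have key : ∀ z, a z ∈ chartDom p → c z ≠ 0 → GermSmooth T (0, z) := fun z hz1 hz2 =>
    germSmooth_segTransport (by simpa using (eventually_linked F p hz1).self_of_nhds) hz2
      (ContDiff.germSmooth (by fun_prop) _) (ContDiff.germSmooth (by fun_prop) _)
      (ContDiff.germSmooth (by fun_prop) _)
  obtain ⟨b, hb, hb1, hb2⟩ := (key z₀ h1 h2).exists_hadamard
  have hT0 : ∀ z, a z ∈ chartDom p → c z ≠ 0 → T (0, z) = c z := fun z hz1 hz2 => by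
    have := (F.isLocalFinsler p).transport_zero hz1 hz2
    simpa [T, segTransport] using this
  refine ⟨b, hb, ?_, ?_⟩
  · filter_upwards [hb1, continuousAt_snd.eventually hd] with q q1 q2
    change T q = _
    rw [q1, hT0 _ q2.1 q2.2, pow_one]
  · filter_upwards [hb2, hd] with z q1 q2
    rw [q1, ← (F.isLocalFinsler p).fderiv_transport (x := a z) (y := c z) q2]
    have d1 := hasDerivAt_prodMk_left (key z q2.1 q2.2).contDiffAt.differentiableAt_infty
    have hl := (eventually_linked F p q2.1).self_of_nhds
    have d2 : DifferentiableAt ℝ (transport (F.coordFun p)) ((a z, 0), c z) := by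
      have := (hl.1.2 _ q2.2).2.contDiffAt.differentiableAt_infty
      simpa using this
    have d3 : HasDerivAt (fun t : ℝ => ((a z, t • u z), c z)) ((0, u z), 0) 0 := by
      have h3 := (hasDerivAt_id (0 : ℝ)).smul_const (u z)
      rw [one_smul] at h3
      exact ((hasDerivAt_const _ _).prodMk h3).prodMk (hasDerivAt_const _ _)
    have d4 := HasFDerivAt.comp_hasDerivAt (f := fun t : ℝ => ((a z, t • u z), c z)) (0 : ℝ)
      (l := transport (F.coordFun p)) (by simpa using d2.hasFDerivAt) d3
    refine d1.unique (d4.congr_of_eventuallyEq (Eventually.of_forall fun t => ?_))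
    simp [T, segTransport]

end FinslerFunction

/-! ### Horizontal flows with the displacement kept as a parameter -/

namespace FinslerFunction

variable {E : Type u} [NormedAddCommGroup E] [NormedSpace ℝ E]
  {M : Type*} [TopologicalSpace M] [ChartedSpace E M] [IsManifold 𝓘(ℝ, E) ∞ M]
  {F : FinslerFunction E M} {p : M} {x₀ : E}
  {U : Type u} [NormedAddCommGroup U] [NormedSpace ℝ U]

/-- Parallel transport along the segment from `x` to `x + t u(w)`, with parameter `w`. -/
def horizontalFlow (F : FinslerFunction E M) (p : M) (u : U → E) (q : ℝ × E × U × E) :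
    E × U × E :=
  (q.2.1 + q.1 • u q.2.2.1, q.2.2.1,
    F.segTransport p q.2.1 (q.2.1 + q.1 • u q.2.2.1) q.2.2.2)

theorem lieBracket_snd_snd {V W : E × U × E → E × U × E} {z : E × U × E}
    (hV : DifferentiableAt ℝ V z) (hW : DifferentiableAt ℝ W z) :
    (VectorField.lieBracket ℝ V W z).2.2
      = fderiv ℝ (fun z => (W z).2.2) z (V z) - fderiv ℝ (fun z => (V z).2.2) z (W z) := by
  have h1 : fderiv ℝ (fun z => (W z).2.2) z = _ := hW.hasFDerivAt.snd.snd.fderiv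
  have h2 : fderiv ℝ (fun z => (V z).2.2) z = _ := hV.hasFDerivAt.snd.snd.fderiv
  rw [h1, h2]
  rfl

theorem fderiv_comp_fst_snd_snd {G : Type*} [NormedAddCommGroup G] [NormedSpace ℝ G]
    {ξ : E × E → G} {x y a b : E} {w : U} (h : DifferentiableAt ℝ ξ (x, y)) :
    fderiv ℝ (fun z : E × U × E => ξ (z.1, z.2.2)) (x, w, y) (a, 0, b)
      = fderiv ℝ ξ (x, y) (a, b) := by
  let L : E × U × E →L[ℝ] E × E :=
    (ContinuousLinearMap.fst ℝ E (U × E)).prod ((ContinuousLinearMap.snd ℝ U E).comp (.snd ℝ E _))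
  have h1 : HasFDerivAt (fun z : E × U × E => (z.1, z.2.2)) L (x, w, y) := L.hasFDerivAt
  have h2 := HasFDerivAt.comp (f := fun z : E × U × E => (z.1, z.2.2)) (x, w, y)
    h.hasFDerivAt h1
  have h3 : fderiv ℝ (fun z : E × U × E => ξ (z.1, z.2.2)) (x, w, y) = _ := h2.fderiv
  rw [h3]
  rfl

theorem fderiv_apply_comp_fst_snd_snd {N : E × E → E →L[ℝ] E} {u : U → E} {x y a b : E} {w : U}
    (hN : DifferentiableAt ℝ N (x, y)) (hu : DifferentiableAt ℝ u w) :
    fderiv ℝ (fun z : E × U × E => -N (z.1, z.2.2) (u z.2.1)) (x, w, y) (a, 0, b)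
      = -fderiv ℝ N (x, y) (a, b) (u w) := by
  let L : E × U × E →L[ℝ] E × E :=
    (ContinuousLinearMap.fst ℝ E (U × E)).prod ((ContinuousLinearMap.snd ℝ U E).comp (.snd ℝ E _))
  have h1 : HasFDerivAt (fun z : E × U × E => (z.1, z.2.2)) L (x, w, y) := L.hasFDerivAt
  have h2 : HasFDerivAt (fun z : E × U × E => N (z.1, z.2.2)) _ (x, w, y) :=
    HasFDerivAt.comp (f := fun z : E × U × E => (z.1, z.2.2)) (x, w, y) hN.hasFDerivAt h1
  have h4 : HasFDerivAt (fun z : E × U × E => z.2.1)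
      ((ContinuousLinearMap.fst ℝ U E).comp (.snd ℝ E _)) (x, w, y) :=
    ((ContinuousLinearMap.fst ℝ U E).comp (.snd ℝ E _)).hasFDerivAt
  have h5 : HasFDerivAt (fun z : E × U × E => u z.2.1) _ (x, w, y) :=
    HasFDerivAt.comp (f := fun z : E × U × E => z.2.1) (x, w, y) hu.hasFDerivAt h4
  have h3 : fderiv ℝ (fun z : E × U × E => -N (z.1, z.2.2) (u z.2.1)) (x, w, y) = _ :=
    (h2.clm_apply h5).neg.fderiv
  rw [h3]
  simp [L]

variable [FiniteDimensional ℝ E]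

section HorizontalFlow

variable {u : U → E} {w₀ : U} {y : E}

theorem eventually_linked_flow (hu : ContDiff ℝ ∞ u) (hx₀ : x₀ ∈ chartDom p) (hy : y ≠ 0) :
    ∀ᶠ q in 𝓝 ((0, x₀, w₀, y) : ℝ × E × U × E),
      F.Linked p q.2.1 (q.2.1 + q.1 • u q.2.2.1) ∧ q.2.2.2 ≠ 0 := by
  have t : Tendsto (fun q : ℝ × E × U × E => (q.2.1, q.2.1 + q.1 • u q.2.2.1))
      (𝓝 (0, x₀, w₀, y)) (𝓝 (x₀, x₀)) := by
    have := (by fun_prop : Continuous fun q : ℝ × E × U × E =>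
      (q.2.1, q.2.1 + q.1 • u q.2.2.1)).tendsto (0, x₀, w₀, y)
    simpa using this
  have c : ContinuousAt (fun q : ℝ × E × U × E => q.2.2.2) (0, x₀, w₀, y) := by fun_prop
  exact (t.eventually (eventually_linked F p hx₀)).and
    (c.eventually (isOpen_compl_singleton.mem_nhds hy))

theorem germSmooth_horizontalFlow (hu : ContDiff ℝ ∞ u) (hx₀ : x₀ ∈ chartDom p) (hy : y ≠ 0) :
    GermSmooth (F.horizontalFlow p u) (0, x₀, w₀, y) := by
  refine GermSmooth.prodMk (ContDiff.germSmooth (by fun_prop) _)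
    (GermSmooth.prodMk (ContDiff.germSmooth (by fun_prop) _) ?_)
  exact germSmooth_segTransport
    (eventually_linked_flow (w₀ := w₀) hu hx₀ hy).self_of_nhds.1 hy
    (ContDiff.germSmooth (by fun_prop) _) (ContDiff.germSmooth (by fun_prop) _)
    (ContDiff.germSmooth (by fun_prop) _)

/-- The parameter w is unchanged by the flow, so the way back uses exactly the opposite displacement
and retraces the same segment. With a variable field X the displacement at the endpoint would
differ. -/
theorem horizontalFlow_neg (hu : ContDiff ℝ ∞ u) (hx₀ : x₀ ∈ chartDom p) (hy : y ≠ 0) :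
    ∀ᶠ q in 𝓝 ((0, x₀, w₀, y) : ℝ × E × U × E),
      F.horizontalFlow p (fun w => -u w) (q.1, F.horizontalFlow p u q) = q.2 := by
  filter_upwards [eventually_linked_flow (F := F) hu hx₀ hy] with q hq
  simp only [horizontalFlow, smul_neg, add_neg_cancel_right]
  rw [hq.1.segTransport_inv hq.2]

theorem horizontalFlow_zero (hx₀ : x₀ ∈ chartDom p) (hy : y ≠ 0) :
    ∀ᶠ z in 𝓝 ((x₀, w₀, y) : E × U × E), F.horizontalFlow p u (0, z) = z := by
  have c1 : ContinuousAt (fun q : E × U × E => q.1) (x₀, w₀, y) := by fun_prop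
  have c2 : ContinuousAt (fun q : E × U × E => q.2.2) (x₀, w₀, y) := by fun_prop
  filter_upwards [c1.eventually ((isOpen_chartDom p).mem_nhds hx₀),
    c2.eventually (isOpen_compl_singleton.mem_nhds hy)] with z h1 h2
  have := (F.isLocalFinsler p).transport_zero h1 h2
  simp [horizontalFlow, segTransport, this]

theorem exists_horizontalFlow_expansion (hu : ContDiff ℝ ∞ u) (hx₀ : x₀ ∈ chartDom p)
    (hy : y ≠ 0) :
    ∃ B : ℝ × E × U × E → E × U × E, ContDiff ℝ ∞ B ∧
      (∀ᶠ q in 𝓝 ((0, x₀, w₀, y) : ℝ × E × U × E),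
        F.horizontalFlow p u q = q.2 + q.1 ^ 1 • B q) ∧
      ∀ᶠ z in 𝓝 ((x₀, w₀, y) : E × U × E), B (0, z)
        = (u z.2.1, 0, -connCoeff (F.coordFun p) z.1 z.2.2 (u z.2.1)) := by
  obtain ⟨b, hb, hb1, hb2⟩ := exists_segTransport_expansion (F := F) (p := p)
    (Z := E × U × E) (a := fun z => z.1) (u := fun z => u z.2.1) (c := fun z => z.2.2)
    (by fun_prop) (by fun_prop) (by fun_prop) (z₀ := (x₀, w₀, y)) hx₀ hy
  refine ⟨fun q => (u q.2.2.1, 0, b q), by fun_prop, ?_, ?_⟩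
  · filter_upwards [hb1] with q hq
    refine Prod.ext ?_ (Prod.ext ?_ ?_)
    · simp [horizontalFlow]
    · simp [horizontalFlow]
    · exact hq
  · filter_upwards [hb2] with z hz
    rw [hz]

end HorizontalFlow

/-! ### Berwald derivatives and curvature as leading fields -/

namespace HolonomyFamily

variable {k : ℕ} {ξ : E → E → E} {Φ Φ' : ℝ × E × E → E}

theorem tendsto_displaced {X : E → E} (hX : ContDiff ℝ ∞ X) :
    Tendsto (fun q : ℝ × E => (q.1, q.2 + q.1 • X q.2)) (𝓝 (0, x₀)) (𝓝 (0, x₀)) := by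
  have := (by fun_prop : Continuous fun q : ℝ × E => (q.1, q.2 + q.1 • X q.2)).tendsto (0, x₀)
  simpa using this

theorem eventually_linked_displaced {X : E → E} (hX : ContDiff ℝ ∞ X) (hx₀ : x₀ ∈ chartDom p) :
    ∀ᶠ q in 𝓝 ((0, x₀) : ℝ × E), F.Linked p q.2 (q.2 + q.1 • X q.2) := by
  have t : Tendsto (fun q : ℝ × E => (q.2, q.2 + q.1 • X q.2)) (𝓝 (0, x₀)) (𝓝 (x₀, x₀)) := by
    have := (by fun_prop : Continuous fun q : ℝ × E => (q.2, q.2 + q.1 • X q.2)).tendsto (0, x₀)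
    simpa using this
  exact t.eventually (eventually_linked F p hx₀)

theorem conj_isHolonomy_smooth {X : E → E} (hX : ContDiff ℝ ∞ X)
    (h : F.HolonomyFamily p x₀ k ξ Φ Φ') (hx₀ : x₀ ∈ chartDom p) :
    (∀ᶠ q in 𝓝 ((0, x₀) : ℝ × E), F.IsHolonomy p q.2
      (fun y => F.segTransport p (q.2 + q.1 • X q.2) q.2 (Φ (q.1, q.2 + q.1 • X q.2,
        F.segTransport p q.2 (q.2 + q.1 • X q.2) y)))
      (fun y => F.segTransport p (q.2 + q.1 • X q.2) q.2 (Φ' (q.1, q.2 + q.1 • X q.2,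
        F.segTransport p q.2 (q.2 + q.1 • X q.2) y)))) ∧
    ∀ᶠ q in 𝓝 ((0, x₀) : ℝ × E), ∀ y ∈ F.coordCone p q.2,
      GermSmooth (fun z : ℝ × E × E => F.segTransport p (z.2.1 + z.1 • X z.2.1) z.2.1
        (Φ (z.1, z.2.1 + z.1 • X z.2.1,
          F.segTransport p z.2.1 (z.2.1 + z.1 • X z.2.1) z.2.2))) (q.1, q.2, y) ∧
      GermSmooth (fun z : ℝ × E × E => F.segTransport p (z.2.1 + z.1 • X z.2.1) z.2.1
        (Φ' (z.1, z.2.1 + z.1 • X z.2.1,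
          F.segTransport p z.2.1 (z.2.1 + z.1 • X z.2.1) z.2.2))) (q.1, q.2, y) := by
  have t := tendsto_displaced (x₀ := x₀) hX
  have hl := eventually_linked_displaced (F := F) hX hx₀
  have key : ∀ {Φ : ℝ × E × E → E} {q : ℝ × E} {y : E},
      F.Linked p q.2 (q.2 + q.1 • X q.2) → y ≠ 0 →
      GermSmooth Φ (q.1, q.2 + q.1 • X q.2, F.segTransport p q.2 (q.2 + q.1 • X q.2) y) →
      Φ (q.1, q.2 + q.1 • X q.2, F.segTransport p q.2 (q.2 + q.1 • X q.2) y) ≠ 0 →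
      GermSmooth (fun z : ℝ × E × E => F.segTransport p (z.2.1 + z.1 • X z.2.1) z.2.1
        (Φ (z.1, z.2.1 + z.1 • X z.2.1,
          F.segTransport p z.2.1 (z.2.1 + z.1 • X z.2.1) z.2.2))) (q.1, q.2, y) := by
    intro Φ q y h1 h2 h3 h4
    have s1 : GermSmooth (fun z : ℝ × E × E => z.1) (q.1, q.2, y) :=
      ContDiff.germSmooth (by fun_prop) _
    have s2 : GermSmooth (fun z : ℝ × E × E => z.2.1) (q.1, q.2, y) :=
      ContDiff.germSmooth (by fun_prop) _
    have s3 : GermSmooth (fun z : ℝ × E × E => z.2.1 + z.1 • X z.2.1) (q.1, q.2, y) :=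
      ContDiff.germSmooth (by fun_prop) _
    have s4 : GermSmooth (fun z : ℝ × E × E => z.2.2) (q.1, q.2, y) :=
      ContDiff.germSmooth (by fun_prop) _
    refine germSmooth_segTransport (a := fun z : ℝ × E × E => z.2.1 + z.1 • X z.2.1)
      (b := fun z : ℝ × E × E => z.2.1) h1.symm h4 s3 s2 ?_
    exact GermSmooth.comp (f := Φ) (h := fun z : ℝ × E × E => (z.1, z.2.1 + z.1 • X z.2.1,
      F.segTransport p z.2.1 (z.2.1 + z.1 • X z.2.1) z.2.2)) h3
      (s1.prodMk (s3.prodMk (germSmooth_segTransport h1 h2 s2 s3 s4)))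
  constructor
  · filter_upwards [t.eventually h.isHolonomy, hl] with q h1 h2 using h1.conj h2
  · filter_upwards [t.eventually h.isHolonomy, t.eventually h.smooth, hl] with q h1 h2 h3 y hy
    have hm := h3.segTransport_mem hy
    have hy0 := ne_zero_of_mem_coordCone h3.mem_left hy
    exact ⟨key h3 hy0 (h2 _ hm).1
        (ne_zero_of_mem_coordCone h3.mem_right (h1.mapsTo h3.mem_right hm)),
      key h3 hy0 (h2 _ hm).2
        (ne_zero_of_mem_coordCone h3.mem_right (h1.inv.mapsTo h3.mem_right hm))⟩

/-- The horizontal Berwald derivative of the field of a family of holonomies. -/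
theorem berwald {X : E → E} (hX : ContDiff ℝ ∞ X)
    (h : F.HolonomyFamily p x₀ k ξ Φ Φ') (hx₀ : x₀ ∈ chartDom p) :
    ∃ Ψ Ψ', F.HolonomyFamily p x₀ (k + 1)
      (fun x y => berwaldCoeff (F.coordFun p) ξ x y (X x)) Ψ Ψ' := by
  have hc := conj_isHolonomy_smooth hX h hx₀
  have hi := h.isHolonomy.mono fun q hq => hq.inv
  have hs := h.smooth.mono fun q hq y hy => (hq y hy).symm
  have c1 := isHolonomy_smooth_comp
    (Φ := fun z => F.segTransport p (z.2.1 + z.1 • X z.2.1) z.2.1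
        (Φ (z.1, z.2.1 + z.1 • X z.2.1,
          F.segTransport p z.2.1 (z.2.1 + z.1 • X z.2.1) z.2.2)))
    (Φ' := fun z => F.segTransport p (z.2.1 + z.1 • X z.2.1) z.2.1
        (Φ' (z.1, z.2.1 + z.1 • X z.2.1,
          F.segTransport p z.2.1 (z.2.1 + z.1 • X z.2.1) z.2.2))) hx₀ hc.1 hc.2 hi hs
  refine ⟨_, _, k.succ_ne_zero, c1.1, c1.2, fun y hy => ?_⟩
  have hy0 := ne_zero_of_mem_coordCone hx₀ hy
  obtain ⟨A, hA, hA1, hA2⟩ := h.expansion y hy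
  have hid : ContDiff ℝ ∞ (fun w : E => w) := contDiff_id
  obtain ⟨B, hB, hB1, hB2⟩ := exists_horizontalFlow_expansion (F := F) (w₀ := X x₀) hid hx₀ hy0
  have t : Tendsto (fun q : ℝ × E × E × E => (q.1, q.2.1, q.2.2.2)) (𝓝 (0, x₀, X x₀, y))
      (𝓝 (0, x₀, y)) := (by fun_prop : Continuous fun q : ℝ × E × E × E =>
        (q.1, q.2.1, q.2.2.2)).tendsto (0, x₀, X x₀, y)
  have t' : Tendsto (fun z : E × E × E => (z.1, z.2.2)) (𝓝 (x₀, X x₀, y)) (𝓝 (x₀, y)) :=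
    (by fun_prop : Continuous fun z : E × E × E => (z.1, z.2.2)).tendsto (x₀, X x₀, y)
  have hbase : ∀ {Φ : ℝ × E × E → E}, GermSmooth Φ (0, x₀, y) →
      GermSmooth (fun q : ℝ × E × E × E => (q.2.1, q.2.2.1, Φ (q.1, q.2.1, q.2.2.2)))
        (0, x₀, X x₀, y) := fun hΦ =>
    (ContDiff.germSmooth (by fun_prop) _).prodMk ((ContDiff.germSmooth (by fun_prop) _).prodMk
      (GermSmooth.comp (h := fun q : ℝ × E × E × E => (q.1, q.2.1, q.2.2.2)) hΦ
        (ContDiff.germSmooth (by fun_prop) _)))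
  -- Apply Φ_t⁻¹ at x, transport to x + t w, apply Φ_t there and transport back. The first and the
  -- conjugated map are holonomies at x, although the two transports separately are not.
  obtain ⟨C, hC, hC1, hC2⟩ := exists_commutator (Z := E × E × E) (z₀ := (x₀, X x₀, y))
    (Φ := fun q => (q.2.1, q.2.2.1, Φ (q.1, q.2.1, q.2.2.2)))
    (Φ' := fun q => (q.2.1, q.2.2.1, Φ' (q.1, q.2.1, q.2.2.2)))
    (Ψ := F.horizontalFlow p (fun w => w)) (Ψ' := F.horizontalFlow p (fun w => -w))
    (A := fun q => (0, 0, A (q.1, q.2.1, q.2.2.2))) (B := B) h.ne_zero one_ne_zero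
    (by fun_prop) hB
    ((t.eventually hA1).mono fun q hq => by
      refine Prod.ext ?_ (Prod.ext ?_ ?_)
      · simp
      · simp
      · exact hq)
    hB1 (hbase (h.germSmooth hy).2) (germSmooth_horizontalFlow hid.neg hx₀ hy0)
    ((t.eventually (h.eventually_inv hx₀ hy)).mono fun q hq => by
      refine Prod.ext rfl (Prod.ext rfl ?_)
      exact hq)
    (horizontalFlow_neg hid hx₀ hy0)
    ((t'.eventually (h.eventually_zero hx₀ hy)).mono fun z hz => by
      refine Prod.ext rfl (Prod.ext rfl ?_)
      exact hz.2)
  have s : Tendsto (fun z : ℝ × E × E => (z.1, z.2.1, X z.2.1, z.2.2)) (𝓝 (0, x₀, y))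
      (𝓝 (0, x₀, X x₀, y)) := (by fun_prop : Continuous fun z : ℝ × E × E =>
        (z.1, z.2.1, X z.2.1, z.2.2)).tendsto (0, x₀, y)
  have s' : Tendsto (fun z : E × E => (z.1, X z.1, z.2)) (𝓝 (x₀, y))
      (𝓝 (x₀, X x₀, y)) := (by fun_prop : Continuous fun z : E × E =>
        (z.1, X z.1, z.2)).tendsto (x₀, y)
  -- Only after the commutator expansion is the frozen displacement w set equal to X(x).
  refine ⟨fun z => (C (z.1, z.2.1, X z.2.1, z.2.2)).2.2, by fun_prop, ?_, ?_⟩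
  · filter_upwards [s.eventually hC1] with z hz
    have hz2 := congrArg (fun v : E × E × E => v.2.2) hz
    simp only [horizontalFlow, smul_neg, add_neg_cancel_right] at hz2
    exact hz2
  · have hξ := h.germSmooth_field hy
    filter_upwards [s'.eventually hC2, s'.eventually hB2.eventually_nhds,
      s'.eventually (t'.eventually hA2).eventually_nhds, hξ.eventually,
      eventually_mem_coordCone hx₀ hy] with w a1 a2 a3 a4 a5
    obtain ⟨x, y'⟩ := w
    have hsl : (x, y') ∈ slit (chartDom p) := ⟨a5.1, ne_zero_of_mem_coordCone a5.1 a5.2⟩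
    have dξ := a4.contDiffAt.differentiableAt_infty
    have dN := ((F.isLocalFinsler p).contDiffAt_connCoeff hsl).differentiableAt_infty
    have e1 : (fun z : E × E × E => A (0, z.1, z.2.2))
        =ᶠ[𝓝 (x, X x, y')] fun z => ξ z.1 z.2.2 := a3
    have e2 : (fun z : E × E × E => (B (0, z)).2.2) =ᶠ[𝓝 (x, X x, y')]
        fun z => -connCoeff (F.coordFun p) z.1 z.2.2 z.2.1 :=
      a2.mono fun z hz => congrArg (fun v : E × E × E => v.2.2) hz
    have e3 : B (0, x, X x, y') = _ := a2.self_of_nhds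
    have e4 : A (0, x, y') = ξ x y' := a3.self_of_nhds
    have d1 : DifferentiableAt ℝ (fun z : E × E × E => B (0, z)) (x, X x, y') :=
      (by fun_prop : ContDiff ℝ ∞ fun z : E × E × E => B (0, z)).differentiable (by simp) _
    have d2 : DifferentiableAt ℝ (fun z : E × E × E => ((0 : E), (0 : E), A (0, z.1, z.2.2)))
        (x, X x, y') :=
      (by fun_prop : ContDiff ℝ ∞ fun z : E × E × E =>
        ((0 : E), (0 : E), A (0, z.1, z.2.2))).differentiable (by simp) _
    change (C (0, x, X x, y')).2.2 = berwaldCoeff (F.coordFun p) ξ x y' (X x)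
    change C (0, x, X x, y') = _ at a1
    rw [a1, lieBracket_snd_snd d1 d2]
    rw [e1.fderiv_eq, e2.fderiv_eq, e3, e4,
      fderiv_comp_fst_snd_snd (ξ := fun z : E × E => ξ z.1 z.2) dξ,
      fderiv_apply_comp_fst_snd_snd (N := fun z : E × E => connCoeff (F.coordFun p) z.1 z.2)
        (u := fun w : E => w) dN differentiableAt_id,
      (F.isLocalFinsler p).berwaldCoeff_eq hsl dξ, sub_neg_eq_add]

/-- The curvature as the field of a family of holonomies. -/
theorem curvature {X Y : E → E} (hX : ContDiff ℝ ∞ X) (hY : ContDiff ℝ ∞ Y)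
    (hx₀ : x₀ ∈ chartDom p) :
    ∃ Ψ Ψ', F.HolonomyFamily p x₀ 2
      (fun x y => curvatureCoeff (F.coordFun p) x y (X x) (Y x)) Ψ Ψ' := by
  -- Vertices of the parallelogram with sides -tY, tX, tY, -tX in this order, as dictated by the
  -- commutator Ψ⁻¹ΦΨΦ⁻¹ with Φ the transport along tY and Ψ along tX.
  let x₁ : ℝ × E → E := fun q => q.2 - q.1 • Y q.2
  let x₂ : ℝ × E → E := fun q => q.2 - q.1 • Y q.2 + q.1 • X q.2
  let x₃ : ℝ × E → E := fun q => q.2 + q.1 • X q.2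
  have hx₁ : ContDiff ℝ ∞ x₁ := by fun_prop
  have hx₂ : ContDiff ℝ ∞ x₂ := by fun_prop
  have hx₃ : ContDiff ℝ ∞ x₃ := by fun_prop
  have lim : ∀ {a b : ℝ × E → E}, ContDiff ℝ ∞ a → ContDiff ℝ ∞ b → a (0, x₀) = x₀ →
      b (0, x₀) = x₀ → ∀ᶠ q in 𝓝 ((0, x₀) : ℝ × E), F.Linked p (a q) (b q) := by
    intro a b ha hb ha0 hb0
    have := (ha.continuous.prodMk hb.continuous).tendsto (0, x₀)
    rw [ha0, hb0] at this
    exact this.eventually (eventually_linked F p hx₀)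
  have i1 : x₁ (0, x₀) = x₀ := by simp [x₁]
  have i2 : x₂ (0, x₀) = x₀ := by simp [x₂]
  have i3 : x₃ (0, x₀) = x₀ := by simp [x₃]
  have l1 := lim (contDiff_snd) hx₁ rfl i1
  have l2 := lim hx₁ hx₂ i1 i2
  have l3 := lim hx₂ hx₃ i2 i3
  have l4 := lim hx₃ contDiff_snd i3 rfl
  have key : ∀ {a b c : ℝ × E → E} {q : ℝ × E} {y : E}, ContDiff ℝ ∞ a → ContDiff ℝ ∞ b →
      ContDiff ℝ ∞ c → F.Linked p q.2 (a q) → F.Linked p (a q) (b q) →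
      F.Linked p (b q) (c q) → F.Linked p (c q) q.2 → y ≠ 0 →
      GermSmooth (fun z : ℝ × E × E => F.segTransport p (c (z.1, z.2.1)) z.2.1
        (F.segTransport p (b (z.1, z.2.1)) (c (z.1, z.2.1))
        (F.segTransport p (a (z.1, z.2.1)) (b (z.1, z.2.1))
        (F.segTransport p z.2.1 (a (z.1, z.2.1)) z.2.2)))) (q.1, q.2, y) := by
    intro a b c q y ha hb hc h1 h2 h3 h4 hy
    have s : ∀ {a : ℝ × E → E}, ContDiff ℝ ∞ a →
        GermSmooth (fun z : ℝ × E × E => a (z.1, z.2.1)) (q.1, q.2, y) := fun ha =>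
      ContDiff.germSmooth (by fun_prop) _
    have n1 := h1.segTransport_ne_zero hy
    have n2 := h2.segTransport_ne_zero n1
    have n3 := h3.segTransport_ne_zero n2
    exact germSmooth_segTransport (a := fun z : ℝ × E × E => c (z.1, z.2.1)) h4 n3 (s hc)
      (s contDiff_snd) (germSmooth_segTransport (a := fun z : ℝ × E × E => b (z.1, z.2.1)) h3 n2
      (s hb) (s hc) (germSmooth_segTransport (a := fun z : ℝ × E × E => a (z.1, z.2.1)) h2 n1
      (s ha) (s hb) (germSmooth_segTransport (a := fun z : ℝ × E × E => z.2.1) h1 hy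
      (s contDiff_snd) (s ha) (ContDiff.germSmooth (by fun_prop) _))))
  have hd : ∀ᶠ q in 𝓝 ((0, x₀) : ℝ × E), q.2 ∈ chartDom p :=
    continuousAt_snd.eventually ((isOpen_chartDom p).mem_nhds hx₀)
  refine ⟨fun z : ℝ × E × E => F.segTransport p (x₃ (z.1, z.2.1)) z.2.1
        (F.segTransport p (x₂ (z.1, z.2.1)) (x₃ (z.1, z.2.1))
        (F.segTransport p (x₁ (z.1, z.2.1)) (x₂ (z.1, z.2.1))
        (F.segTransport p z.2.1 (x₁ (z.1, z.2.1)) z.2.2))),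
    fun z : ℝ × E × E => F.segTransport p (x₁ (z.1, z.2.1)) z.2.1
        (F.segTransport p (x₂ (z.1, z.2.1)) (x₁ (z.1, z.2.1))
        (F.segTransport p (x₃ (z.1, z.2.1)) (x₂ (z.1, z.2.1))
        (F.segTransport p z.2.1 (x₃ (z.1, z.2.1)) z.2.2))), two_ne_zero, ?_, ?_, fun y hy => ?_⟩
  · filter_upwards [l1, l2, l3, l4] with q h1 h2 h3 h4
    exact isHolonomy_quadrilateral h1 h2 h3 h4
  · filter_upwards [l1, l2, l3, l4, hd] with q h1 h2 h3 h4 hq y hy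
    have hy0 := ne_zero_of_mem_coordCone hq hy
    exact ⟨key hx₁ hx₂ hx₃ h1 h2 h3 h4 hy0,
      key hx₃ hx₂ hx₁ h4.symm h3.symm h2.symm h1.symm hy0⟩
  have hy0 := ne_zero_of_mem_coordCone hx₀ hy
  set w₀ : E × E := (X x₀, Y x₀) with hw₀
  have h1 : ContDiff ℝ ∞ (fun w : E × E => w.1) := contDiff_fst
  have h2 : ContDiff ℝ ∞ (fun w : E × E => w.2) := contDiff_snd
  obtain ⟨A, hA, hA1, hA2⟩ := exists_horizontalFlow_expansion (F := F) (w₀ := w₀) h2 hx₀ hy0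
  obtain ⟨B, hB, hB1, hB2⟩ := exists_horizontalFlow_expansion (F := F) (w₀ := w₀) h1 hx₀ hy0
  have hneg := horizontalFlow_neg (F := F) (w₀ := w₀) h2.neg hx₀ hy0
  simp only [neg_neg] at hneg
  -- Both displacements are frozen in the parameter w, so the base motions commute and the loop
  -- closes exactly; the fibre component of the bracket of the horizontal lifts is the curvature.
  obtain ⟨C, hC, hC1, hC2⟩ := exists_commutator (Z := E × (E × E) × E) (z₀ := (x₀, w₀, y))
    (Φ := F.horizontalFlow p (fun w : E × E => w.2))
    (Φ' := F.horizontalFlow p (fun w : E × E => -w.2))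
    (Ψ := F.horizontalFlow p (fun w : E × E => w.1))
    (Ψ' := F.horizontalFlow p (fun w : E × E => -w.1))
    (A := A) (B := B) one_ne_zero one_ne_zero hA hB hA1 hB1
    (germSmooth_horizontalFlow h2.neg hx₀ hy0) (germSmooth_horizontalFlow h1.neg hx₀ hy0)
    hneg (horizontalFlow_neg h1 hx₀ hy0) (horizontalFlow_zero hx₀ hy0)
  have s : Tendsto (fun z : ℝ × E × E => (z.1, z.2.1, (X z.2.1, Y z.2.1), z.2.2)) (𝓝 (0, x₀, y))
      (𝓝 (0, x₀, w₀, y)) := (by fun_prop : Continuous fun z : ℝ × E × E =>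
        (z.1, z.2.1, (X z.2.1, Y z.2.1), z.2.2)).tendsto (0, x₀, y)
  have s' : Tendsto (fun z : E × E => (z.1, (X z.1, Y z.1), z.2)) (𝓝 (x₀, y))
      (𝓝 (x₀, w₀, y)) := (by fun_prop : Continuous fun z : E × E =>
        (z.1, (X z.1, Y z.1), z.2)).tendsto (x₀, y)
  refine ⟨fun z => (C (z.1, z.2.1, (X z.2.1, Y z.2.1), z.2.2)).2.2, by fun_prop, ?_, ?_⟩
  · filter_upwards [s.eventually hC1] with z hz
    have hz2 := congrArg (fun v : E × (E × E) × E => v.2.2) hz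
    have e1 : z.2.1 - z.1 • Y z.2.1 + z.1 • X z.2.1 + z.1 • Y z.2.1
      = z.2.1 + z.1 • X z.2.1 := by abel
    simp only [horizontalFlow, smul_neg, ← sub_eq_add_neg, e1, add_sub_cancel_right] at hz2
    exact hz2
  · filter_upwards [s'.eventually hC2, s'.eventually hA2.eventually_nhds,
      s'.eventually hB2.eventually_nhds, eventually_mem_coordCone hx₀ hy] with w a1 a2 a3 a5
    obtain ⟨x, y'⟩ := w
    have hsl : (x, y') ∈ slit (chartDom p) := ⟨a5.1, ne_zero_of_mem_coordCone a5.1 a5.2⟩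
    have dN := ((F.isLocalFinsler p).contDiffAt_connCoeff hsl).differentiableAt_infty
    have e1 : (fun z : E × (E × E) × E => (A (0, z)).2.2) =ᶠ[𝓝 (x, (X x, Y x), y')]
        fun z => -connCoeff (F.coordFun p) z.1 z.2.2 z.2.1.2 :=
      a2.mono fun z hz => congrArg (fun v : E × (E × E) × E => v.2.2) hz
    have e2 : (fun z : E × (E × E) × E => (B (0, z)).2.2) =ᶠ[𝓝 (x, (X x, Y x), y')]
        fun z => -connCoeff (F.coordFun p) z.1 z.2.2 z.2.1.1 :=
      a3.mono fun z hz => congrArg (fun v : E × (E × E) × E => v.2.2) hz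
    have e3 : A (0, x, (X x, Y x), y') = _ := a2.self_of_nhds
    have e4 : B (0, x, (X x, Y x), y') = _ := a3.self_of_nhds
    have d1 : DifferentiableAt ℝ (fun z : E × (E × E) × E => A (0, z)) (x, (X x, Y x), y') :=
      (by fun_prop : ContDiff ℝ ∞ fun z : E × (E × E) × E => A (0, z)).differentiable (by simp) _
    have d2 : DifferentiableAt ℝ (fun z : E × (E × E) × E => B (0, z)) (x, (X x, Y x), y') :=
      (by fun_prop : ContDiff ℝ ∞ fun z : E × (E × E) × E => B (0, z)).differentiable (by simp) _
    change (C (0, x, (X x, Y x), y')).2.2 = curvatureCoeff (F.coordFun p) x y' (X x) (Y x)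
    change C (0, x, (X x, Y x), y') = _ at a1
    rw [a1, lieBracket_snd_snd d2 d1, e1.fderiv_eq, e2.fderiv_eq, e3, e4,
      fderiv_apply_comp_fst_snd_snd (N := fun z : E × E => connCoeff (F.coordFun p) z.1 z.2)
        (u := fun w : E × E => w.1) dN differentiableAt_fst,
      fderiv_apply_comp_fst_snd_snd (N := fun z : E × E => connCoeff (F.coordFun p) z.1 z.2)
        (u := fun w : E × E => w.2) dN differentiableAt_snd,
      (F.isLocalFinsler p).curvatureCoeff_eq hsl]
    simp only
    abel

end HolonomyFamily

end FinslerFunction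

namespace FinslerFunction

variable {E : Type u} [NormedAddCommGroup E] [NormedSpace ℝ E]
  {M : Type*} [TopologicalSpace M] [ChartedSpace E M] [IsManifold 𝓘(ℝ, E) ∞ M]
  {F : FinslerFunction E M} {p : M} {x₀ : E}

/-! ### Vertical fields in coordinates -/

theorem coordField_eq (ξ : F.VerticalField) (p : M) (x y : E) :
    coordField ξ p x y = toChart p x (homExt (ξ (chartPt p x)) (fromChart p x y)) := rfl

theorem coordField_smul_right (ξ : F.VerticalField) {x y : E} (hy : y ∈ F.coordCone p x) {r : ℝ}
    (hr : 0 < r) : coordField ξ p x (r • y) = r • coordField ξ p x y := by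
  rw [coordField_eq, coordField_eq, map_smul,
    homExt_smul (m := chartPt p x) _ (v := fromChart p x y) hy hr, map_smul]

theorem coordField_of_eq_one (ξ : F.VerticalField) {x y : E} (hy : F.coordFun p x y = 1) :
    coordField ξ p x y = toChart p x (ξ (chartPt p x) ⟨fromChart p x y, hy⟩) :=
  congrArg (toChart p x) (homExt_of_eq_one (m := chartPt p x) _ (v := fromChart p x y) hy)

theorem fromChart_chartField (X : (x : M) → TangentSpace 𝓘(ℝ, E) x) {x : E}
    (hx : x ∈ chartDom p) : fromChart p x (chartField p X x) = X (chartPt p x) :=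
  fromChart_toChart hx _

theorem homExt_add {m : M} (f g : F.Indicatrix m → E) (v : E) :
    homExt (f + g) v = homExt f v + homExt g v := by
  unfold homExt
  split_ifs <;> simp

theorem homExt_const_smul {m : M} (r : ℝ) (f : F.Indicatrix m → E) (v : E) :
    homExt (r • f) v = r • homExt f v := by
  unfold homExt
  split_ifs
  · rw [Pi.smul_apply, smul_comm]
  · rw [smul_zero]

theorem homExt_zero {m : M} (v : E) : homExt (0 : F.Indicatrix m → E) v = 0 := by
  unfold homExt
  split_ifs <;> simp

theorem coordField_transition (ξ : F.VerticalField) {p m : M} {x : E} (hx : x ∈ transitionDom p m)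
    (y : E) : fderiv ℝ (transition p m) x (coordField ξ p x y)
      = coordField ξ m (transition p m x) (fderiv ℝ (transition p m) x y) := by
  rw [coordField_eq, coordField_eq, fromChart_transition hx, toChart_transition hx,
    chartPt_transition hx]

theorem fderiv_transition_transition {p m : M} {x : E} (hx : x ∈ transitionDom m p) (y : E) :
    fderiv ℝ (transition p m) (transition m p x) (fderiv ℝ (transition m p) x y) = y := by
  rw [fderiv_transition (transition_mem_transitionDom hx), fderiv_transition hx,
    chartPt_transition hx]
  exact tangentCoordChange_inv (chartPt_mem_source hx.1) hx.2 y

theorem coordField_eq_transition (ξ : F.VerticalField) {p m : M} {x : E}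
    (hx : x ∈ transitionDom m p) (y : E) :
    coordField ξ m x y = fderiv ℝ (transition p m) (transition m p x)
      (coordField ξ p (transition m p x) (fderiv ℝ (transition m p) x y)) := by
  rw [coordField_transition ξ (transition_mem_transitionDom hx),
    fderiv_transition_transition hx, transition_transition hx]

/-- The covariant derivative at a point is computed in that point's chart, whereas differentiability
is known in the chart at p from the family of holonomies; the field is rewritten through the
transition map. -/
theorem differentiableAt_coordField_transition (ξ : F.VerticalField) {p m : M} {x y : E}
    (hx : x ∈ transitionDom p m)
    (h : DifferentiableAt ℝ (fun z : E × E => coordField ξ p z.1 z.2) (x, y)) :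
    DifferentiableAt ℝ (fun z : E × E => coordField ξ m z.1 z.2)
      (tangentLift (transition p m) (x, y)) := by
  set z' := tangentLift (transition p m) (x, y) with hz'
  have hx' : z'.1 ∈ transitionDom m p := transition_mem_transitionDom hx
  have e : tangentLift (transition m p) z' = (x, y) :=
    Prod.ext (transition_transition hx)
      (fderiv_transition_transition (p := m) (m := p) hx y)
  have h1 := ((F.isCoordChange m p).hasFDerivAt_tangentLift (z := z') hx').differentiableAt
  have h2 : DifferentiableAt ℝ (fun z => coordField ξ p (tangentLift (transition m p) z).1
      (tangentLift (transition m p) z).2) z' :=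
    DifferentiableAt.comp (g := fun z : E × E => coordField ξ p z.1 z.2) z'
      (by rw [e]; exact h) h1
  have h3 : DifferentiableAt ℝ (fun z : E × E =>
      fderiv ℝ (transition p m) (transition m p z.1)) z' :=
    DifferentiableAt.comp (f := fun z : E × E => transition m p z.1) z'
      (contDiffAt_transition (transition_mem_transitionDom hx')).fderiv_infty.differentiableAt_infty
      (DifferentiableAt.comp (f := fun z : E × E => z.1) z'
        (contDiffAt_transition hx').differentiableAt_infty differentiableAt_fst)
  refine (h3.clm_apply h2).congr_of_eventuallyEq ?_
  have c : ContinuousAt (fun z : E × E => z.1) z' := continuousAt_fst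
  filter_upwards [c.eventually ((isOpen_transitionDom m p).mem_nhds hx')] with z hz
  exact coordField_eq_transition ξ hz z.2

/-- The Lie bracket in coordinates. -/
theorem coordField_bracket (ξ η : F.VerticalField) {x y : E} (hx : x ∈ chartDom p)
    (hy : F.coordFun p x y = 1)
    (hξ : DifferentiableAt ℝ (fun z : E × E => coordField ξ p z.1 z.2) (x, y))
    (hη : DifferentiableAt ℝ (fun z : E × E => coordField η p z.1 z.2) (x, y)) :
    coordField (fun x => bracket (ξ x) (η x)) p x y
      = VectorField.lieBracket ℝ (coordField ξ p x) (coordField η p x) y := by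
  have key : ∀ ζ : F.VerticalField,
      DifferentiableAt ℝ (fun z : E × E => coordField ζ p z.1 z.2) (x, y) →
      HasFDerivAt (homExt (ζ (chartPt p x))) ((fromChart p x).comp
        ((fderiv ℝ (coordField ζ p x) y).comp (toChart p x))) (fromChart p x y) := by
    intro ζ hζ
    have h1 := (hasFDerivAt_slice_right hζ).differentiableAt.hasFDerivAt
    have h2 : HasFDerivAt (coordField ζ p x) (fderiv ℝ (coordField ζ p x) y)
        (toChart p x (fromChart p x y)) := by
      rw [toChart_fromChart hx]
      exact h1
    have h3 := (fromChart p x).hasFDerivAt.comp (fromChart p x y)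
      (h2.comp (fromChart p x y) (toChart p x).hasFDerivAt)
    refine h3.congr_of_eventuallyEq (Eventually.of_forall fun v => ?_)
    change _ = fromChart p x (coordField ζ p x (toChart p x v))
    rw [coordField_eq, fromChart_toChart hx, fromChart_toChart hx]
  rw [coordField_of_eq_one _ hy]
  change toChart p x (VectorField.lieBracket ℝ (homExt (ξ (chartPt p x)))
    (homExt (η (chartPt p x))) (fromChart p x y)) = _
  rw [VectorField.lieBracket, VectorField.lieBracket, (key ξ hξ).fderiv, (key η hη).fderiv,
    map_sub]
  simp only [ContinuousLinearMap.comp_apply, toChart_fromChart hx]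
  rfl

variable [FiniteDimensional ℝ E]

/-- The curvature field in coordinates. -/
theorem coordField_curvatureField (X Y : (x : M) → TangentSpace 𝓘(ℝ, E) x) {x y : E}
    (hx : x ∈ chartDom p) (hy : F.coordFun p x y = 1) :
    coordField (F.curvatureField X Y) p x y
      = curvatureCoeff (F.coordFun p) x y (chartField p X x) (chartField p Y x) := by
  have hm := mem_transitionDom_self hx
  have hsl : (x, y) ∈ slit (transitionDom p (chartPt p x)) :=
    ⟨hm, ne_zero_of_mem_coordCone hx (mem_coordCone_of_eq_one hy)⟩
  have h := (F.isCoordChange p (chartPt p x)).curvatureCoeff (F.isLocalFinsler _)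
    (F.isLocalFinsler p) hsl (chartField p X x) (chartField p Y x)
  have e : fderiv ℝ (transition p (chartPt p x)) x = fromChart p x := fderiv_transition hm
  rw [e, fromChart_chartField X hx, fromChart_chartField Y hx] at h
  rw [coordField_of_eq_one _ hy, ← toChart_fromChart hx
    (curvatureCoeff (F.coordFun p) x y _ _), ← h]
  rfl

/-- The horizontal Berwald derivative in coordinates. -/
theorem coordField_covariantDeriv (X : (x : M) → TangentSpace 𝓘(ℝ, E) x) (ξ : F.VerticalField)
    {x y : E} (hx : x ∈ chartDom p) (hy : F.coordFun p x y = 1)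
    (hξ : DifferentiableAt ℝ (fun z : E × E => coordField ξ p z.1 z.2) (x, y)) :
    coordField (covariantDeriv X ξ) p x y
      = berwaldCoeff (F.coordFun p) (coordField ξ p) x y (chartField p X x) := by
  have hm := mem_transitionDom_self hx
  have hsl : (x, y) ∈ slit (transitionDom p (chartPt p x)) :=
    ⟨hm, ne_zero_of_mem_coordCone hx (mem_coordCone_of_eq_one hy)⟩
  have c : ContinuousAt (fun z : E × E => z.1) (x, y) := continuousAt_fst
  have h := (F.isCoordChange p (chartPt p x)).berwaldCoeff (F.isLocalFinsler _)
    (F.isLocalFinsler p) hsl hξ (differentiableAt_coordField_transition ξ hm hξ)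
    ((c.eventually ((isOpen_transitionDom _ _).mem_nhds hm)).mono fun z hz =>
      coordField_transition ξ hz z.2) (chartField p X x)
  have e : fderiv ℝ (transition p (chartPt p x)) x = fromChart p x := fderiv_transition hm
  rw [e, fromChart_chartField X hx] at h
  rw [coordField_of_eq_one _ hy, ← toChart_fromChart hx
    (berwaldCoeff (F.coordFun p) (coordField ξ p) x y _), ← h]
  rfl

/-! ### The holonomy algebra -/

/-- The reparametrization with r = 1 raises the order by one and keeps the field. -/
theorem HolonomyFamily.raise {k : ℕ} {ξ : E → E → E} {Φ Φ' : ℝ × E × E → E}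
    (h : F.HolonomyFamily p x₀ k ξ Φ Φ') (hx₀ : x₀ ∈ chartDom p) (l : ℕ) :
    ∃ Ψ Ψ', F.HolonomyFamily p x₀ (k + l) ξ Ψ Ψ' := by
  induction l with
  | zero => exact ⟨Φ, Φ', h⟩
  | succ l ih =>
    obtain ⟨Ψ, Ψ', h'⟩ := ih
    have := h'.smul_succ hx₀ 1
    simp only [one_smul] at this
    exact ⟨_, _, this⟩

/-- Every element of the fibred holonomy algebra is the field of a family of holonomies. -/
theorem FibredHolonomyAlgebra.exists_holonomyFamily {ξ : F.VerticalField}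
    (hξ : F.FibredHolonomyAlgebra ξ) (hx₀ : x₀ ∈ chartDom p) :
    ∃ k Φ Φ', F.HolonomyFamily p x₀ k (coordField ξ p) Φ Φ' := by
  have hhom : ∀ ξ : F.VerticalField, ∀ x ∈ chartDom p, ∀ y ∈ F.coordCone p x, ∀ r : ℝ, 0 < r →
      coordField ξ p x (r • y) = r • coordField ξ p x y :=
    fun ξ x _ y hy r hr => coordField_smul_right ξ hy hr
  have hfield : ∀ {X : (x : M) → TangentSpace 𝓘(ℝ, E) x}, IsSmoothField X →
      GermSmooth (chartField p X) x₀ := fun hX => GermSmooth.of_eventually_contDiffAt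
    (((isOpen_chartDom p).eventually_mem hx₀).mono fun x hx =>
      contDiffAt_chartField hX hx)
  induction hξ with
  | curvature X Y hX hY =>
    obtain ⟨X', hX', hXe⟩ := hfield hX
    obtain ⟨Y', hY', hYe⟩ := hfield hY
    obtain ⟨Ψ, Ψ', h⟩ := HolonomyFamily.curvature (F := F) hX' hY' hx₀
    refine ⟨_, Ψ, Ψ', h.congr hx₀ (hhom _) fun y hy => ?_⟩
    have c : ContinuousAt (fun z : E × E => z.1) (x₀, y) := continuousAt_fst
    filter_upwards [c.eventually hXe, c.eventually hYe,
      eventually_mem_coordCone hx₀ (mem_coordCone_of_eq_one hy)] with w h1 h2 h3 hw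
    rw [coordField_curvatureField X Y h3.1 hw, h1, h2]
  | covariantDeriv X hX ξ _ ih =>
    obtain ⟨k, Φ, Φ', h⟩ := ih
    obtain ⟨X', hX', hXe⟩ := hfield hX
    obtain ⟨Ψ, Ψ', h'⟩ := h.berwald hX' hx₀
    refine ⟨_, Ψ, Ψ', h'.congr hx₀ (hhom _) fun y hy => ?_⟩
    have c : ContinuousAt (fun z : E × E => z.1) (x₀, y) := continuousAt_fst
    filter_upwards [c.eventually hXe, (h.germSmooth_field (mem_coordCone_of_eq_one hy)).eventually,
      eventually_mem_coordCone hx₀ (mem_coordCone_of_eq_one hy)] with w h1 h2 h3 hw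
    rw [coordField_covariantDeriv X ξ h3.1 hw h2.contDiffAt.differentiableAt_infty, h1]
  | zero =>
    refine ⟨_, _, _, (HolonomyFamily.zero F p x₀).congr hx₀ (hhom _) fun y hy =>
      Eventually.of_forall fun w _ => ?_⟩
    rw [coordField_eq]
    change (0 : E) = toChart p w.1 (homExt 0 _)
    rw [homExt_zero, map_zero]
  | add ξ η _ _ ih ih' =>
    obtain ⟨k, Φ, Φ', h⟩ := ih
    obtain ⟨l, Ψ, Ψ', h'⟩ := ih'
    -- Composition adds leading fields only for equal orders, so both families are raised to order k
    -- + l.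
    obtain ⟨Φ₁, Φ₁', h₁⟩ := h.raise hx₀ l
    obtain ⟨Ψ₁, Ψ₁', h₂⟩ := h'.raise hx₀ k
    rw [add_comm] at h₂
    refine ⟨_, _, _, (h₁.add h₂ hx₀).congr hx₀ (hhom _) fun y hy =>
      Eventually.of_forall fun w _ => ?_⟩
    rw [coordField_eq, coordField_eq, coordField_eq, ← map_add, ← homExt_add]
    rfl
  | smul r ξ _ ih =>
    obtain ⟨k, Φ, Φ', h⟩ := ih
    refine ⟨_, _, _, (h.smul_succ hx₀ r).congr hx₀ (hhom _) fun y hy =>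
      Eventually.of_forall fun w _ => ?_⟩
    rw [coordField_eq, coordField_eq, ← map_smul, ← homExt_const_smul]
    rfl
  | bracket ξ η _ _ ih ih' =>
    obtain ⟨k, Φ, Φ', h⟩ := ih
    obtain ⟨l, Ψ, Ψ', h'⟩ := ih'
    -- The commutator lemma puts the field of its second family first in the bracket, hence the
    -- exchanged roles.
    refine ⟨_, _, _, (h'.commutator h hx₀).congr hx₀ (hhom _) fun y hy => ?_⟩
    filter_upwards [(h.germSmooth_field (mem_coordCone_of_eq_one hy)).eventually,
      (h'.germSmooth_field (mem_coordCone_of_eq_one hy)).eventually,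
      eventually_mem_coordCone hx₀ (mem_coordCone_of_eq_one hy)] with w h1 h2 h3 hw
    rw [coordField_bracket ξ η h3.1 hw h1.contDiffAt.differentiableAt_infty
      h2.contDiffAt.differentiableAt_infty]

end FinslerFunction

/-! ### Odd roots -/

/-- An odd power is an increasing homeomorphism of the line, and its inverse is smooth wherever the
derivative of the power is nonzero. -/
theorem exists_odd_root {k : ℕ} (hk : Odd k) : ∃ ρ : ℝ → ℝ, Continuous ρ ∧ (∀ s, ρ s ^ k = s) ∧
    ∀ s, s ≠ 0 → ContDiffAt ℝ ∞ ρ s := by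
  have hk0 : k ≠ 0 := fun h => by simp [h] at hk
  have hsurj : Function.Surjective fun t : ℝ => t ^ k :=
    (continuous_pow k).surjective (tendsto_pow_atTop hk0) <| by
      have h := tendsto_neg_atTop_atBot.comp
        ((tendsto_pow_atTop (α := ℝ) hk0).comp tendsto_neg_atBot_atTop)
      refine h.congr fun t => ?_
      simp [hk.neg_pow]
  let e := (hk.strictMono_pow.orderIsoOfSurjective _ hsurj).toHomeomorph
  have he : ∀ s, (e.symm s) ^ k = s := e.apply_symm_apply
  refine ⟨e.symm, e.symm.continuous, he, fun s hs => ?_⟩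
  have h0 : e.symm s ≠ 0 := fun h => hs (by rw [← he s, h, zero_pow hk0])
  exact e.toOpenPartialHomeomorph.contDiffAt_symm_deriv (f₀' := k * e.symm s ^ (k - 1))
    (mul_ne_zero (Nat.cast_ne_zero.2 hk0) (pow_ne_zero _ h0)) (mem_univ _)
    (hasDerivAt_pow k _) (contDiff_id.pow k).contDiffAt

section Root

variable {E G : Type*} [NormedAddCommGroup E] [NormedSpace ℝ E] [NormedAddCommGroup G]
  [NormedSpace ℝ G] {k : ℕ} {ρ : ℝ → ℝ} {A : ℝ × E → G}

/-- The derivative of ρ may blow up at 0, but ρ(s) ^ k = s gives s ρ'(s) = ρ(s)/k. The factor s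
therefore absorbs the singularity, and one formula covers s = 0 and s ≠ 0. -/
theorem hasFDerivAt_smul_root (hk : k ≠ 0) (hρ : Continuous ρ) (hρk : ∀ s, ρ s ^ k = s)
    (hρs : ∀ s, s ≠ 0 → ContDiffAt ℝ ∞ ρ s) (hA : ContDiff ℝ ∞ A) (q : ℝ × E) :
    HasFDerivAt (fun q : ℝ × E => q.1 • A (ρ q.1, q.2))
      ((ContinuousLinearMap.fst ℝ ℝ E).smulRight (A (ρ q.1, q.2))
        + (fderiv ℝ A (ρ q.1, q.2)).comp
          ((ρ q.1 / k) • (ContinuousLinearMap.inl ℝ ℝ E).comp (.fst ℝ ℝ E)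
            + q.1 • (ContinuousLinearMap.inr ℝ ℝ E).comp (.snd ℝ ℝ E))) q := by
  have hk' : (k : ℝ) ≠ 0 := Nat.cast_ne_zero.2 hk
  by_cases hq : q.1 = 0
  · have h0 : ρ 0 = 0 := by
      have := hρk 0
      exact eq_zero_of_pow_eq_zero this
    obtain ⟨s, y⟩ := q
    simp only at hq
    subst hq
    rw [h0, zero_div, zero_smul, zero_smul, add_zero, ContinuousLinearMap.comp_zero, add_zero]
    have hc : Continuous fun q : ℝ × E => A (ρ q.1, q.2) := by
      have := hA.continuous
      fun_prop
    refine .of_isLittleO ?_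
    have h1 : (fun q : ℝ × E => A (ρ q.1, q.2) - A (0, y)) =o[𝓝 (0, y)] fun _ => (1 : ℝ) := by
      rw [Asymptotics.isLittleO_one_iff]
      have := (hc.tendsto (0, y)).sub_const (A (0, y))
      simpa [h0] using this
    have h2 : (fun q : ℝ × E => q.1) =O[𝓝 (0, y)] fun q => ‖q - (0, y)‖ :=
      Asymptotics.isBigO_of_le _ fun q => by
        have := norm_fst_le (q - (0, y))
        simpa using this
    have h3 := h2.smul_isLittleO h1
    refine Asymptotics.IsLittleO.of_norm_right (h3.congr (fun q => ?_) fun q => ?_)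
    · simp [smul_sub]
    · simp
  · have hd : HasDerivAt ρ (ρ q.1 / (k * q.1)) q.1 := by
      have h1 := ((hρs _ hq).differentiableAt (by simp)).hasDerivAt
      have h2 := h1.pow k
      have e : (ρ ^ k) = fun s => s := funext hρk
      rw [e] at h2
      have h3 := h2.unique (hasDerivAt_id q.1)
      have h4 : ρ q.1 * ρ q.1 ^ (k - 1) = q.1 := by
        rw [← pow_succ', Nat.sub_add_cancel (Nat.pos_of_ne_zero hk), hρk]
      have h5 : ρ q.1 / (k * q.1) = deriv ρ q.1 := by
        rw [div_eq_iff (mul_ne_zero hk' hq)]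
        nth_rewrite 3 [← h4]
        linear_combination (-ρ q.1) * h3
      rw [h5]
      exact h1
    have h1 : HasFDerivAt (fun q : ℝ × E => (ρ q.1, q.2)) (((ρ q.1 / (k * q.1)) •
        ContinuousLinearMap.fst ℝ ℝ E).prod (.snd ℝ ℝ E)) q :=
      (hd.comp_hasFDerivAt q hasFDerivAt_fst).prodMk hasFDerivAt_snd
    have h2 : HasFDerivAt (fun q : ℝ × E => A (ρ q.1, q.2)) _ q :=
      HasFDerivAt.comp (f := fun q : ℝ × E => (ρ q.1, q.2)) q
        (hA.differentiable (by simp) _).hasFDerivAt h1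
    have h3 : HasFDerivAt (fun q : ℝ × E => q.1 • A (ρ q.1, q.2)) _ q :=
      hasFDerivAt_fst.smul h2
    refine h3.congr_fderiv ?_
    have e : q.1 • ((ρ q.1 / (k * q.1)) • ContinuousLinearMap.fst ℝ ℝ E).prod (.snd ℝ ℝ E)
        = (ρ q.1 / k) • (ContinuousLinearMap.inl ℝ ℝ E).comp (.fst ℝ ℝ E)
          + q.1 • (ContinuousLinearMap.inr ℝ ℝ E).comp (.snd ℝ ℝ E) := by
      refine ContinuousLinearMap.ext fun v => Prod.ext ?_ ?_
      · simp
        field_simp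
      · simp
    rw [add_comm, ← e, ContinuousLinearMap.comp_smul]

/-- The derivative formula contains ρ but no derivative of ρ, so it is continuous. -/
theorem contDiff_smul_root (hk : k ≠ 0) (hρ : Continuous ρ) (hρk : ∀ s, ρ s ^ k = s)
    (hρs : ∀ s, s ≠ 0 → ContDiffAt ℝ ∞ ρ s) (hA : ContDiff ℝ ∞ A) :
    ContDiff ℝ 1 (fun q : ℝ × E => q.1 • A (ρ q.1, q.2)) := by
  have h := hasFDerivAt_smul_root hk hρ hρk hρs hA
  rw [contDiff_one_iff_fderiv]
  refine ⟨fun q => (h q).differentiableAt, ?_⟩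
  rw [funext fun q => (h q).fderiv]
  have h1 := hA.continuous
  have h2 := hA.continuous_fderiv (by simp)
  have h3 : Continuous fun q : ℝ × E => (ρ q.1, q.2) := by fun_prop
  refine .add ?_ (.clm_comp (h2.comp h3) ?_)
  · exact (ContinuousLinearMap.smulRightL ℝ (ℝ × E) G
      (ContinuousLinearMap.fst ℝ ℝ E)).continuous.comp (h1.comp h3)
  · fun_prop

end Root

/-! ### Tangency to the holonomy group -/

namespace FinslerFunction

variable {E : Type u} [NormedAddCommGroup E] [NormedSpace ℝ E]
  {M : Type*} [TopologicalSpace M] [ChartedSpace E M] [IsManifold 𝓘(ℝ, E) ∞ M]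
  {F : FinslerFunction E M} {p : M} {x : E}

-- Substitute t = ρ(s) with ρ the k-th root: t ^ k becomes s, defined for s of both signs because k
-- is odd. Away from s = 0 the substituted family is smooth by composition; at s = 0
-- `contDiff_smul_root` gives C¹ regularity.
open Classical in
theorem HolonomyFamily.isTangentTo {k : ℕ} (hk : Odd k) {ξ : F.VerticalField}
    {Φ Φ' : ℝ × E × E → E} (h : F.HolonomyFamily p x k (coordField ξ p) Φ Φ')
    (hx : x ∈ chartDom p) : F.IsTangentTo (F.holonomyGroup (chartPt p x)) (ξ (chartPt p x)) := by
  obtain ⟨ρ, hρ, hρk, hρs⟩ := exists_odd_root hk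
  have h0 : ρ 0 = 0 := eq_zero_of_pow_eq_zero (hρk 0)
  have t : Tendsto (fun s : ℝ => (ρ s, x)) (𝓝 0) (𝓝 (0, x)) := by
    have := (by fun_prop : Continuous fun s : ℝ => (ρ s, x)).tendsto 0
    rwa [h0] at this
  obtain ⟨ε, hε, hball⟩ := Metric.eventually_nhds_iff.1
    ((t.eventually h.isHolonomy).and (t.eventually h.smooth))
  have hgood : ∀ s ∈ Ioo (-ε) ε, F.IsHolonomy p x (fun y => Φ (ρ s, x, y))
      (fun y => Φ' (ρ s, x, y)) ∧ ∀ y ∈ F.coordCone p x, GermSmooth Φ (ρ s, x, y) := by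
    intro s hs
    have := hball (y := s) (by rw [Real.dist_eq, sub_zero]; exact abs_lt.2 hs)
    exact ⟨this.1, fun y hy => (this.2 y hy).1⟩
  have hΦ0 : ∀ y ∈ F.coordCone p x, Φ (0, x, y) = y := fun y hy =>
    (h.eventually_zero hx hy).self_of_nhds.1
  -- The element represented by Φ(ρ s, x, ·) is a choice. It is set to 1 at s = 0, which makes φ 0 =
  -- 1 hold by definition.
  let φ : ℝ → F.diffGroup (chartPt p x) := fun s =>
    if hs : s ≠ 0 ∧ s ∈ Ioo (-ε) ε then (hgood s hs.2).1.choose else 1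
  have hφ0 : φ 0 = 1 := by simp [φ]
  have hφ : ∀ s ∈ Ioo (-ε) ε, φ s ∈ F.holonomyGroup (chartPt p x) ∧
      F.Represents p x (φ s).1 (fun y => Φ (ρ s, x, y)) := by
    intro s hs
    by_cases hs0 : s = 0
    · subst hs0
      rw [hφ0, h0]
      exact ⟨one_mem _, (Represents.id F p x).congr hx hΦ0⟩
    · have e : φ s = (hgood s hs).1.choose := dif_pos ⟨hs0, hs⟩
      rw [e]
      exact ⟨(hgood s hs).1.choose_spec.1, (hgood s hs).1.choose_spec.2.1⟩
  have hext : ∀ s ∈ Ioo (-ε) ε, ∀ v ∈ F.cone (chartPt p x),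
      homExt (fun z => ((φ s).1 z).1) v = fromChart p x (Φ (ρ s, x, toChart p x v)) :=
    fun s hs v hv => (hφ s hs).2.homExt_eq hx hv
  have hzero : ∀ y ∈ F.coordCone p x, ∃ B : ℝ × E → E,
      ContDiff ℝ ∞ B ∧ B (0, y) = coordField ξ p x y ∧
      ∀ᶠ q in 𝓝 ((0, y) : ℝ × E), Φ (ρ q.1, x, q.2) = q.2 + q.1 • B (ρ q.1, q.2) := by
    intro y hy
    obtain ⟨A, hA, hA1, hA2⟩ := h.expansion y hy
    refine ⟨fun q => A (q.1, x, q.2), by fun_prop, hA2.self_of_nhds, ?_⟩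
    have t : Tendsto (fun q : ℝ × E => (ρ q.1, x, q.2)) (𝓝 (0, y)) (𝓝 (0, x, y)) := by
      have := (by fun_prop : Continuous fun q : ℝ × E => (ρ q.1, x, q.2)).tendsto (0, y)
      simpa only [h0] using this
    filter_upwards [t.eventually hA1] with q hq
    rw [hq, hρk]
  refine ⟨ε, hε, φ, fun s hs => (hφ s hs).1, ?_, hφ0, fun y => ?_⟩
  · have hC : ∀ q ∈ Ioo (-ε) ε ×ˢ F.coordCone p x,
        ContDiffAt ℝ 1 (fun q : ℝ × E => Φ (ρ q.1, x, q.2)) q := by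
      rintro ⟨s, y⟩ ⟨hs, hy⟩
      by_cases hs0 : s = 0
      · subst hs0
        obtain ⟨B, hB, -, hB1⟩ := hzero y hy
        have h1 := contDiff_smul_root h.ne_zero hρ hρk hρs hB
        exact (contDiffAt_snd.add h1.contDiffAt).congr_of_eventuallyEq hB1
      · have h1 := ((hgood s hs).2 y hy).contDiffAt
        have h2 : ContDiffAt ℝ ∞ (fun q : ℝ × E => (ρ q.1, x, q.2)) (s, y) :=
          (ContDiffAt.comp (f := fun q : ℝ × E => q.1) (s, y) (hρs s hs0)
            contDiffAt_fst).prodMk (contDiffAt_const.prodMk contDiffAt_snd)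
        exact (ContDiffAt.comp (f := fun q : ℝ × E => (ρ q.1, x, q.2)) (s, y) h1 h2).of_le
          (by simp)
    have hC' : ContDiffOn ℝ 1 (fun q : ℝ × E => fromChart p x (Φ (ρ q.1, x, toChart p x q.2)))
        (Ioo (-ε) ε ×ˢ F.cone (chartPt p x)) := fun q hq =>
      ((fromChart p x).contDiff.contDiffAt.comp q
        (ContDiffAt.comp (g := fun q : ℝ × E => Φ (ρ q.1, x, q.2))
          (f := fun q : ℝ × E => (q.1, toChart p x q.2)) q
          (hC (q.1, toChart p x q.2) ⟨hq.1, toChart_mem_coordCone hx hq.2⟩)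
          (by fun_prop))).contDiffWithinAt
    exact hC'.congr fun q hq => hext q.1 hq.1 q.2 hq.2
  · have hy := toChart_indicatrix_mem hx y
    obtain ⟨B, hB, hB0, hB1⟩ := hzero _ hy
    have h1 := (hasFDerivAt_smul_root h.ne_zero hρ hρk hρs hB (0, toChart p x y.1))
    have h2 : HasDerivAt (fun s : ℝ => s • B (ρ s, toChart p x y.1))
        (coordField ξ p x (toChart p x y.1)) 0 := by
      have := hasDerivAt_prodMk_left h1.differentiableAt
      rw [h1.fderiv] at this
      simpa [h0, hB0, Prod.mk_zero_zero] using this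
    have h3 := ((fromChart p x).hasFDerivAt.comp_hasDerivAt (0 : ℝ)
      (h2.const_add (toChart p x y.1)))
    have e : fromChart p x (coordField ξ p x (toChart p x y.1)) = ξ (chartPt p x) y := by
      rw [coordField_of_eq_one ξ (coordFun_toChart_indicatrix hx y), fromChart_toChart hx]
      congr 1
      exact Subtype.ext (fromChart_toChart hx _)
    rw [e] at h3
    refine h3.congr_of_eventuallyEq ?_
    have t : Tendsto (fun s : ℝ => (s, toChart p x y.1)) (𝓝 0) (𝓝 (0, toChart p x y.1)) :=
      (by fun_prop : Continuous fun s : ℝ => (s, toChart p x y.1)).tendsto 0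
    filter_upwards [t.eventually hB1, Ioo_mem_nhds (neg_lt_zero.2 hε) hε] with s h4 h5
    change _ = fromChart p x (toChart p x y.1 + s • B (ρ s, toChart p x y.1))
    rw [← h4]
    exact (fromChart_toChart hx _).symm.trans (congrArg (fromChart p x) ((hφ s h5).2.apply y))

variable [FiniteDimensional ℝ E]

/-- The infinitesimal holonomy algebra is tangent to the holonomy group. -/
theorem FibredHolonomyAlgebra.isTangentTo {ξ : F.VerticalField} (hξ : F.FibredHolonomyAlgebra ξ)
    (p : M) : F.IsTangentTo (F.holonomyGroup p) (ξ p) := by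
  obtain ⟨k, Φ, Φ', h⟩ := hξ.exists_holonomyFamily (center_mem p)
  have key : F.IsTangentTo (F.holonomyGroup (chartPt p (extChartAt 𝓘(ℝ, E) p p)))
      (ξ (chartPt p (extChartAt 𝓘(ℝ, E) p p))) := by
    -- An even order is raised by one, since only odd roots are defined on both sides of 0.
    rcases Nat.even_or_odd k with hk | hk
    · obtain ⟨Ψ, Ψ', h'⟩ := h.raise (center_mem p) 1
      exact h'.isTangentTo hk.add_one (center_mem p)
    · exact h.isTangentTo hk (center_mem p)
  rwa [chartPt_center] at key

/-- Smoothness is that of the leading coefficient of a family of holonomies. Tangency to the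
indicatrix follows from differentiating F(φ_t(y)) = 1 at t = 0 along the tangent family already
constructed. -/
theorem FibredHolonomyAlgebra.isVectorField {ξ : F.VerticalField}
    (hξ : F.FibredHolonomyAlgebra ξ) (p : M) : IsVectorField (ξ p) := by
  constructor
  · obtain ⟨k, Φ, Φ', h⟩ := hξ.exists_holonomyFamily (center_mem p)
    intro y hy
    have e : ∀ y, F.coordFun p (extChartAt 𝓘(ℝ, E) p p) y = F.val p y := fun y => by
      rw [coordFun_eq, fromChart_center, chartPt_center]
    have hy' : y ∈ F.coordCone p (extChartAt 𝓘(ℝ, E) p p) := by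
      change 0 < F.coordFun p _ y
      rw [e]
      exact hy
    have h1 := (h.germSmooth_field hy').contDiffAt
    have h2 : ContDiffAt ℝ ∞ (fun y => coordField ξ p (extChartAt 𝓘(ℝ, E) p p) y) y :=
      ContDiffAt.comp (f := fun y : E => (extChartAt 𝓘(ℝ, E) p p, y)) y h1 (by fun_prop)
    refine (h2.congr_of_eventuallyEq (Eventually.of_forall fun v => ?_)).contDiffWithinAt
    change homExt (ξ p) v = coordField ξ p (extChartAt 𝓘(ℝ, E) p p) v
    rw [coordField_eq, toChart_center, fromChart_center, chartPt_center]
  · intro y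
    obtain ⟨ε, hε, φ, -, -, hφ0, hφ⟩ := hξ.isTangentTo p
    -- Homogeneity forces F = 0 on the zero vector, so the indicatrix avoids the points where F need
    -- not be smooth.
    have hy0 : y.1 ≠ 0 := by
      intro h0
      have h1 := F.homogeneous p 0 2 two_pos
      have h2 : F.toFun ⟨p, y.1⟩ = 1 := y.2
      rw [smul_zero, ← h0, h2] at h1
      norm_num at h1
    have e : ((φ 0).1 y).1 = y.1 := by rw [hφ0]; rfl
    have h1 : HasFDerivAt (F.val p) (fderiv ℝ (F.val p) y.1) ((φ 0).1 y).1 := by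
      rw [e]
      exact (F.contDiffAt_val p hy0).differentiableAt_infty.hasFDerivAt
    have h2 := HasFDerivAt.comp_hasDerivAt (f := fun t => ((φ t).1 y).1) (0 : ℝ) h1 (hφ y)
    have h3 : (F.val p ∘ fun t => ((φ t).1 y).1) = fun _ => (1 : ℝ) :=
      funext fun t => ((φ t).1 y).2
    rw [h3] at h2
    exact h2.unique (hasDerivAt_const _ _)

end FinslerFunction

end

/-- Sums, multiples and brackets of vertical fields are taken fibre by fibre, so the closure
properties of hol_f(M) restrict to the fibre over p directly; the content lies in smoothness and
tangency. -/
theorem mainTheorem2 {E : Type*} [NormedAddCommGroup E] [NormedSpace ℝ E]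
    [FiniteDimensional ℝ E] {M : Type*} [TopologicalSpace M] [T2Space M]
    [SecondCountableTopology M] [ChartedSpace E M] [IsManifold 𝓘(ℝ, E) ∞ M]
    (F : FinslerFunction E M) (p : M) :
    F.IsLieSubalgebra (F.infinitesimalHolonomyAlgebra p) ∧
      ∀ ξ ∈ F.infinitesimalHolonomyAlgebra p, F.IsTangentTo (F.holonomyGroup p) ξ := by
  refine ⟨⟨?_, ⟨0, .zero, rfl⟩, ?_, ?_, ?_⟩, ?_⟩
  · rintro _ ⟨ξ, hξ, rfl⟩
    exact hξ.isVectorField p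
  · rintro _ ⟨ξ, hξ, rfl⟩ _ ⟨η, hη, rfl⟩
    exact ⟨ξ + η, .add ξ η hξ hη, rfl⟩
  · rintro r _ ⟨ξ, hξ, rfl⟩
    exact ⟨r • ξ, .smul r ξ hξ, rfl⟩
  · rintro _ ⟨ξ, hξ, rfl⟩ _ ⟨η, hη, rfl⟩
    exact ⟨_, .bracket ξ η hξ hη, rfl⟩
  · rintro _ ⟨ξ, hξ, rfl⟩
    exact hξ.isTangentTo p
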